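/- Let $n\ge 3$ be finite. **Notions.** $\mathsf{CA}_m$ is the class of cylindric algebras of dimension $m$. For $\mathfrak D\in\mathsf{CA}_{n+4}$, the neat reduct $\mathfrak{Nr}_n\mathfrak D$ has universe $\{x:\mathsf c_jx=x\text{ for all }n\le j<n+4\}$ and the operations of $\mathfrak D$ with indices below $n$; $S\mathfrak{Nr}_n\mathsf{CA}_{n+4}$ is the class of algebras isomorphic to a subalgebra of some $\mathfrak{Nr}_n\mathfrak D$, $\mathfrak D\in\mathsf{CA}_{n+4}$. An algebra of dimension $n$ is representable if it embeds into a product of full cylindric set algebras $\mathcal P({}^nU)$. A completion of an algebra is a complete $\mathsf{CA}_n$ in which it is a dense subalgebra. A class $K$ is atom-canonical if for every atomic $\mathfrak B\in K$ the complex algebra $\mathfrak{Cm}\,\mathrm{At}\,\mathfrak B$ of its atom structure belongs to $K$. **The rainbow algebra $\mathsf{CA}_{n+2,n+1}$.** The edge colours are the greens $g_0^i$ ($i<n+2$) and $g_j$ ($1\le j\le n-2$), the whites $w_j$ ($0\le j\le n-2$) and the reds $r_{kl}$ ($k,l<n+1$). There are also shades of yellow $y_S$, $S\subseteq\{0,\dots,n+1\}$,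 for sequences of $n-1$ nodes. A coloured graph is a complete graph $M$ with every edge coloured, where $M(x,y)=r_{kl}$ iff $M(y,x)=r_{lk}$ and the other colours are symmetric, such that: 1. There is no triangle with three green edges. There is no triangle with colours $(g_j,g_j,w_j)$, $1\le j\le n-2$, or $(g_0^i,g_0^{i'},w_0)$. If $M(x,y)=g_0^i$, $M(x,z)=g_0^{j}$ and $M(y,z)=r_{kl}$, then $i=j$ implies $k=l$ and $i\ne j$ implies $k\neq l$. If $M(x,y)=r_{ij}$, $M(y,z)=r_{j'k'}$ and $M(x,z)=r_{i^*k^*}$, then $i=i^*$, $j=j'$ and $k'=k^*$. 2. Every sequence of $n-1$ distinct nodes with no green edge among them has exactly one shade of yellow, and no other $(n-1)$-sequence has one. 3. If $d_0,\dots,d_{n-2},\delta$ are distinct nodes with $M(d_0,\delta)=g_0^i$, $M(d_j,\delta)=g_j$ for $1\le j\le n-2$ and no other green edges among them, and $(d_0,\dots,d_{n-2})$ has shade $y_S$, then $i\in S$. The atoms are the surjections $a$ from $n=\{0,\dots,n-1\}$ onto coloured graphs, up to the equivalence $a\sim b$ that holds iff $a$ and $b$ induce the same equalities, edge colours and yellow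 shades on $n$. An atom $[a]$ is in $E_{ij}$ iff $a(i)=a(j)$, and $[a]\,T_i\,[b]$ iff $a$ and $b$ induce the same equalities, edge colours and yellow shades on $n\setminus\{i\}$. $\mathsf{CA}_{n+2,n+1}$ is the (finite) complex algebra of this atom structure. **Theorem.** $\mathsf{CA}_{n+2,n+1}\notin S\mathfrak{Nr}_n\mathsf{CA}_{n+4}$. Moreover, there is an atomic representable algebra of dimension $n$ whose completion is not in $S\mathfrak{Nr}_n\mathsf{CA}_{n+4}$, and the class $S\mathfrak{Nr}_n\mathsf{CA}_{n+4}$ is not atom-canonical. -/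

import Mathlib

universe u v w

namespace Cyl

/-! ### Algebras of the cylindric similarity type of dimension `n` -/

/-- A Boolean algebra with operations `c i` (cylindrifications) and constants `d i j` (diagonals),
`i, j < n`; no equations on `c`, `d` are required at this point. -/
structure Alg (n : ℕ) : Type (u + 1) where
  carrier : Type u
  ba : BooleanAlgebra carrier
  c : Fin n → carrier → carrier
  d : Fin n → Fin n → carrier

attribute [instance] Alg.ba

/-- The axioms of `CA_n` (over a Boolean algebra). -/
structure IsCA {n : ℕ} (A : Alg.{u} n) : Prop where
  c_bot : ∀ i, A.c i ⊥ = ⊥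
  le_c : ∀ i x, x ≤ A.c i x
  c_inf_c : ∀ i x y, A.c i (x ⊓ A.c i y) = A.c i x ⊓ A.c i y
  c_comm : ∀ i j x, A.c i (A.c j x) = A.c j (A.c i x)
  d_self : ∀ i, A.d i i = ⊤
  d_eq : ∀ i j k, k ≠ i → k ≠ j → A.d i j = A.c k (A.d i k ⊓ A.d k j)
  c_d_disjoint : ∀ i j x, i ≠ j → A.c i (A.d i j ⊓ x) ⊓ A.c i (A.d i j ⊓ xᶜ) = ⊥

/-- Embeddings (injective homomorphisms; a bounded lattice homomorphism of Boolean algebras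
preserves complements). -/
structure IsEmbedding {n : ℕ} (A : Alg.{u} n) (B : Alg.{v} n)
    (f : BoundedLatticeHom A.carrier B.carrier) : Prop where
  injective : Function.Injective f
  map_c : ∀ i x, f (A.c i x) = B.c i (f x)
  map_d : ∀ i j, f (A.d i j) = B.d i j

/-- `A ∈ S Nr_n CA_{n+k}`: for some `D ∈ CA_{n+k}`, the algebra `A` is isomorphic to a subalgebra
of the neat reduct `Nr_n D`, whose universe is the set of all `x` in `D` with `c j x = x` for
`n ≤ j < n + k`, and whose operations are those of `D` with indices below `n`. -/
def SNr (n k : ℕ) (A : Alg.{v} n) : Prop :=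
  ∃ D : Alg.{u} (n + k), IsCA D ∧
    ∃ f : BoundedLatticeHom A.carrier D.carrier,
      Function.Injective f ∧
      (∀ x, ∀ j : Fin k, D.c (Fin.natAdd n j) (f x) = f x) ∧
      (∀ i x, f (A.c i x) = D.c (Fin.castAdd k i) (f x)) ∧
      (∀ i j, f (A.d i j) = D.d (Fin.castAdd k i) (Fin.castAdd k j))

/-- The full cylindric set algebra of dimension `n` with base `U`. -/
def setAlg (n : ℕ) (U : Type u) : Alg.{u} n where
  carrier := Set (Fin n → U)
  ba := inferInstance
  c i X := {s | ∃ t ∈ X, ∀ j, j ≠ i → s j = t j}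
  d i j := {s | s i = s j}

/-- Direct products. -/
def prod {n : ℕ} {ι : Type v} (A : ι → Alg.{u} n) : Alg.{max u v} n where
  carrier := ∀ l, (A l).carrier
  ba := inferInstance
  c i x := fun l => (A l).c i (x l)
  d i j := fun l => (A l).d i j

/-- `RCA_n`: the algebras isomorphic to a subalgebra of a product of full set algebras. -/
def Representable {n : ℕ} (A : Alg.{u} n) : Prop :=
  ∃ (ι : Type u) (U : ι → Type u)
    (f : BoundedLatticeHom A.carrier (prod fun l => setAlg n (U l)).carrier),
    IsEmbedding A (prod fun l => setAlg n (U l)) f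

/-! ### Atom structures, complex algebras, completions -/

/-- Atom structures of dimension `n`: accessibility relations `T i` and sets `E i j`. -/
structure AtomStr (n : ℕ) : Type (u + 1) where
  carrier : Type u
  T : Fin n → carrier → carrier → Prop
  E : Fin n → Fin n → carrier → Prop

/-- The (full) complex algebra of an atom structure. -/
def Cm {n : ℕ} (S : AtomStr.{u} n) : Alg.{u} n where
  carrier := Set S.carrier
  ba := inferInstance
  c i X := {a | ∃ b ∈ X, S.T i a b}
  d i j := {a | S.E i j a}

/-- The atom structure of an algebra. -/
def At {n : ℕ} (A : Alg.{u} n) : AtomStr.{u} n where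
  carrier := {a : A.carrier // IsAtom a}
  T i a b := a.1 ≤ A.c i b.1
  E i j a := a.1 ≤ A.d i j

/-- `C` is the (Dedekind-MacNeille) completion of `B`: a complete cylindric algebra in which `B`
is a dense subalgebra (up to isomorphism). -/
def IsCompletion {n : ℕ} (B : Alg.{u} n) (C : Alg.{v} n) : Prop :=
  IsCA C ∧ (∀ X : Set C.carrier, ∃ s, IsLUB X s) ∧
    ∃ f : BoundedLatticeHom B.carrier C.carrier, IsEmbedding B C f ∧
      ∀ y : C.carrier, y ≠ ⊥ → ∃ x : B.carrier, x ≠ ⊥ ∧ f x ≤ y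

/-- A class `K` of algebras is atom-canonical if the complex algebra of the atom structure of
every atomic member of `K` belongs to `K`. -/
def AtomCanonical {n : ℕ} (K : Alg.{u} n → Prop) : Prop :=
  ∀ B : Alg.{u} n, K B → IsAtomic B.carrier → K (Cm (At B))

/-! ### Rainbow algebras -/

/-- The colours of edges: the greens `g_0^i` (`i ∈ α`) and `g_1, …, g_{n-2}`, the whites
`w_0, …, w_{n-2}`, and the reds `r_{kl}` (`k, l ∈ β`). Here `green j` stands for `g_{j+1}`. -/
inductive Colour (n : ℕ) (α β : Type) : Type
  | green₀ (i : α)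
  | green (j : Fin (n - 2))
  | white (j : Fin (n - 1))
  | red (k l : β)

namespace Colour

variable {n : ℕ} {α β : Type}

/-- The colour of an edge read in the opposite direction. -/
def conv : Colour n α β → Colour n α β
  | red k l => red l k
  | p => p

/-- `p.IsGreen j`: the colour `p` is `g_j`, where for `j = 0` it is one of the `g_0^i`. -/
def IsGreen : Colour n α β → ℕ → Prop
  | green₀ _, j => j = 0
  | green i, j => j = i.1 + 1
  | _, _ => False

/-- `p` is some green. -/
def Green (p : Colour n α β) : Prop := ∃ j, p.IsGreen j

end Colour

/-- `{(i, k), (j, l)}` is a partial homomorphism from the graph `G` to the graph `H`. -/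
def IsPartialHom {α β : Type} (G : SimpleGraph α) (H : SimpleGraph β) (i j : α) (k l : β) : Prop :=
  (i = j → k = l) ∧ (G.Adj i j → H.Adj k l)

/-- Edges of a complete graph on `V` with colours (`edge x x` is irrelevant), together with a
partial colouring of `(n-1)`-tuples by shades of yellow `y_S`, `S ⊆ α`. -/
structure PreGraph (n : ℕ) (α β V : Type) : Type where
  edge : V → V → Colour n α β
  yellow : (Fin (n - 1) → V) → Option (Set α)

/-- `IsCone M d z i`: the nodes `d 0, …, d (n-2), z` are distinct and form an `i`-cone with apex `z`
and tint `i`, inducing the order `d 0, …, d (n-2)` on its base. -/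
def IsCone {n : ℕ} {α β V : Type} (M : PreGraph n α β V) (d : Fin (n - 1) → V) (z : V) (i : α) :
    Prop :=
  Function.Injective d ∧ (∀ j, d j ≠ z) ∧
    (∀ j, (M.edge (d j) z).IsGreen j.1) ∧
    (∀ j, j.1 = 0 → M.edge (d j) z = Colour.green₀ i) ∧
    (∀ j j', j ≠ j' → ¬ (M.edge (d j) (d j')).Green)

/-- The coloured graphs of the rainbow class given by `G` (greens) and `H` (reds). -/
structure IsColouredGraph {n : ℕ} {α β V : Type} (G : SimpleGraph α) (H : SimpleGraph β)
    (M : PreGraph n α β V) : Prop where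
  symm : ∀ x y, x ≠ y → M.edge y x = (M.edge x y).conv
  /- no triangle of three greens -/
  no_ggg : ∀ x y z, x ≠ y → x ≠ z → y ≠ z →
    ¬ ((M.edge x y).Green ∧ (M.edge x z).Green ∧ (M.edge y z).Green)
  /- no triangle `(g_j, g_j, w_j)`; for `j = 0` no triangle `(g_0^i, g_0^i', w_0)` -/
  no_ggw : ∀ x y z, x ≠ y → x ≠ z → y ≠ z → ∀ j : Fin (n - 1),
    (M.edge x y).IsGreen j.1 → (M.edge x z).IsGreen j.1 → M.edge y z ≠ Colour.white j
  /- no triangle `(g_0^i, g_0^j, r_{kl})` unless `{(i, k), (j, l)}` is a partial homomorphism -/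
  ggr : ∀ x y z, x ≠ y → x ≠ z → y ≠ z → ∀ i j k l,
    M.edge x y = Colour.green₀ i → M.edge x z = Colour.green₀ j → M.edge y z = Colour.red k l →
    IsPartialHom G H i j k l
  /- the indices in a triangle of reds match -/
  rrr : ∀ x y z, x ≠ y → x ≠ z → y ≠ z → ∀ i j j' k' i' k,
    M.edge x y = Colour.red i j → M.edge y z = Colour.red j' k' → M.edge x z = Colour.red i' k →
    i = i' ∧ j = j' ∧ k' = k
  /- exactly the sequences of distinct nodes without green edges have a shade of yellow -/
  yellow_iff : ∀ a : Fin (n - 1) → V, (M.yellow a).isSome ↔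
    Function.Injective a ∧ ∀ j j', j ≠ j' → ¬ (M.edge (a j) (a j')).Green
  yellow_shade : ∀ a S, M.yellow a = some S → S.Finite ∨ S = Set.univ
  cone : ∀ d z i S, IsCone M d z i → M.yellow d = some S → i ∈ S

/-- A surjective map from `n` onto a coloured graph (with nodes `0, …, k-1`). -/
structure Surj (n : ℕ) {α β : Type} (G : SimpleGraph α) (H : SimpleGraph β) : Type where
  k : ℕ
  graph : PreGraph n α β (Fin k)
  isColouredGraph : IsColouredGraph G H graph
  map : Fin n → Fin k
  surjective : Function.Surjective map

section

variable {n : ℕ} {α β : Type} {G : SimpleGraph α} {H : SimpleGraph β}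

/-- `a` and `b` induce the same coloured graph on the indices in `s`. -/
structure AgreeOn (s : Set (Fin n)) (a b : Surj n G H) : Prop where
  eq_iff : ∀ i ∈ s, ∀ j ∈ s, (a.map i = a.map j ↔ b.map i = b.map j)
  edge : ∀ i ∈ s, ∀ j ∈ s, a.map i ≠ a.map j →
    a.graph.edge (a.map i) (a.map j) = b.graph.edge (b.map i) (b.map j)
  yellow : ∀ t : Fin (n - 1) → Fin n, (∀ l, t l ∈ s) →
    a.graph.yellow (a.map ∘ t) = b.graph.yellow (b.map ∘ t)

theorem AgreeOn.refl (s : Set (Fin n)) (a : Surj n G H) : AgreeOn s a a :=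
  ⟨fun _ _ _ _ => Iff.rfl, fun _ _ _ _ _ => rfl, fun _ _ => rfl⟩

theorem AgreeOn.symm {s : Set (Fin n)} {a b : Surj n G H} (h : AgreeOn s a b) : AgreeOn s b a :=
  ⟨fun i hi j hj => (h.eq_iff i hi j hj).symm,
    fun i hi j hj hne => (h.edge i hi j hj fun e => hne ((h.eq_iff i hi j hj).1 e)).symm,
    fun t ht => (h.yellow t ht).symm⟩

theorem AgreeOn.trans {s : Set (Fin n)} {a b c : Surj n G H} (h : AgreeOn s a b)
    (h' : AgreeOn s b c) : AgreeOn s a c :=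
  ⟨fun i hi j hj => (h.eq_iff i hi j hj).trans (h'.eq_iff i hi j hj),
    fun i hi j hj hne => (h.edge i hi j hj hne).trans
      (h'.edge i hi j hj fun e => hne ((h.eq_iff i hi j hj).2 e)),
    fun t ht => (h.yellow t ht).trans (h'.yellow t ht)⟩

end

/-- The equivalence relation whose classes are the atoms. -/
def surjSetoid (n : ℕ) {α β : Type} (G : SimpleGraph α) (H : SimpleGraph β) :
    Setoid (Surj n G H) where
  r := AgreeOn Set.univ
  iseqv := ⟨AgreeOn.refl _, AgreeOn.symm, AgreeOn.trans⟩

/-- The rainbow atom structure of dimension `n` given by the graphs `G` (greens) and `H` (reds). -/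
def rainbowAtomStr (n : ℕ) {α β : Type} (G : SimpleGraph α) (H : SimpleGraph β) :
    AtomStr.{0} n where
  carrier := Quotient (surjSetoid n G H)
  T i x y := ∃ a b : Surj n G H, Quotient.mk _ a = x ∧ Quotient.mk _ b = y ∧ AgreeOn {i}ᶜ a b
  E i j x := ∃ a : Surj n G H, Quotient.mk _ a = x ∧ a.map i = a.map j

/-- The rainbow algebra `CA_{p,q}` of dimension `n`: greens indexed by the complete irreflexive
graph on `p` nodes, reds by the complete irreflexive graph on `q` nodes. -/
def rainbowCA (n p q : ℕ) : Alg.{0} n :=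
  Cm (rainbowAtomStr n (⊤ : SimpleGraph (Fin p)) (⊤ : SimpleGraph (Fin q)))

end Cyl

/-! ### Frames, substitutions, and labels on pairs of coordinates. -/

namespace Cyl

/-! Non-embeddability is shown in the ultrafilter frame of a hypothetical `D` of dimension `n + 4`.
A point of this frame behaves like a tuple: one coordinate can be copied to another (`sub`), and
commuting cylindrifications amalgamate points that differ in one coordinate. Suppose that the atoms
of a complex algebra carry labels with finitely many values on pairs of coordinates. The sets of
atoms with a given label then partition the unit, so every ultrafilter chooses one label for each
pair. Reading through spare coordinates extends the labels to all pairs of coordinates of `D`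
(`exists_isLabelling`), and every triple of coordinates can be moved to three fixed ones
(`exists_triple`), so each labelled triangle already occurs in an atom. Seven coordinates suffice,
and `n + 4 ≥ 7`. This is `SNr.exists_labelling`, which also lets a spare coordinate become the apex
of a cone of any tint over a given base.

For the rainbow algebra, fix an apex of tint `0`. A new apex of tint `t ≠ 0` is joined to it by a
red with two distinct indices. Amalgamating two new apexes shows that the first index does not
depend on `t` and that the second is injective in `t`. This gives `n + 2` distinct indices among `n
+ 1`.

The atomic representable algebra is not obtained from that rainbow algebra. Put `n = p + 3`. Each
sequence of `p` parameters colours the edges between the other nodes with greens of six tints,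
whites and reds; the genuine reds come as pairs of halves `(m, b)`, `m ∈ ℕ`, and a red triangle must
contain both halves of some pair or two edges of an ideal red `none`. A universal colouring of `ℕ`
exists (`exists_isUniversal`). Its relations that ignore the difference between all reds of index at
least some `N`, identified with `none`, are closed under cylindrification by a back-and-forth
argument (`exists_update`). They form a set algebra, which is atomic because `none` can be replaced
by halves of the red `N` (`exists_genuine`); atoms contain no `none`.

The completion contains all sets of atoms, hence can speak of the half `b` of a red without its
index. There are only two halves, and no triangle of genuine reds has a single half. Six apexes of
different tints over one base would be joined by a two-colouring of the complete graph on six nodes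
without monochromatic triangle, against Ramsey's `R(3,3) = 6` (`false_of_labelling`). The algebra
itself, being a set algebra on a nonempty base, does lie in `S Nr_n CA_{n+4}`, so this class is not
atom-canonical. -/

/-- Relational structures of the kind carried by the ultrafilters of a cylindric algebra. -/
structure CylFrame (ι : Type v) (F : Type u) where
  R : ι → F → F → Prop
  E : ι → ι → F → Prop
  equiv : ∀ i, Equivalence (R i)
  comm : ∀ i j U V W, R i U V → R j V W → ∃ V', R j U V' ∧ R i V' W
  E_self : ∀ i U, E i i U
  E_iff : ∀ i j k U, k ≠ i → k ≠ j → (E i j U ↔ ∃ V, R k U V ∧ E i k V ∧ E k j V)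
  unique : ∀ i j U V, i ≠ j → R i U V → E i j U → E i j V → U = V

namespace CylFrame

variable {ι : Type v} {F : Type u} (A : CylFrame ι F)

theorem E_of_R {i j k : ι} {U V : F} (hi : k ≠ i) (hj : k ≠ j) (h : A.R k U V) (hE : A.E i j U) :
    A.E i j V := by
  rw [A.E_iff i j k V hi hj]
  obtain ⟨W, hW, h1, h2⟩ := (A.E_iff i j k U hi hj).1 hE
  exact ⟨W, (A.equiv k).trans ((A.equiv k).symm h) hW, h1, h2⟩

theorem exists_sub {i j : ι} (hij : i ≠ j) (U : F) : ∃ V, A.R i U V ∧ A.E j i V ∧ A.E i j V :=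
  (A.E_iff j j i U hij hij).1 (A.E_self j U)

theorem E_symm {i j : ι} {U : F} (h : A.E i j U) : A.E j i U := by
  by_cases hij : i = j
  · subst hij; exact h
  obtain ⟨V, hV, h1, h2⟩ := A.exists_sub hij U
  rw [A.unique i j U V hij hV h h2]
  exact h1

theorem E_trans {i j k : ι} {U : F} (h : A.E i j U) (h' : A.E j k U) : A.E i k U := by
  by_cases hij : j = i
  · subst hij; exact h'
  by_cases hjk : j = k
  · subst hjk; exact h
  exact (A.E_iff i k j U hij hjk).2 ⟨U, (A.equiv j).refl U, h, h'⟩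

open Classical in
/-- The point obtained by replacing the coordinate `i` by the coordinate `j`. -/
noncomputable def sub (i j : ι) (U : F) : F :=
  -- For `i = j` the point is left unchanged, so that `R_sub` and `E_sub` need no hypothesis.
  if h : i ≠ j then (A.exists_sub h U).choose else U

variable {A}

theorem R_sub {i j : ι} (U : F) : A.R i U (A.sub i j U) := by
  unfold sub
  split_ifs with h
  · exact (A.exists_sub h U).choose_spec.1
  · exact (A.equiv i).refl U

theorem E_sub {i j : ι} (U : F) : A.E i j (A.sub i j U) := by
  unfold sub
  split_ifs with h
  · exact (A.exists_sub h U).choose_spec.2.2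
  · push Not at h; subst h; exact A.E_self i U

theorem eq_sub {i j : ι} {U V : F} (h : i ≠ j) (hR : A.R i U V) (hE : A.E i j V) :
    V = A.sub i j U :=
  A.unique i j V _ h ((A.equiv i).trans ((A.equiv i).symm hR) (R_sub U)) hE (E_sub U)

theorem sub_eq_self {i j : ι} {U : F} (hE : A.E i j U) : A.sub i j U = U := by
  by_cases h : i = j
  · simp [sub, h]
  · exact (eq_sub h ((A.equiv i).refl U) hE).symm

theorem sub_congr {i j : ι} {U V : F} (h : i ≠ j) (hR : A.R i U V) : A.sub i j U = A.sub i j V :=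
  eq_sub h ((A.equiv i).trans ((A.equiv i).symm hR) (R_sub U)) (E_sub U)

/-- Commutation moves the change at `k` past the substitution; the point so obtained still satisfies
`E i j`, because `k` differs from both, and is therefore the substituted one by uniqueness. -/
theorem sub_R_sub {i j k : ι} {U V : F} (hij : i ≠ j) (hi : k ≠ i) (hj : k ≠ j) (hR : A.R k U V) :
    A.R k (A.sub i j U) (A.sub i j V) := by
  obtain ⟨W, h1, h2⟩ := A.comm i k _ U V ((A.equiv i).symm (R_sub (j := j) U)) hR
  rw [← eq_sub hij ((A.equiv i).symm h2) (A.E_of_R hi hj h1 (E_sub U))]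
  exact h1

theorem sub_eq_sub {i j k : ι} {U : F} (hij : i ≠ j) (hik : i ≠ k) (hE : A.E j k U) :
    A.sub i j U = A.sub i k U :=
  eq_sub hik (R_sub U) (A.E_trans (E_sub U) (A.E_of_R hij hik (R_sub U) hE))

theorem sub_comm {i j k l : ι} (U : F) (hij : i ≠ j) (hkl : k ≠ l) (hik : i ≠ k) (hil : i ≠ l)
    (hkj : k ≠ j) : A.sub i j (A.sub k l U) = A.sub k l (A.sub i j U) :=
  (eq_sub hij (sub_R_sub hkl hik hil (R_sub U))
    (A.E_of_R hik.symm hkj (R_sub _) (E_sub U))).symm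

variable (A)

/-- The frame obtained by forgetting the coordinates outside the range of `φ`. -/
def comap {κ : Type w} (φ : κ → ι) (hφ : Function.Injective φ) : CylFrame κ F where
  R i := A.R (φ i)
  E i j := A.E (φ i) (φ j)
  equiv i := A.equiv (φ i)
  comm i j := A.comm (φ i) (φ j)
  E_self i := A.E_self (φ i)
  E_iff _ _ _ U hi hj := A.E_iff _ _ _ U (hφ.ne hi) (hφ.ne hj)
  unique _ _ U V h := A.unique _ _ U V (hφ.ne h)

/-- `e U p q` is the label of the pair of coordinates `p ≠ q` of the point `U`. -/
structure IsLabelling {X : Type w} (e : F → ι → ι → X) : Prop where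
  inv : ∀ k p q U V, p ≠ q → k ≠ p → k ≠ q → A.R k U V → e U p q = e V p q
  left : ∀ p p' q U, p ≠ q → p' ≠ q → A.E p p' U → e U p q = e U p' q
  right : ∀ p q q' U, p ≠ q → p ≠ q' → A.E q q' U → e U p q = e U p q'

variable {A}

section Extend

variable {X : Type w} (φ : F → X) (a b : ι)

/-- The label of the coordinates `p, q` read at the coordinates `a, b`, via spare coordinates
`s, t`. -/
noncomputable def readAt (A : CylFrame ι F) (s t p q : ι) (U : F) : X :=
  -- Copying `p` to `a` and `q` to `b` directly could overwrite a source when `{p, q}` meets `{a,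
  -- b}`; the detour through `s, t` avoids this.
  φ (A.sub b t (A.sub a s (A.sub t q (A.sub s p U))))

variable {φ a b}

/-- The value depends on the coordinates `s, t` only: `a` and `b` are overwritten, and `φ` ignores
all others. -/
theorem read_inv (hφ : ∀ k U V, k ≠ a → k ≠ b → A.R k U V → φ U = φ V) (hab : a ≠ b) {s t : ι}
    (hsa : s ≠ a) (hsb : s ≠ b) (htb : t ≠ b) {k : ι} (hks : k ≠ s) (hkt : k ≠ t)
    {U V : F} (hR : A.R k U V) :
    φ (A.sub b t (A.sub a s U)) = φ (A.sub b t (A.sub a s V)) := by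
  by_cases hka : k = a
  · subst hka; rw [sub_congr hks hR]
  by_cases hkb : k = b
  · subst hkb; rw [sub_congr hkt (sub_R_sub hsa.symm hka hks hR)]
  exact hφ k _ _ hka hkb (sub_R_sub htb.symm hkb hkt (sub_R_sub hsa.symm hka hks hR))

/-- Make both `s` and `s'` copies of `p`. Reading through either one then gives the same point, and
the unused copy can be forgotten by `read_inv`. -/
theorem readAt_congr_left (hφ : ∀ k U V, k ≠ a → k ≠ b → A.R k U V → φ U = φ V) (hab : a ≠ b)
    {s s' t p q : ι} (hsa : s ≠ a) (hsb : s ≠ b) (hsa' : s' ≠ a) (hsb' : s' ≠ b)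
    (htb : t ≠ b) (hst : s ≠ t) (hst' : s' ≠ t)
    (hsp : s ≠ p) (hsq : s ≠ q) (hsp' : s' ≠ p) (hsq' : s' ≠ q) (htp : t ≠ p) (htq : t ≠ q)
    (U : F) : readAt φ a b A s t p q U = readAt φ a b A s' t p q U := by
  by_cases hss : s = s'
  · subst hss; rfl
  unfold readAt
  set Y := A.sub t q (A.sub s p U) with hY
  have h1 : A.E s p Y := A.E_of_R hst.symm htp (R_sub _) (E_sub U)
  set Z := A.sub s' p Y with hZ
  have h2 : A.E s s' Z :=
    A.E_trans (A.E_of_R (Ne.symm hss) hsp' (R_sub _) h1) (A.E_symm (E_sub Y))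
  rw [read_inv hφ hab hsa hsb htb (Ne.symm hss) hst' (R_sub (j := p) Y), ← hZ,
    sub_eq_sub hsa.symm hsa'.symm h2]
  refine (read_inv hφ hab hsa' hsb' htb hss hst ?_).symm
  rw [hZ, hY, sub_comm U htq hsp' hst'.symm htp hsq']
  exact sub_R_sub hsp' hss hsp (sub_R_sub htq hst hsq (R_sub U))

theorem readAt_congr_right (hφ : ∀ k U V, k ≠ a → k ≠ b → A.R k U V → φ U = φ V) (hab : a ≠ b)
    {s t t' p q : ι} (hsa : s ≠ a) (hsb : s ≠ b)
    (hta : t ≠ a) (htb : t ≠ b) (hta' : t' ≠ a) (htb' : t' ≠ b) (hst : s ≠ t) (hst' : s ≠ t')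
    (htq : t ≠ q) (htq' : t' ≠ q)
    (U : F) : readAt φ a b A s t p q U = readAt φ a b A s t' p q U := by
  by_cases hss : t = t'
  · subst hss; rfl
  unfold readAt
  set Y := A.sub s p U with hY
  have h1 : A.E t q (A.sub t q Y) := E_sub Y
  set Z := A.sub t' q (A.sub t q Y) with hZ
  have h2 : A.E t t' Z :=
    A.E_trans (A.E_of_R (Ne.symm hss) htq' (R_sub _) h1) (A.E_symm (E_sub _))
  rw [read_inv hφ hab hsa hsb htb hst'.symm (Ne.symm hss) (R_sub (j := q) _), ← hZ,
    sub_eq_sub htb.symm htb'.symm (A.E_of_R hta.symm hta'.symm (R_sub _) h2)]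
  refine (read_inv hφ hab hsa hsb htb' hst.symm hss ?_).symm
  exact sub_R_sub htq' hss htq (R_sub Y)

/-- The two choices are connected by replacing `s` by `r`, then `t` by `t'`, then `r` by `s'`. The
intermediate `r` must avoid six coordinates, which is one use of the bound seven. -/
theorem readAt_congr [Fintype ι] [DecidableEq ι] (hι : 7 ≤ Fintype.card ι)
    (hφ : ∀ k U V, k ≠ a → k ≠ b → A.R k U V → φ U = φ V) (hab : a ≠ b)
    {s s' t t' p q : ι} (hs : s ∉ ({a, b, p, q} : Finset ι)) (hs' : s' ∉ ({a, b, p, q} : Finset ι))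
    (ht : t ∉ ({a, b, p, q, s} : Finset ι)) (ht' : t' ∉ ({a, b, p, q, s'} : Finset ι)) (U : F) :
    readAt φ a b A s t p q U = readAt φ a b A s' t' p q U := by
  obtain ⟨r, hr⟩ : ∃ r, r ∉ ({a, b, p, q, t, t'} : Finset ι) := by
    by_contra! h
    have h1 : (Finset.univ : Finset ι).card ≤ _ := Finset.card_le_card fun x _ => h x
    have h2 := h1.trans Finset.card_le_six
    rw [Finset.card_univ] at h2
    omega
  simp only [Finset.mem_insert, Finset.mem_singleton, not_or] at hs hs' ht ht' hr
  rw [readAt_congr_left (s' := r) hφ hab hs.1 hs.2.1 hr.1 hr.2.1 ht.2.1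
      (Ne.symm ht.2.2.2.2) hr.2.2.2.2.1 hs.2.2.1 hs.2.2.2 hr.2.2.1 hr.2.2.2.1 ht.2.2.1 ht.2.2.2.1,
    readAt_congr_right (t' := t') hφ hab hr.1 hr.2.1 ht.1 ht.2.1 ht'.1 ht'.2.1 hr.2.2.2.2.1
      hr.2.2.2.2.2 ht.2.2.2.1 ht'.2.2.2.1,
    readAt_congr_left (s' := s') hφ hab hr.1 hr.2.1 hs'.1 hs'.2.1 ht'.2.1
      hr.2.2.2.2.2 (Ne.symm ht'.2.2.2.2) hr.2.2.1 hr.2.2.2.1 hs'.2.2.1 hs'.2.2.2 ht'.2.2.1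
      ht'.2.2.2.1]

theorem exists_notMem [Fintype ι] {k : ℕ} (hι : k < Fintype.card ι) (S : Finset ι)
    (hS : S.card ≤ k) : ∃ r, r ∉ S := by
  by_contra! h
  have h1 : (Finset.univ : Finset ι).card ≤ S.card := Finset.card_le_card fun x _ => h x
  rw [Finset.card_univ] at h1
  omega

/-- A function of the points that depends on the coordinates `a, b` only, read at all pairs of
coordinates. -/
theorem exists_isLabelling [Fintype ι] (hι : 7 ≤ Fintype.card ι)
    (hφ : ∀ k U V, k ≠ a → k ≠ b → A.R k U V → φ U = φ V) (hab : a ≠ b) :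
    ∃ e : F → ι → ι → X, A.IsLabelling e ∧ ∀ U, e U a b = φ U := by
  classical
  have hsp : ∀ p q : ι, ∃ s, s ∉ ({a, b, p, q} : Finset ι) := fun p q =>
    exists_notMem (k := 4) (by omega) _ Finset.card_le_four
  choose s hs using hsp
  have htp : ∀ p q : ι, ∃ t, t ∉ ({a, b, p, q, s p q} : Finset ι) := fun p q =>
    exists_notMem (k := 5) (by omega) _ Finset.card_le_five
  choose t ht using htp
  have key : ∀ {p q s' t' : ι} (U : F), s' ∉ ({a, b, p, q} : Finset ι) →
      t' ∉ ({a, b, p, q, s'} : Finset ι) →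
      readAt φ a b A (s p q) (t p q) p q U = readAt φ a b A s' t' p q U :=
    fun U h h' => readAt_congr hι hφ hab (hs _ _) h (ht _ _) h' U
  refine ⟨fun U p q => readAt φ a b A (s p q) (t p q) p q U, ⟨?_, ?_, ?_⟩, ?_⟩
  · intro k p q U V hpq hkp hkq hR
    have h1 := hs p q
    have h2 := ht p q
    simp only [Finset.mem_insert, Finset.mem_singleton, not_or] at h1 h2
    show φ _ = φ _
    by_cases hks : k = s p q
    · subst hks; rw [sub_congr hkp hR]
    by_cases hkt : k = t p q
    · rw [sub_congr (i := t p q) h2.2.2.2.1 (hkt ▸ sub_R_sub h1.2.2.1 hks hkp hR)]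
    exact read_inv hφ hab h1.1 h1.2.1 h2.2.1 hks hkt
      (sub_R_sub h2.2.2.2.1 hkt hkq (sub_R_sub h1.2.2.1 hks hkp hR))
  · intro p p' q U hp hp' hE
    -- Spare coordinates that avoid both `p` and `p'` read both labels in the same way, so the two
    -- substituted points coincide.
    obtain ⟨s', hs'⟩ := exists_notMem (k := 5) (by omega) ({a, b, p, p', q} : Finset ι)
      Finset.card_le_five
    obtain ⟨t', ht'⟩ := exists_notMem (k := 6) (by omega) ({a, b, p, p', q, s'} : Finset ι)
      Finset.card_le_six
    simp only [Finset.mem_insert, Finset.mem_singleton, not_or] at hs' ht'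
    show readAt φ a b A _ _ _ _ _ = readAt φ a b A _ _ _ _ _
    rw [key (s' := s') (t' := t') U (by simp; tauto) (by simp; tauto),
      key (s' := s') (t' := t') U (by simp; tauto) (by simp; tauto)]
    unfold readAt
    rw [sub_eq_sub hs'.2.2.1 hs'.2.2.2.1 hE]
  · intro p q q' U hp hp' hE
    obtain ⟨s', hs'⟩ := exists_notMem (k := 5) (by omega) ({a, b, p, q, q'} : Finset ι)
      Finset.card_le_five
    obtain ⟨t', ht'⟩ := exists_notMem (k := 6) (by omega) ({a, b, p, q, q', s'} : Finset ι)
      Finset.card_le_six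
    simp only [Finset.mem_insert, Finset.mem_singleton, not_or] at hs' ht'
    show readAt φ a b A _ _ _ _ _ = readAt φ a b A _ _ _ _ _
    rw [key (s' := s') (t' := t') U (by simp; tauto) (by simp; tauto),
      key (s' := s') (t' := t') U (by simp; tauto) (by simp; tauto)]
    unfold readAt
    rw [sub_eq_sub ht'.2.2.2.1 ht'.2.2.2.2.1
      (A.E_of_R hs'.2.2.2.1 hs'.2.2.2.2 (R_sub _) hE)]
  · intro U
    have h1 := hs a b
    have h2 := ht a b
    simp only [Finset.mem_insert, Finset.mem_singleton, not_or] at h1 h2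
    show φ _ = φ _
    set Y := A.sub (t a b) b (A.sub (s a b) a U) with hY
    have hE1 : A.E a (s a b) Y :=
      A.E_symm (A.E_of_R h2.2.2.2.2 h2.1 (R_sub _) (E_sub U))
    have hE2 : A.E b (t a b) Y := A.E_symm (E_sub _)
    rw [sub_eq_self hE1, sub_eq_self hE2, hY, ← hφ _ _ _ h2.1 h2.2.1 (R_sub _),
      ← hφ _ _ _ h1.1 h1.2.1 (R_sub _)]

end Extend

namespace IsLabelling

variable {X : Type w} {e : F → ι → ι → X}

theorem sub_left (h : A.IsLabelling e) {k l q : ι} (hkq : k ≠ q) (hlq : l ≠ q) (hkl : k ≠ l)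
    (U : F) : e (A.sub k l U) k q = e U l q := by
  rw [h.left k l q _ hkq hlq (E_sub U)]
  exact (h.inv k l q _ _ hlq hkl hkq (R_sub U)).symm

theorem sub_right (h : A.IsLabelling e) {k l p : ι} (hkp : k ≠ p) (hlp : l ≠ p) (hkl : k ≠ l)
    (U : F) : e (A.sub k l U) p k = e U p l := by
  rw [h.right p k l _ hkp.symm hlp.symm (E_sub U)]
  exact (h.inv k p l _ _ hlp.symm hkp hkl (R_sub U)).symm

theorem sub_other (h : A.IsLabelling e) {k l p q : ι} (hpq : p ≠ q) (hp : k ≠ p) (hq : k ≠ q)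
    (U : F) : e (A.sub k l U) p q = e U p q :=
  (h.inv k p q _ _ hpq hp hq (R_sub U)).symm

/-- A triple of coordinates can be moved by one step. -/
theorem move (h : A.IsLabelling e) {k l q r : ι} (hlq : l ≠ q) (hlr : l ≠ r) (hqr : q ≠ r)
    (hkl : k ≠ l) (hkq : k ≠ q) (hkr : k ≠ r) (U : F) :
    ∃ V, e V k q = e U l q ∧ e V k r = e U l r ∧ e V q r = e U q r ∧
      e V q k = e U q l ∧ e V r k = e U r l ∧ e V r q = e U r q :=
  ⟨A.sub k l U, h.sub_left hkq hlq hkl U, h.sub_left hkr hlr hkl U, h.sub_other hqr hkq hkr U,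
    h.sub_right hkq hlq hkl U, h.sub_right hkr hlr hkl U, h.sub_other hqr.symm hkr hkq U⟩

/-- Six moves `p → s`, `q → t`, `r → z`, `s → a`, `t → b`, `z → c` through spare coordinates; the
detour allows `{p, q, r}` and `{a, b, c}` to overlap. Consequently any constraint on the labels of
one fixed triple holds for all triples. -/
theorem exists_triple [Fintype ι] (hι : 7 ≤ Fintype.card ι) (h : A.IsLabelling e)
    {a b c p q r : ι} (hab : a ≠ b) (hac : a ≠ c) (hbc : b ≠ c) (hpq : p ≠ q) (hpr : p ≠ r)
    (hqr : q ≠ r) (U : F) :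
    ∃ V, e V a b = e U p q ∧ e V a c = e U p r ∧ e V b c = e U q r := by
  classical
  obtain ⟨s, hs⟩ := exists_notMem (k := 6) (by omega) ({a, b, c, p, q, r} : Finset ι)
    Finset.card_le_six
  obtain ⟨t, ht⟩ := exists_notMem (k := 6) (by omega) ({a, b, c, s, q, r} : Finset ι)
    Finset.card_le_six
  obtain ⟨z, hz⟩ := exists_notMem (k := 6) (by omega) ({a, b, c, s, t, r} : Finset ι)
    Finset.card_le_six
  simp only [Finset.mem_insert, Finset.mem_singleton, not_or, ← ne_eq] at hs ht hz
  obtain ⟨sa, sb, sc, sp, sq, sr⟩ := hs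
  obtain ⟨ta, tb, tc, ts, tq, tr⟩ := ht
  obtain ⟨za, zb, zc, zs, zt, zr⟩ := hz
  obtain ⟨V1, a1, a2, a3, -, -, -⟩ := h.move hpq hpr hqr sp sq sr U
  obtain ⟨V2, -, b2, b3, b1, -, -⟩ := h.move sq.symm hqr sr tq ts tr V1
  obtain ⟨V3, -, -, c1, c2, c3, -⟩ := h.move sr.symm tr.symm ts.symm zr zs zt V2
  obtain ⟨V4, d1, d2, d3, -, -, -⟩ := h.move ts.symm zs.symm zt.symm sa.symm ta.symm za.symm V3
  obtain ⟨V5, -, f2, f3, f1, -, -⟩ := h.move ta zt.symm za.symm tb.symm hab.symm zb.symm V4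
  obtain ⟨V6, -, -, g1, g2, g3, -⟩ := h.move za zb hab zc.symm hac.symm hbc.symm V5
  exact ⟨V6, by rw [g1, f1, d1, c1, b1, a1], by rw [g2, f3, d2, c2, b3, a2],
    by rw [g3, f2, d3, c3, b2, a3]⟩

end IsLabelling

end CylFrame

end Cyl

/-! ### The ultrafilter frame of a cylindric algebra, and labels read in a neat embedding. -/

namespace Cyl

/-- Ultrafilters of a Boolean algebra. -/
structure UltraPt (B : Type u) [BooleanAlgebra B] where
  carrier : Set B
  top_mem : ⊤ ∈ carrier
  inf_mem_iff : ∀ x y, x ⊓ y ∈ carrier ↔ x ∈ carrier ∧ y ∈ carrier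
  compl_mem_iff : ∀ x, xᶜ ∈ carrier ↔ x ∉ carrier

namespace UltraPt

variable {B : Type u} [BooleanAlgebra B]

instance : Membership B (UltraPt B) := ⟨fun U x => x ∈ U.carrier⟩

theorem inf_mem {U : UltraPt B} {x y : B} (hx : x ∈ U) (hy : y ∈ U) : x ⊓ y ∈ U :=
  (U.inf_mem_iff x y).2 ⟨hx, hy⟩

theorem mem_of_le {U : UltraPt B} {x y : B} (h : x ≤ y) (hx : x ∈ U) : y ∈ U := by
  rw [← inf_eq_left.2 h] at hx
  exact ((U.inf_mem_iff x y).1 hx).2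

theorem compl_mem {U : UltraPt B} {x : B} : xᶜ ∈ U ↔ x ∉ U := U.compl_mem_iff x

theorem bot_notMem (U : UltraPt B) : (⊥ : B) ∉ U := by
  rw [← compl_mem, compl_bot]
  exact U.top_mem

theorem sup_mem {U : UltraPt B} {x y : B} : x ⊔ y ∈ U ↔ x ∈ U ∨ y ∈ U := by
  constructor
  · intro h
    by_contra! h'
    have := inf_mem h (inf_mem (compl_mem.2 h'.1) (compl_mem.2 h'.2))
    rw [← compl_sup, inf_compl_eq_bot] at this
    exact U.bot_notMem this
  · rintro (h | h)
    exacts [mem_of_le le_sup_left h, mem_of_le le_sup_right h]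

theorem ext_of_subset {U V : UltraPt B} (h : ∀ x ∈ U, x ∈ V) : U = V := by
  have : U.carrier = V.carrier := by
    refine Set.Subset.antisymm h fun x hx => ?_
    by_contra hx'
    exact (compl_mem (U := V)).1 (h _ (compl_mem.2 hx')) hx
  cases U; cases V; congr

theorem exists_of_base (S : Set B) (hne : S.Nonempty) (hinf : ∀ x ∈ S, ∀ y ∈ S, x ⊓ y ∈ S)
    (hbot : ⊥ ∉ S) : ∃ U : UltraPt B, ∀ x ∈ S, x ∈ U := by
  have hF : Order.IsPFilter {x : B | ∃ s ∈ S, s ≤ x} := by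
    refine Order.IsPFilter.of_def ?_ ?_ ?_
    · obtain ⟨s, hs⟩ := hne
      exact ⟨s, s, hs, le_rfl⟩
    · rintro x ⟨s, hs, hsx⟩ y ⟨t, ht, hty⟩
      exact ⟨s ⊓ t, ⟨s ⊓ t, hinf s hs t ht, le_rfl⟩, inf_le_left.trans hsx,
        inf_le_right.trans hty⟩
    · rintro x y hxy ⟨s, hs, hsx⟩
      exact ⟨s, hs, hsx.trans hxy⟩
  obtain ⟨J, hJ, hJb, hJF⟩ := DistribLattice.prime_ideal_of_disjoint_filter_ideal
    (F := hF.toPFilter) (I := (⊥ : Order.Ideal B)) (by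
      rw [Set.disjoint_left]
      rintro x ⟨s, hs, hsx⟩ hx
      have h1 : x = ⊥ := le_bot_iff.1 hx
      have h2 : s = ⊥ := le_bot_iff.1 (h1 ▸ hsx)
      exact hbot (h2 ▸ hs))
  refine ⟨⟨(J : Set B)ᶜ, ?_, ?_, ?_⟩, ?_⟩
  · exact hJ.toIsProper.top_notMem
  · intro x y
    simp only [Set.mem_compl_iff, SetLike.mem_coe]
    constructor
    · exact fun h => ⟨fun hx => h (J.lower inf_le_left hx), fun hy => h (J.lower inf_le_right hy)⟩
    · rintro ⟨hx, hy⟩ h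
      exact (hJ.mem_or_mem h).elim hx hy
  · intro x
    simp only [Set.mem_compl_iff, SetLike.mem_coe, not_not]
    constructor
    · intro h
      exact (hJ.mem_or_compl_mem (x := x)).resolve_right h
    · intro h h'
      have := J.sup_mem h h'
      rw [sup_compl_eq_top] at this
      exact hJ.toIsProper.top_notMem this
  · intro x hx hxJ
    exact Set.disjoint_left.1 hJF ⟨x, hx, le_rfl⟩ hxJ

theorem exists_mem {x : B} (hx : x ≠ ⊥) : ∃ U : UltraPt B, x ∈ U := by
  obtain ⟨U, hU⟩ := exists_of_base {x} ⟨x, rfl⟩ (by rintro _ rfl _ rfl; simp)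
    (by simpa using hx.symm)
  exact ⟨U, hU x rfl⟩

end UltraPt

namespace IsCA

variable {n : ℕ} {A : Alg.{u} n} (h : IsCA A)

include h

theorem c_mono (i : Fin n) {x y : A.carrier} (hxy : x ≤ y) : A.c i x ≤ A.c i y := by
  have := h.c_inf_c i x y
  rw [inf_eq_left.2 (hxy.trans (h.le_c i y))] at this
  rw [this]
  exact inf_le_right

theorem c_c (i : Fin n) (x : A.carrier) : A.c i (A.c i x) = A.c i x := by
  have := h.c_inf_c i ⊤ x
  rwa [top_inf_eq, inf_eq_right.2 (le_top.trans (h.le_c i ⊤))] at this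

theorem c_compl_c (i : Fin n) (x : A.carrier) : A.c i (A.c i x)ᶜ = (A.c i x)ᶜ := by
  refine le_antisymm ?_ (h.le_c i _)
  rw [le_compl_iff_disjoint_right, disjoint_iff, ← h.c_inf_c, compl_inf_eq_bot, h.c_bot]

theorem c_inf_of_closed (i : Fin n) {x y : A.carrier} (hx : A.c i x = x) (hy : A.c i y = y) :
    A.c i (x ⊓ y) = x ⊓ y := by
  have := h.c_inf_c i x y
  rwa [hx, hy] at this

theorem c_inf_eq_bot (i : Fin n) {x y : A.carrier} (hy : A.c i y = y) (hxy : x ⊓ y = ⊥) :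
    A.c i x ⊓ y = ⊥ := by
  have := h.c_inf_c i x y
  rw [hy, hxy, h.c_bot] at this
  exact this.symm

omit h in
/-- The relation between ultrafilters that contain the same `c i`-closed elements. -/
theorem agree_of_imp (h : IsCA A) (i : Fin n) {U V : UltraPt A.carrier}
    (hUV : ∀ x, A.c i x = x → x ∈ U → x ∈ V) (x : A.carrier) : A.c i x ∈ U ↔ A.c i x ∈ V := by
  refine ⟨hUV _ (h.c_c i x), fun hV => ?_⟩
  by_contra hU
  exact UltraPt.compl_mem.1 (hUV _ (h.c_compl_c i x) (UltraPt.compl_mem.2 hU)) hV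

/-- The meets of `x` with the `c i`-closed elements of `U` have the finite intersection property: if
`x ⊓ y = ⊥` with `y` closed, then `c i x ⊓ y = ⊥`. -/
theorem exists_point (i : Fin n) {x : A.carrier} {U : UltraPt A.carrier} (hx : A.c i x ∈ U) :
    ∃ V : UltraPt A.carrier, (∀ y, A.c i y ∈ U ↔ A.c i y ∈ V) ∧ x ∈ V := by
  obtain ⟨V, hV⟩ := UltraPt.exists_of_base {z | ∃ y ∈ U, A.c i y = y ∧ z = x ⊓ y}
    ⟨x ⊓ ⊤, ⊤, U.top_mem, top_le_iff.1 (h.le_c i ⊤), rfl⟩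
    (by
      rintro _ ⟨y, hy, hyc, rfl⟩ _ ⟨z, hz, hzc, rfl⟩
      exact ⟨y ⊓ z, UltraPt.inf_mem hy hz, h.c_inf_of_closed i hyc hzc, by
        rw [inf_inf_inf_comm, inf_idem]⟩)
    (by
      rintro ⟨y, hy, hyc, hbot⟩
      have := h.c_inf_eq_bot i hyc hbot.symm
      exact U.bot_notMem (this ▸ UltraPt.inf_mem hx hy))
  refine ⟨V, h.agree_of_imp i fun y hyc hy => ?_, ?_⟩
  · exact UltraPt.mem_of_le inf_le_right (hV _ ⟨y, hy, hyc, rfl⟩)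
  · exact UltraPt.mem_of_le inf_le_left (hV _ ⟨⊤, U.top_mem, top_le_iff.1 (h.le_c i ⊤), rfl⟩)

/-- The ultrafilter frame of a cylindric algebra. -/
def frame : CylFrame (Fin n) (UltraPt A.carrier) where
  R i U V := ∀ x, A.c i x ∈ U ↔ A.c i x ∈ V
  E i j U := A.d i j ∈ U
  equiv i := ⟨fun _ _ => Iff.rfl, fun h x => (h x).symm, fun h h' x => (h x).trans (h' x)⟩
  comm i j U V W hUV hVW := by
    -- `V'` must contain the `c j`-closed elements of `U` and the `c i`-closed elements of `W`. If
    -- such `x` and `y` were disjoint, `x` would be disjoint from `c j y`; but `c j y = c j (c i y)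
    -- = c i (c j y)` belongs to `U`.
    obtain ⟨V', hV'⟩ := UltraPt.exists_of_base
      {z | ∃ x ∈ U, A.c j x = x ∧ ∃ y ∈ W, A.c i y = y ∧ z = x ⊓ y}
      ⟨⊤ ⊓ ⊤, ⊤, U.top_mem, top_le_iff.1 (h.le_c j ⊤), ⊤, W.top_mem, top_le_iff.1 (h.le_c i ⊤),
        rfl⟩
      (by
        rintro _ ⟨x, hx, hxc, y, hy, hyc, rfl⟩ _ ⟨x', hx', hxc', y', hy', hyc', rfl⟩
        exact ⟨x ⊓ x', UltraPt.inf_mem hx hx', h.c_inf_of_closed j hxc hxc', y ⊓ y',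
          UltraPt.inf_mem hy hy', h.c_inf_of_closed i hyc hyc', inf_inf_inf_comm _ _ _ _⟩)
      (by
        rintro ⟨x, hx, hxc, y, hy, hyc, hbot⟩
        rw [eq_comm, inf_comm] at hbot
        have h1 := h.c_inf_eq_bot j hxc hbot
        have h2 : A.c i (A.c j y) ∈ U :=
          (hUV _).2 (UltraPt.mem_of_le (h.le_c i _) ((hVW y).2 (UltraPt.mem_of_le (h.le_c j y) hy)))
        rw [h.c_comm, hyc] at h2
        exact U.bot_notMem (h1 ▸ UltraPt.inf_mem h2 hx))
    refine ⟨V', h.agree_of_imp j fun x hxc hx => ?_,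
      fun z => (h.agree_of_imp i (fun y hyc hy => ?_) z).symm⟩
    · exact UltraPt.mem_of_le inf_le_left
        (hV' _ ⟨x, hx, hxc, ⊤, W.top_mem, top_le_iff.1 (h.le_c i ⊤), rfl⟩)
    · exact UltraPt.mem_of_le inf_le_right
        (hV' _ ⟨⊤, U.top_mem, top_le_iff.1 (h.le_c j ⊤), y, hy, hyc, rfl⟩)
  E_self i U := by rw [h.d_self]; exact U.top_mem
  E_iff i j k U hi hj := by
    rw [h.d_eq i j k hi hj]
    constructor
    · intro hU
      obtain ⟨V, hV, hd⟩ := h.exists_point k hU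
      exact ⟨V, hV, (V.inf_mem_iff _ _).1 hd⟩
    · rintro ⟨V, hV, h1, h2⟩
      exact (hV _).2 (UltraPt.mem_of_le (h.le_c k _) (UltraPt.inf_mem h1 h2))
  unique i j U V hij hUV hU hV := by
    refine UltraPt.ext_of_subset fun x hx => ?_
    by_contra hx'
    have h1 : A.c i (A.d i j ⊓ x) ∈ V :=
      (hUV _).1 (UltraPt.mem_of_le (h.le_c i _) (UltraPt.inf_mem hU hx))
    have h2 : A.c i (A.d i j ⊓ xᶜ) ∈ V :=
      UltraPt.mem_of_le (h.le_c i _) (UltraPt.inf_mem hV (UltraPt.compl_mem.2 hx'))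
    exact V.bot_notMem (h.c_d_disjoint i j x hij ▸ UltraPt.inf_mem h1 h2)

end IsCA

/-- Labels of the pairs of coordinates of the atoms, read in an algebra of larger dimension in which
the complex algebra is neatly embedded. The atoms `atoms t` differ in one coordinate only. -/
theorem SNr.exists_labelling {n m : ℕ} {S : AtomStr.{v} n} (hS : SNr.{u, v} n m (Cm S))
    {ι : Type} [Fintype ι] (hι : 7 ≤ Fintype.card ι) {φ : ι → Fin (n + m)}
    (hφ : Function.Injective φ) {κ : Type} {inn : κ → ι} (hinn : Function.Injective inn)
    {pos : κ → Fin n} (hpos : ∀ x, φ (inn x) = Fin.castAdd m (pos x))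
    (hout : ∀ i, (∀ x, inn x ≠ i) → ∃ j, φ i = Fin.natAdd n j)
    {k₀ k₁ k₂ : κ} (h₀₁ : k₀ ≠ k₁) (h₀₂ : k₀ ≠ k₂) (h₁₂ : k₁ ≠ k₂)
    {X : Type} [Finite X] (lab : S.carrier → κ → κ → X)
    (hT : ∀ z x y a b, x ≠ y → z ≠ x → z ≠ y → S.T (pos z) a b → lab a x y = lab b x y)
    (hl : ∀ x x' y a, x ≠ y → x' ≠ y → S.E (pos x) (pos x') a → lab a x y = lab a x' y)
    (hr : ∀ x y y' a, x ≠ y → x ≠ y' → S.E (pos y) (pos y') a → lab a x y = lab a x y')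
    (z : κ) {τ : Type} (atoms : τ → S.carrier) (t₀ : τ)
    (hrefl : S.T (pos z) (atoms t₀) (atoms t₀))
    (htrans : ∀ a t, S.T (pos z) a (atoms t₀) → S.T (pos z) a (atoms t)) :
    ∃ (F : Type u) (A : CylFrame ι F) (e : F → ι → ι → X), A.IsLabelling e ∧
      (∀ U p q r, p ≠ q → p ≠ r → q ≠ r →
        ∃ a, lab a k₀ k₁ = e U p q ∧ lab a k₀ k₂ = e U p r ∧ lab a k₁ k₂ = e U q r) ∧
      ∃ U, (∀ x, x ≠ z → e U (inn x) (inn z) = lab (atoms t₀) x z) ∧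
        ∀ i, (∀ x, inn x ≠ i) → ∀ t, ∃ V, A.R i U V ∧
          ∀ x, x ≠ z → e V (inn x) i = lab (atoms t) x z := by
  classical
  obtain ⟨D, hD, f, hf, hfn, hfc, hfd⟩ := hS
  obtain ⟨g, hginj, hgbot, hgtop, hginf, hgsup, hgn, hgc, hgd⟩ :
      ∃ g : Set S.carrier → D.carrier, Function.Injective g ∧ g ∅ = ⊥ ∧ g Set.univ = ⊤ ∧
        (∀ P Q, g (P ∩ Q) = g P ⊓ g Q) ∧ (∀ P Q, g (P ∪ Q) = g P ⊔ g Q) ∧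
        (∀ P j, D.c (Fin.natAdd n j) (g P) = g P) ∧
        (∀ i P, g {a | ∃ b ∈ P, S.T i a b} = D.c (Fin.castAdd m i) (g P)) ∧
        ∀ i j, g {a | S.E i j a} = D.d (Fin.castAdd m i) (Fin.castAdd m j) :=
    ⟨fun P => f P, hf, map_bot f, map_top f, fun P Q => map_inf f (show (Cm S).carrier from P) Q,
      fun P Q => map_sup f (show (Cm S).carrier from P) Q, hfn, hfc, hfd⟩
  clear hf hfn hfc hfd f
  let A : CylFrame ι (UltraPt D.carrier) := hD.frame.comap φ hφ
  have mono : ∀ {P Q : Set S.carrier} {U : UltraPt D.carrier}, P ⊆ Q → g P ∈ U → g Q ∈ U :=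
    by
    intro P Q U hPQ h
    rw [← Set.inter_eq_left.2 hPQ, hginf] at h
    exact UltraPt.mem_of_le inf_le_right h
  have ne : ∀ {P : Set S.carrier} {U : UltraPt D.carrier}, g P ∈ U → P.Nonempty := by
    intro P U h
    rw [Set.nonempty_iff_ne_empty]
    rintro rfl
    exact U.bot_notMem (hgbot ▸ h)
  have inter : ∀ {P Q : Set S.carrier} {U : UltraPt D.carrier}, g P ∈ U → g Q ∈ U →
      g (P ∩ Q : Set S.carrier) ∈ U := by
    intro P Q U h h'
    rw [hginf]
    exact UltraPt.inf_mem h h'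
  -- Finiteness of `X` enters here: an ultrafilter selects a member of a finite partition of the
  -- unit.
  have hex : ∀ (U : UltraPt D.carrier) (x y : κ), ∃ l, g {a | lab a x y = l} ∈ U := by
    intro U x y
    by_contra! hno
    have hfin : ∀ T : Set X, T.Finite → g {a | lab a x y ∈ T} ∉ U := by
      intro T hTf
      induction T, hTf using Set.Finite.induction_on with
      | empty => exact fun h => (ne h).elim fun a ha => ha
      | insert _ _ ih =>
        rename_i l T _ _
        intro h
        have : g {a | lab a x y ∈ insert l T} = g {a | lab a x y = l} ⊔ g {a | lab a x y ∈ T} :=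
          hgsup {a | lab a x y = l} {a | lab a x y ∈ T}
        rw [this, UltraPt.sup_mem] at h
        exact h.elim (hno l) ih
    refine hfin Set.univ Set.finite_univ ?_
    have : g {a | lab a x y ∈ Set.univ} = ⊤ := by
      rw [← hgtop]
      simp
    rw [this]
    exact U.top_mem
  choose e₀ he₀ using hex
  have huniq : ∀ {U x y l}, g {a | lab a x y = l} ∈ U → e₀ U x y = l := by
    intro U x y l h
    obtain ⟨a, h1, h2⟩ := ne (inter (he₀ U x y) h)
    exact h1.symm.trans h2
  have hinv : ∀ (i : ι) x y U V, x ≠ y → i ≠ inn x → i ≠ inn y → A.R i U V →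
      e₀ U x y = e₀ V x y := by
    intro i x y U V hxy hx hy hR
    refine (huniq ?_).symm
    -- At a coordinate of the small algebra the invariance is that of the atoms' labels, by `hT`; at
    -- a spare coordinate it is the neatness of the embedding.
    by_cases hi : ∃ w, inn w = i
    · obtain ⟨w, rfl⟩ := hi
      have h1 : g {a | ∃ b ∈ {a | lab a x y = e₀ U x y}, S.T (pos w) a b} ∈ V := by
        rw [hgc, ← hpos]
        refine (hR _).1 (UltraPt.mem_of_le (hD.le_c _ _) (he₀ U x y))
      refine mono ?_ h1
      rintro a ⟨b, hb, hab⟩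
      exact (hT w x y a b hxy (fun h => hx (h ▸ rfl)) (fun h => hy (h ▸ rfl)) hab).trans hb
    · push Not at hi
      obtain ⟨j, hj⟩ := hout i hi
      have h1 := he₀ U x y
      rw [← hgn _ j, ← hj] at h1 ⊢
      exact (hR _).1 h1
  obtain ⟨e, he, hee⟩ := CylFrame.exists_isLabelling (A := A) (φ := fun U => e₀ U k₀ k₁)
    (a := inn k₀) (b := inn k₁) hι
    (fun k U V h h' hR => hinv k k₀ k₁ U V h₀₁ h h' hR) (hinn.ne h₀₁)
  have hE : ∀ {x y : κ} {U}, A.E (inn x) (inn y) U → g {a | S.E (pos x) (pos y) a} ∈ U := by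
    intro x y U h
    have h1 : D.d (φ (inn x)) (φ (inn y)) ∈ U := h
    rw [hpos, hpos, ← hgd] at h1
    exact h1
  have agl : ∀ x y x', x ≠ y → x' ≠ y → (∀ U, e U (inn x) (inn y) = e₀ U x y) →
      ∀ U, e U (inn x') (inn y) = e₀ U x' y := by
    intro x y x' hxy hx'y h U
    by_cases hxx : x = x'
    · subst hxx; exact h U
    rw [← he.sub_left (hinn.ne hxy) (hinn.ne hx'y) (hinn.ne hxx), h,
      hinv (inn x) x' y U _ hx'y (hinn.ne hxx) (hinn.ne hxy) (CylFrame.R_sub U)]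
    refine huniq (mono ?_ (inter (hE (CylFrame.E_sub (A := A) (i := inn x) (j := inn x') U))
      (he₀ _ x' y)))
    rintro a ⟨h1, h2⟩
    exact (hl x x' y a hxy hx'y h1).trans h2
  have agr : ∀ x y y', x ≠ y → x ≠ y' → (∀ U, e U (inn x) (inn y) = e₀ U x y) →
      ∀ U, e U (inn x) (inn y') = e₀ U x y' := by
    intro x y y' hxy hxy' h U
    by_cases hyy : y = y'
    · subst hyy; exact h U
    rw [← he.sub_right (hinn.ne hxy.symm) (hinn.ne hxy'.symm) (hinn.ne hyy), h,
      hinv (inn y) x y' U _ hxy' (hinn.ne hxy.symm) (hinn.ne hyy) (CylFrame.R_sub U)]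
    refine huniq (mono ?_ (inter (hE (CylFrame.E_sub (A := A) (i := inn y) (j := inn y') U))
      (he₀ _ x y')))
    rintro a ⟨h1, h2⟩
    exact (hr x y y' a hxy hxy' h1).trans h2
  -- The extended labelling was built from the pair `(k₀, k₁)` alone. Agreement with the labels of
  -- the atoms spreads by changing one entry of the pair at a time without making the entries equal,
  -- so a third index `k₂` is needed to reach pairs beginning with `k₁`.
  have hag : ∀ x y, x ≠ y → ∀ U, e U (inn x) (inn y) = e₀ U x y := by
    intro x y hxy
    by_cases hx : x = k₁
    · subst hx
      by_cases hy : y = k₂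
      · subst hy
        exact agl k₀ y x h₀₂ h₁₂ (agr k₀ x y h₀₁ h₀₂ hee)
      · exact agl k₂ y x (Ne.symm hy) hxy
          (agr k₂ x y h₁₂.symm (Ne.symm hy) (agl k₀ x k₂ h₀₁ h₁₂.symm hee))
    · exact agr x k₁ y hx hxy (agl k₀ k₁ x h₀₁ hx hee)
  refine ⟨_, A, e, he, ?_, ?_⟩
  · intro U p q r hpq hpr hqr
    obtain ⟨V, h1, h2, h3⟩ := he.exists_triple hι (hinn.ne h₀₁) (hinn.ne h₀₂) (hinn.ne h₁₂)
      hpq hpr hqr U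
    rw [hag _ _ h₀₁] at h1
    rw [hag _ _ h₀₂] at h2
    rw [hag _ _ h₁₂] at h3
    obtain ⟨a, ⟨ha1, ha2⟩, ha3⟩ := ne (inter (inter (he₀ V k₀ k₁) (he₀ V k₀ k₂)) (he₀ V k₁ k₂))
    exact ⟨a, ha1.trans h1, ha2.trans h2, ha3.trans h3⟩
  · obtain ⟨U, hU⟩ := UltraPt.exists_mem (x := g ({atoms t₀} : Set S.carrier)) (by
      intro h
      exact Set.singleton_ne_empty _ (hginj (h.trans hgbot.symm)))
    refine ⟨U, fun x hx => ?_, fun i hi t => ?_⟩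
    · rw [hag x z hx]
      refine huniq (mono ?_ hU)
      rintro _ rfl
      rfl
    · have h1 : g {a | ∃ b ∈ ({atoms t} : Set S.carrier), S.T (pos z) a b} ∈ U := by
        refine mono ?_ hU
        rintro _ rfl
        exact ⟨atoms t, rfl, htrans _ t hrefl⟩
      rw [hgc, ← hpos] at h1
      obtain ⟨W, hW, hWt⟩ := hD.exists_point _ h1
      -- `W` is `U` with coordinate `z` replaced so as to lie in `atoms t`. Copying that coordinate
      -- to `i` and commuting gives `V`, which is `U` except that its coordinate `i` is the
      -- coordinate `z` of `W`.
      obtain ⟨V, hV1, hV2⟩ := A.comm (inn z) i U W (A.sub i (inn z) W) hW (CylFrame.R_sub W)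
      refine ⟨V, hV1, fun x hx => ?_⟩
      rw [← he.sub_right (hinn.ne hx.symm) (hi x).symm (hi z),
        ← CylFrame.eq_sub (hi z) hV2 (A.E_symm (CylFrame.E_sub W)),
        he.sub_other (hinn.ne hx) (hi x).symm (hi z).symm, hag x z hx]
      refine huniq (mono ?_ hWt)
      rintro _ rfl
      rfl

end Cyl

/-! ### The rainbow algebra. -/

namespace Cyl

namespace Colour

variable {n : ℕ} {α β : Type}

instance [Finite α] [Finite β] : Finite (Colour n α β) :=
  Finite.of_surjective
    (fun p : (α ⊕ Fin (n - 2)) ⊕ (Fin (n - 1) ⊕ β × β) => match p with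
      | .inl (.inl i) => green₀ i
      | .inl (.inr j) => green j
      | .inr (.inl j) => white j
      | .inr (.inr p) => red p.1 p.2)
    (fun c => match c with
      | green₀ i => ⟨.inl (.inl i), rfl⟩
      | green j => ⟨.inl (.inr j), rfl⟩
      | white j => ⟨.inr (.inl j), rfl⟩
      | red k l => ⟨.inr (.inr (k, l)), rfl⟩)

/-- The colour of the edge from the `j`-th node of the base to the apex of a cone of tint `t`. -/
def cone (n : ℕ) (β : Type) (t : α) (j : ℕ) : Colour n α β :=
  -- The second condition only makes the definition total; it is automatic for `0 < j < n - 1`.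
  if h : j ≠ 0 ∧ j - 1 < n - 2 then green ⟨j - 1, h.2⟩ else green₀ t

theorem cone_zero (t : α) : cone n β t 0 = green₀ t := by simp [cone]

theorem isGreen_cone {t : α} {j k : ℕ} (hj : j < n - 1) : (cone n β t j).IsGreen k ↔ k = j := by
  unfold cone
  split_ifs with h
  · simp only [IsGreen]; omega
  · simp only [IsGreen]; omega

theorem conv_cone (t : α) (j : ℕ) : (cone n β t j).conv = cone n β t j := by
  unfold cone
  split_ifs <;> rfl

theorem not_isGreen_white {j : Fin (n - 1)} {k : ℕ} : ¬ (white j : Colour n α β).IsGreen k :=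
  fun h => h

end Colour

variable {n : ℕ} {α β : Type} {G : SimpleGraph α} {H : SimpleGraph β}

open Classical in
/-- A cone of tint `t` with base `0, …, n - 2` and apex `n - 1`. -/
noncomputable def coneGraph (n : ℕ) (hn : 3 ≤ n) (β : Type) (t : α) :
    PreGraph n α β (Fin n) where
  edge x y :=
    if x.1 < n - 1 then
      if y.1 < n - 1 then Colour.white ⟨0, by omega⟩ else Colour.cone n β t x
    else if y.1 < n - 1 then Colour.cone n β t y else Colour.white ⟨0, by omega⟩
  yellow a := if Function.Injective a ∧ ∀ j, (a j).1 < n - 1 then some Set.univ else none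

theorem coneGraph_isGreen {hn : 3 ≤ n} {t : α} {x y : Fin n} {j : ℕ} :
    ((coneGraph n hn β t).edge x y).IsGreen j ↔
      (x.1 < n - 1 ∧ ¬ y.1 < n - 1 ∧ j = x) ∨ (¬ x.1 < n - 1 ∧ y.1 < n - 1 ∧ j = y) := by
  by_cases hx : x.1 < n - 1 <;> by_cases hy : y.1 < n - 1 <;>
    simp [coneGraph, hx, hy, Colour.isGreen_cone, Colour.not_isGreen_white]

theorem coneGraph_green {hn : 3 ≤ n} {t : α} {x y : Fin n} :
    ((coneGraph n hn β t).edge x y).Green ↔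
      (x.1 < n - 1 ∧ ¬ y.1 < n - 1) ∨ (¬ x.1 < n - 1 ∧ y.1 < n - 1) := by
  unfold Colour.Green
  simp only [coneGraph_isGreen]
  constructor
  · rintro ⟨j, h⟩; tauto
  · rintro (h | h)
    exacts [⟨x, Or.inl ⟨h.1, h.2, rfl⟩⟩, ⟨y, Or.inr ⟨h.1, h.2, rfl⟩⟩]

theorem coneGraph_ne_red {hn : 3 ≤ n} {t : α} {x y : Fin n} {k l : β} :
    (coneGraph n hn β t).edge x y ≠ Colour.red k l := by
  simp only [coneGraph, Colour.cone]
  split_ifs <;> simp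

/-- Every green edge joins the base to the apex, and its green index is the base node; hence there
are no three greens in a triangle and no two greens of equal index at a node. There are no reds, and
the full shade of yellow makes the cone condition vacuous. -/
theorem coneGraph_isColouredGraph (hn : 3 ≤ n) (t : α) :
    IsColouredGraph G H (coneGraph n hn β t) where
  symm x y _ := by
    by_cases hx : x.1 < n - 1 <;> by_cases hy : y.1 < n - 1 <;>
      simp only [coneGraph, hx, hy, if_true, if_false, Colour.conv_cone] <;> rfl
  no_ggg x y z hxy hxz hyz := by
    simp only [coneGraph_green]
    tauto
  no_ggw x y z hxy hxz hyz j h1 h2 _ := by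
    rw [coneGraph_isGreen] at h1 h2
    rw [ne_eq, Fin.ext_iff] at hxy hxz hyz
    have := x.2
    have := y.2
    have := z.2
    omega
  ggr x y z _ _ _ i j k l _ _ h := (coneGraph_ne_red h).elim
  rrr x y z _ _ _ i j j' k' i' k h := (coneGraph_ne_red h).elim
  yellow_iff a := by
    simp only [coneGraph_green]
    have h0 : ((coneGraph n hn β t).yellow a).isSome ↔
        Function.Injective a ∧ ∀ j, (a j).1 < n - 1 := by
      simp only [coneGraph]
      split_ifs with h <;> simp [h]
    rw [h0]
    refine and_congr_right fun ha => ⟨fun h j j' _ => by have := h j; have := h j'; tauto, ?_⟩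
    intro h j
    by_contra hj
    -- As `n - 1 ≥ 2`, a sequence through the apex has a second entry: a base node would give a
    -- green edge, and a second apex contradicts injectivity.
    obtain ⟨j', hj'⟩ : ∃ j' : Fin (n - 1), j' ≠ j := by
      by_cases h0 : j.1 = 0
      · exact ⟨⟨1, by omega⟩, fun h => by rw [← h] at h0; simp at h0⟩
      · exact ⟨⟨0, by omega⟩, fun h => h0 (by rw [← h])⟩
    have h1 : ¬ (a j').1 < n - 1 := by
      have := h j j' hj'.symm
      tauto
    refine hj' (ha (Fin.ext ?_))
    have := (a j).2
    have := (a j').2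
    omega
  yellow_shade a S h := by
    simp only [coneGraph] at h
    split_ifs at h
    right
    simpa using h.symm
  cone d z i S _ h := by
    simp only [coneGraph] at h
    split_ifs at h
    simp only [Option.some.injEq] at h
    rw [← h]
    trivial

/-- The cone of tint `t` as an atom. -/
noncomputable def coneSurj (hn : 3 ≤ n) (G : SimpleGraph α) (H : SimpleGraph β) (t : α) :
    Surj n G H :=
  ⟨n, coneGraph n hn β t, coneGraph_isColouredGraph hn t, id, Function.surjective_id⟩

/-- The tint is visible only on edges to the apex. -/
theorem agreeOn_coneSurj (hn : 3 ≤ n) {z : Fin n} (hz : z.1 = n - 1) (t t' : α) :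
    AgreeOn {z}ᶜ (coneSurj hn G H t) (coneSurj hn G H t') := by
  have key : ∀ i ∈ ({z}ᶜ : Set (Fin n)), i.1 < n - 1 := by
    intro i hi
    have h1 : i.1 ≠ z.1 := fun h => hi (Fin.ext h)
    have := i.2
    omega
  refine ⟨fun _ _ _ _ => Iff.rfl, fun i hi j hj _ => ?_, fun _ _ => rfl⟩
  simp [coneSurj, coneGraph, key i hi, key j hj]

open Classical in
/-- The colour of a pair of indices in an atom; `none` if the nodes are equal. -/
noncomputable def Surj.label (a : Surj n G H) (i j : Fin n) : Option (Colour n α β) :=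
  if a.map i = a.map j then none else some (a.graph.edge (a.map i) (a.map j))

theorem Surj.label_eq_some {a : Surj n G H} {i j : Fin n} {c : Colour n α β} :
    a.label i j = some c ↔ a.map i ≠ a.map j ∧ a.graph.edge (a.map i) (a.map j) = c := by
  unfold label
  split_ifs with h <;> simp [h]

theorem AgreeOn.label_eq {s : Set (Fin n)} {a b : Surj n G H} (h : AgreeOn s a b) {i j : Fin n}
    (hi : i ∈ s) (hj : j ∈ s) : a.label i j = b.label i j := by
  unfold Surj.label
  have h1 := h.eq_iff i hi j hj
  by_cases hij : a.map i = a.map j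
  · rw [if_pos hij, if_pos (h1.1 hij)]
  · rw [if_neg hij, if_neg fun h => hij (h1.2 h), h.edge i hi j hj hij]

/-- The label of a pair of indices in an atom of the rainbow algebra. -/
noncomputable def rainbowLabel (x : (rainbowAtomStr n G H).carrier) (i j : Fin n) :
    Option (Colour n α β) :=
  Quotient.lift (s := surjSetoid n G H) (fun a : Surj n G H => a.label i j)
    (fun _ _ h => AgreeOn.label_eq h trivial trivial) x

theorem rainbow_T_iff {i : Fin n} {a b : Surj n G H} :
    (rainbowAtomStr n G H).T i (Quotient.mk _ a) (Quotient.mk _ b) ↔ AgreeOn {i}ᶜ a b := by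
  constructor
  · rintro ⟨a', b', ha, hb, h⟩
    have h1 : AgreeOn Set.univ a' a := Quotient.exact ha
    have h2 : AgreeOn Set.univ b' b := Quotient.exact hb
    have mono : ∀ {c d : Surj n G H}, AgreeOn Set.univ c d → AgreeOn {i}ᶜ c d := fun h =>
      ⟨fun i _ j _ => h.eq_iff i trivial j trivial, fun i _ j _ => h.edge i trivial j trivial,
        fun t _ => h.yellow t fun _ => trivial⟩
    exact (mono h1.symm).trans (h.trans (mono h2))
  · exact fun h => ⟨a, b, rfl, rfl, h⟩

/-- The rainbow algebra is not neatly embeddable in an algebra of dimension `n + 4`. -/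
theorem not_SNr_rainbowCA (n : ℕ) (hn : 3 ≤ n) :
    ¬ SNr.{u, 0} n 4 (rainbowCA n (n + 2) (n + 1)) := by
  intro hS
  have hz : n - 1 < n := by omega
  obtain ⟨F, A, e, he, htri, U, hU, hext⟩ := hS.exists_labelling (ι := Fin (n + 4)) (κ := Fin n)
    (by simp only [Fintype.card_fin]; omega) Function.injective_id (Fin.castAdd_injective n 4)
    (pos := id) (fun _ => rfl)
    (fun i hi => by
      have h1 : n ≤ i.1 := by
        by_contra h
        exact hi ⟨i, by omega⟩ rfl
      exact ⟨⟨i - n, by omega⟩, Fin.ext (by simp; omega)⟩)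
    (k₀ := ⟨0, by omega⟩) (k₁ := ⟨1, by omega⟩) (k₂ := ⟨2, by omega⟩) (by simp) (by simp) (by simp)
    rainbowLabel
    (by
      rintro z x y a b - hx hy hT
      induction a using Quotient.inductionOn
      induction b using Quotient.inductionOn
      exact (rainbow_T_iff.1 hT).label_eq (Ne.symm hx) (Ne.symm hy))
    (by
      rintro x x' y _ - - ⟨a, rfl, ha⟩
      show a.label x y = a.label x' y
      unfold Surj.label
      rw [show a.map x = a.map x' from ha])
    (by
      rintro x y y' _ - - ⟨a, rfl, ha⟩
      show a.label x y = a.label x y'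
      unfold Surj.label
      rw [show a.map y = a.map y' from ha])
    ⟨n - 1, hz⟩ (fun t => Quotient.mk _ (coneSurj hn _ _ t)) 0
    (rainbow_T_iff.2 (AgreeOn.refl _ _))
    (by
      intro a t hT
      induction a using Quotient.inductionOn
      exact rainbow_T_iff.2 ((rainbow_T_iff.1 hT).trans (agreeOn_coneSurj hn rfl _ _)))
  set b : Fin (n - 1) → Fin (n + 4) := fun j => ⟨j, by omega⟩ with hb
  have hlab : ∀ (t : Fin (n + 2)) (x : Fin (n - 1)),
      rainbowLabel (Quotient.mk (surjSetoid n ⊤ ⊤)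
        (coneSurj hn ⊤ (⊤ : SimpleGraph (Fin (n + 1))) t)) ⟨x, by omega⟩ ⟨n - 1, hz⟩ =
        some (Colour.cone n _ t x) := by
    intro t x
    refine Surj.label_eq_some.2 ⟨?_, ?_⟩
    · have := x.2
      simp only [coneSurj, id, ne_eq, Fin.mk.injEq]
      omega
    · simp [coneSurj, coneGraph]
  -- `Apex V i t`: the coordinate `i` of `V` is the apex of a cone of tint `t`
  let Apex : F → Fin (n + 4) → Fin (n + 2) → Prop := fun V i t =>
    ∀ x, e V (b x) i = some (Colour.cone n _ t x)
  -- Two apexes over one base: the edge between them is not green because of base node `0`, not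
  -- `w_j` because base node `j` sees both apexes in `g_j`, and the apexes are not equal because the
  -- tints differ. The rule for `g_0^t, g_0^{t'}, r_{kl}` then gives `k ≠ l`.
  have red : ∀ V i j t t', i ≠ j → n - 1 ≤ i.1 → n - 1 ≤ j.1 → t ≠ t' → Apex V i t →
      Apex V j t' → ∃ k l, e V i j = some (Colour.red k l) ∧ k ≠ l := by
    intro V i j t t' hij hi hj ht hVi hVj
    have hbi : ∀ x, b x ≠ i := fun x h => by have := x.2; rw [← h] at hi; simp [hb] at hi; omega
    have hbj : ∀ x, b x ≠ j := fun x h => by have := x.2; rw [← h] at hj; simp [hb] at hj; omega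
    have tri : ∀ x : Fin (n - 1), ∃ (k : ℕ) (M : PreGraph n (Fin (n + 2)) (Fin (n + 1)) (Fin k))
        (x₀ x₁ x₂ : Fin k), IsColouredGraph ⊤ ⊤ M ∧ x₀ ≠ x₁ ∧ x₀ ≠ x₂ ∧
        M.edge x₀ x₁ = Colour.cone n _ t x ∧ M.edge x₀ x₂ = Colour.cone n _ t' x ∧
        (x₁ ≠ x₂ → e V i j = some (M.edge x₁ x₂)) ∧ (x₁ = x₂ → e V i j = none) := by
      intro x
      obtain ⟨a, h1, h2, h3⟩ := htri V (b x) i j (hbi x) (hbj x) hij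
      induction a using Quotient.inductionOn
      rename_i a
      rw [hVi x] at h1
      rw [hVj x] at h2
      obtain ⟨h11, h12⟩ := Surj.label_eq_some.1 h1
      obtain ⟨h21, h22⟩ := Surj.label_eq_some.1 h2
      refine ⟨a.k, a.graph, _, _, _, a.isColouredGraph, h11, h21, h12, h22, fun h => ?_,
        fun h => ?_⟩
      · exact h3.symm.trans (Surj.label_eq_some.2 ⟨h, rfl⟩)
      · refine h3.symm.trans ?_
        show Surj.label _ _ _ = _
        rw [Surj.label, if_pos h]
    obtain ⟨k, M, x₀, x₁, x₂, hM, h01, h02, e1, e2, e3, -⟩ := tri ⟨0, by omega⟩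
    simp only [Colour.cone_zero] at e1 e2
    have h12 : x₁ ≠ x₂ := by
      rintro rfl
      rw [e1] at e2
      injection e2 with h
      exact ht h
    have e4 := e3 h12
    have hng : ¬ (M.edge x₁ x₂).Green := fun h =>
      hM.no_ggg x₀ x₁ x₂ h01 h02 h12 ⟨⟨0, by rw [e1]; rfl⟩, ⟨0, by rw [e2]; rfl⟩, h⟩
    generalize hc : M.edge x₁ x₂ = c at *
    cases c with
    | green₀ i => exact (hng ⟨0, rfl⟩).elim
    | green j => exact (hng ⟨_, rfl⟩).elim
    | white w =>
      obtain ⟨k, M, x₀, x₁, x₂, hM, h01, h02, e1, e2, e3, e5⟩ := tri w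
      have h12 : x₁ ≠ x₂ := by
        intro h
        rw [e5 h] at e4
        simp at e4
      refine (hM.no_ggw x₀ x₁ x₂ h01 h02 h12 w ?_ ?_ ?_).elim
      · rw [e1]; exact (Colour.isGreen_cone w.2).2 rfl
      · rw [e2]; exact (Colour.isGreen_cone w.2).2 rfl
      · rw [e3 h12] at e4
        simpa using e4
    | red k l =>
      exact ⟨k, l, e4, (hM.ggr x₀ x₁ x₂ h01 h02 h12 t t' k l e1 e2 hc).2 ht⟩
  have rrr : ∀ V p q r i j j' k' i' k, p ≠ q → p ≠ r → q ≠ r → e V p q = some (Colour.red i j) →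
      e V q r = some (Colour.red j' k') → e V p r = some (Colour.red i' k) →
      i = i' ∧ j = j' ∧ k' = k := by
    intro V p q r i j j' k' i' k hpq hpr hqr h1 h2 h3
    obtain ⟨a, g1, g2, g3⟩ := htri V p q r hpq hpr hqr
    induction a using Quotient.inductionOn
    rename_i a
    obtain ⟨h11, h12⟩ := Surj.label_eq_some.1 (g1.trans h1)
    obtain ⟨h21, h22⟩ := Surj.label_eq_some.1 (g3.trans h2)
    obtain ⟨h31, h32⟩ := Surj.label_eq_some.1 (g2.trans h3)
    exact a.isColouredGraph.rrr _ _ _ h11 h31 h21 _ _ _ _ _ _ h12 h22 h32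
  have hbase : ∀ x (i : Fin (n + 4)), n - 1 ≤ i.1 → i ≠ b x := by
    rintro x i hi rfl
    have := x.2
    simp [hb] at hi
    omega
  set a : Fin (n + 4) := ⟨n - 1, by omega⟩ with ha
  set y : Fin (n + 4) := ⟨n, by omega⟩ with hy
  set y' : Fin (n + 4) := ⟨n + 1, by omega⟩ with hy'
  have hay : a ≠ y := by simp only [ha, hy, ne_eq, Fin.mk.injEq]; omega
  have hay' : a ≠ y' := by simp only [ha, hy', ne_eq, Fin.mk.injEq]; omega
  have hyy' : y ≠ y' := by simp [hy, hy']
  have gea : n - 1 ≤ a.1 := le_rfl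
  have gey : n - 1 ≤ y.1 := by simp [hy]
  have gey' : n - 1 ≤ y'.1 := by simp only [hy']; omega
  have hba : ∀ x, b x ≠ a := fun x => (hbase x a gea).symm
  have hUa : Apex U a 0 := fun x => by
    rw [← hlab]
    refine hU ⟨x, by omega⟩ ?_
    have := x.2
    simp only [ne_eq, Fin.mk.injEq]
    omega
  have hX : ∀ t, ∃ V, A.R y U V ∧ Apex V y t := by
    intro t
    obtain ⟨V, hV, hVt⟩ := hext y (fun x h => by
      have := congrArg Fin.val h; have := x.2; simp [hy] at *; omega) t
    refine ⟨V, hV, fun x => ?_⟩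
    rw [← hlab]
    refine hVt ⟨x, by omega⟩ ?_
    have := x.2
    simp only [ne_eq, Fin.mk.injEq]
    omega
  choose V hV hVy using hX
  have hVa : ∀ t, Apex (V t) a 0 := fun t x => by
    rw [← he.inv y _ _ _ _ (hba x) (hbase x y gey) hay.symm (hV t)]
    exact hUa x
  have h1 : ∀ t, t ≠ 0 → ∃ k l, e (V t) a y = some (Colour.red k l) ∧ k ≠ l := fun t ht =>
    red (V t) a y 0 t hay gea gey ht.symm (hVa t) (hVy t)
  choose! p k hpk hne using h1
  -- In `W` the coordinate `y'` is the new apex of `V t` and `y` is that of `V t'`, both joined to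
  -- `a` as before. The red triangle on `a, y', y` identifies the first indices and separates the
  -- second ones.
  have amalg : ∀ t t', t ≠ 0 → t' ≠ 0 → t ≠ t' → p t = p t' ∧ k t ≠ k t' := by
    intro t t' ht ht' htt
    have hR : A.R y (V t) (V t') := (A.equiv y).trans ((A.equiv y).symm (hV t)) (hV t')
    obtain ⟨W, hW1, hW2⟩ := A.comm y' y _ _ _
      ((A.equiv y').symm (CylFrame.R_sub (j := y) (V t))) hR
    have w1 : Apex W y' t := fun x => by
      rw [← he.inv y _ _ _ _ (hbase x y' gey').symm (hbase x y gey) hyy' hW1]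
      refine (he.sub_right (hbase x y' gey') (hbase x y gey) hyy'.symm _).trans (hVy t x)
    have w2 : Apex W y t' := fun x => by
      rw [he.inv y' _ _ _ _ (hbase x y gey).symm (hbase x y' gey') hyy'.symm hW2]
      exact hVy t' x
    have w3 : e W a y' = some (Colour.red (p t) (k t)) := by
      rw [← he.inv y _ _ _ _ hay' hay.symm hyy' hW1, he.sub_right hay'.symm hay.symm hyy'.symm,
        hpk t ht]
    have w4 : e W a y = some (Colour.red (p t') (k t')) := by
      rw [he.inv y' _ _ _ _ hay hay'.symm hyy'.symm hW2, hpk t' ht']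
    obtain ⟨i, j, hij, hne⟩ := red W y' y t t' hyy'.symm gey' gey htt w1 w2
    obtain ⟨r1, r2, r3⟩ := rrr W a y' y _ _ _ _ _ _ hay' hay hyy'.symm w3 hij w4
    exact ⟨r1, by rw [r2, ← r3]; exact hne⟩
  -- The unused tint `0` is sent to the common first index, from which every `k t` differs; this is
  -- the extra value in the pigeonhole count.
  have hinj : Function.Injective (fun t : Fin (n + 2) => if t = 0 then p 1 else k t) := by
    have hp : ∀ t, t ≠ 0 → p t = p 1 := by
      intro t ht
      by_cases h : t = 1
      · rw [h]
      · exact (amalg t 1 ht (by simp) h).1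
    intro t t' htt
    by_contra h
    simp only at htt
    split_ifs at htt with h1 h2 h2
    · exact h (h1.trans h2.symm)
    · exact hne t' h2 (by rw [← htt, hp t' h2])
    · exact hne t h1 (by rw [htt, hp t h1])
    · exact (amalg t t' h1 h2 h).2 htt
  have := Fintype.card_le_of_injective _ hinj
  simp at this

end Cyl

/-! ### Edge colours with split reds, and a universal colouring of the natural numbers. -/

namespace Cyl

/-- The red `some (m, b)` is one of the two halves of the `m`-th red colour; `none` is an
additional shade of red, which no atom has. -/
abbrev RedIdx := Option (ℕ × Bool)

/-- The edge colours of the structure whose definable relations form an algebra with a completion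
that is not neatly embeddable. -/
inductive EdgeCol : Type
  | green (j : Fin 2) (t : Fin 6)
  | white (j : Fin 2)
  | red (r : RedIdx)

namespace EdgeCol

instance : Countable EdgeCol :=
  Function.Surjective.countable
    (f := fun p : (Fin 2 × Fin 6) ⊕ (Fin 2 ⊕ RedIdx) => match p with
      | .inl p => green p.1 p.2
      | .inr (.inl j) => white j
      | .inr (.inr r) => red r)
    (fun c => match c with
      | green j t => ⟨.inl (j, t), rfl⟩
      | white j => ⟨.inr (.inl j), rfl⟩
      | red r => ⟨.inr (.inr r), rfl⟩)

/-- The colour is `green j t` for some `t`. -/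
def IsG (j : Fin 2) : EdgeCol → Prop
  | green i _ => i = j
  | _ => False

/-- Two reds that may occur together in a red triangle. -/
def Linked : RedIdx → RedIdx → Prop
  -- The ideal red is linked to itself because it stands for both halves of all reds of large index
  -- at once.
  | none, none => True
  | some p, some q => p.1 = q.1 ∧ p.2 ≠ q.2
  | _, _ => False

theorem Linked.symm : ∀ {r s : RedIdx}, Linked r s → Linked s r
  | none, none, _ => trivial
  | some _, some _, h => ⟨h.1.symm, h.2.symm⟩

/-- The triangles with these colours are allowed. -/
structure Ok (a b c : EdgeCol) : Prop where
  ggg : ∀ i j k, a.IsG i → b.IsG j → ¬ c.IsG k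
  ggw : ∀ j, a.IsG j → b.IsG j → c ≠ white j
  gwg : ∀ j, a.IsG j → c.IsG j → b ≠ white j
  wgg : ∀ j, b.IsG j → c.IsG j → a ≠ white j
  rrr : ∀ r s t, a = red r → b = red s → c = red t → Linked r s ∨ Linked r t ∨ Linked s t

theorem Ok.swap₁ {a b c : EdgeCol} (h : Ok a b c) : Ok b a c :=
  ⟨fun i j k h1 h2 => h.ggg j i k h2 h1, fun j h1 h2 => h.ggw j h2 h1, h.wgg, h.gwg,
    fun r s t h1 h2 h3 => (h.rrr s r t h2 h1 h3).elim (fun h => .inl h.symm)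
      fun h => .inr h.symm⟩

theorem Ok.swap₂ {a b c : EdgeCol} (h : Ok a b c) : Ok a c b :=
  ⟨fun i j k h1 h2 h3 => h.ggg i k j h1 h3 h2, h.gwg, h.ggw, fun j h1 h2 => h.wgg j h2 h1,
    fun r s t h1 h2 h3 => by
      rcases h.rrr r t s h1 h3 h2 with h | h | h
      exacts [.inr (.inl h), .inl h, .inr (.inr h.symm)]⟩

theorem ok_white {a b : EdgeCol} {j : Fin 2} (h : a.IsG j → ¬ b.IsG j) : Ok a b (white j) where
  ggg _ _ _ _ _ h := h
  ggw i h1 h2 h3 := by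
    injection h3 with h3
    subst h3
    exact h h1 h2
  gwg _ _ h := h.elim
  wgg _ _ h := h.elim
  rrr _ _ _ _ _ h := by cases h

theorem ok_white_white (a : EdgeCol) (j k : Fin 2) : Ok a (white j) (white k) :=
  ok_white fun _ h => h

theorem ok_green_red (a : EdgeCol) {b : EdgeCol} {j : Fin 2} {r : RedIdx} (hb : b.IsG j) :
    Ok a b (red r) where
  ggg _ _ _ _ _ h := h
  ggw _ _ _ h := by cases h
  gwg _ _ h := h.elim
  wgg _ _ h := h.elim
  rrr _ _ _ _ h := by subst h; exact hb.elim

theorem ok_white_red (a : EdgeCol) (j : Fin 2) (r : RedIdx) : Ok a (white j) (red r) where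
  ggg _ _ _ _ h := h.elim
  ggw _ _ h := h.elim
  gwg _ _ h := h.elim
  wgg _ h := h.elim
  rrr _ _ _ _ h := by cases h

theorem ok_red_red (a : EdgeCol) {r s : RedIdx} (hrs : Linked r s) : Ok a (red r) (red s) where
  ggg _ _ _ _ h := h.elim
  ggw _ _ h := h.elim
  gwg _ _ h := h.elim
  wgg _ h := h.elim
  rrr _ _ _ _ h h' := by
    injection h with h
    injection h' with h'
    subst h h'
    exact .inr (.inr hrs)

end EdgeCol

open EdgeCol

variable {p : ℕ}

/-- `x ≠ y` are nodes outside the injective sequence `e` of parameters. -/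
structure Proper {V : Type u} (e : Fin p → V) (x y : V) : Prop where
  inj : Function.Injective e
  ne : x ≠ y
  left : ∀ i, e i ≠ x
  right : ∀ i, e i ≠ y

theorem Proper.symm {V : Type u} {e : Fin p → V} {x y : V} (h : Proper e x y) : Proper e y x :=
  ⟨h.inj, h.ne.symm, h.right, h.left⟩

theorem Proper.map {V : Type u} {W : Type v} {f : V → W} (hf : Function.Injective f)
    {e : Fin p → V} {x y : V} (h : Proper e x y) : Proper (f ∘ e) (f x) (f y) :=
  ⟨hf.comp h.inj, hf.ne h.ne, fun i => hf.ne (h.left i), fun i => hf.ne (h.right i)⟩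

theorem Proper.of_map {V : Type u} {W : Type v} {f : V → W}
    {e : Fin p → V} {x y : V} (h : Proper (f ∘ e) (f x) (f y)) : Proper e x y :=
  ⟨h.inj.of_comp, fun hxy => h.ne (hxy ▸ rfl), fun i hi => h.left i (congrArg f hi),
    fun i hi => h.right i (congrArg f hi)⟩

/-- A colouring, for every sequence of `p` parameters, of the edges between the other nodes, with
allowed triangles on the nodes in `D`. -/
structure IsColouring {V : Type u} (D : Set V) (c : (Fin p → V) → V → V → EdgeCol) : Prop where
  symm : ∀ e x y, c e x y = c e y x
  tri : ∀ e x y z, (∀ i, e i ∈ D) → x ∈ D → y ∈ D → z ∈ D → Proper e x y → Proper e x z →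
    Proper e y z → Ok (c e x y) (c e x z) (c e y z)

section Step

variable (k : ℕ) (c : (Fin p → ℕ) → ℕ → ℕ → EdgeCol) (F : Finset ℕ)
  (g : (Fin p → Option F) → Option F → Option F → EdgeCol)

open Classical in
/-- The element of `F`, or `none` for other numbers. -/
noncomputable def toOption (v : ℕ) : Option F := if h : v ∈ F then some ⟨v, h⟩ else none

/-- A new green triangle excludes the colour `white j` for the edge from `x` to the new node. -/
def Blocked (j : Fin 2) (e : Fin p → ℕ) (x : ℕ) : Prop :=
  ∃ f ∈ F, (∀ i, e i ≠ f) ∧ (c e x f).IsG j ∧ (g (toOption F ∘ e) (toOption F f) none).IsG j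

open Classical in
/-- The colour of an edge to a new node that is not prescribed. -/
noncomputable def freeCol (e : Fin p → ℕ) (x : ℕ) : EdgeCol :=
  -- A free white is always harmless; when both whites are blocked, the ideal red is the default.
  if Blocked c F g 0 e x then if Blocked c F g 1 e x then red none else white 1 else white 0

open Classical in
/-- The colouring extended to a new node `k`, over the nodes in `F` as prescribed by `g`. -/
noncomputable def extendCol (e : Fin p → ℕ) (x y : ℕ) : EdgeCol :=
  if (∀ i, e i < k) ∧ x < k ∧ y < k then c e x y
  else if (∀ i, e i ∈ insert k F) ∧ x ∈ insert k F ∧ y ∈ insert k F then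
    g (toOption F ∘ e) (toOption F x) (toOption F y)
  else if (∀ i, e i ∈ F) ∧ y = k then freeCol c F g e x
  else if (∀ i, e i ∈ F) ∧ x = k then freeCol c F g e y
  -- Edges over parameters that mix the new node with nodes outside `F`, or old parameters outside
  -- `F`, meet no prescription.
  else white 0

variable {k c F g}

theorem toOption_of_mem {v : ℕ} (h : v ∈ F) : toOption F v = some ⟨v, h⟩ := dif_pos h

theorem toOption_of_notMem {v : ℕ} (h : v ∉ F) : toOption F v = none := dif_neg h

theorem freeCol_cases (e : Fin p → ℕ) (x : ℕ) :
    (∃ j, freeCol c F g e x = white j ∧ ¬ Blocked c F g j e x) ∨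
      (freeCol c F g e x = red none ∧ Blocked c F g 0 e x ∧ Blocked c F g 1 e x) := by
  unfold freeCol
  split_ifs with h h'
  · exact .inr ⟨rfl, h, h'⟩
  · exact .inl ⟨1, rfl, h'⟩
  · exact .inl ⟨0, rfl, h⟩

theorem extendCol_old {e : Fin p → ℕ} {x y : ℕ} (he : ∀ i, e i < k) (hx : x < k) (hy : y < k) :
    extendCol k c F g e x y = c e x y := if_pos ⟨he, hx, hy⟩

theorem extendCol_symm (hc : ∀ e x y, c e x y = c e y x) (hg : ∀ e x y, g e x y = g e y x)
    (e : Fin p → ℕ) (x y : ℕ) : extendCol k c F g e x y = extendCol k c F g e y x := by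
  unfold extendCol
  simp only [and_comm (a := x < k), and_comm (a := x ∈ insert k F), hc e x y,
    hg _ (toOption F x) (toOption F y)]
  split_ifs with h1 h2 h3 h4 h5
  · rfl
  · rfl
  · rw [h3.2, h4.2]
  · rfl
  · rfl
  · rfl

theorem extendCol_new (hF : ∀ f ∈ F, f < k) {e : Fin p → ℕ} {x : ℕ} (he : ∀ i, e i < k)
    (hx : x < k) :
    ((∀ i, e i ∈ F) → x ∈ F → extendCol k c F g e x k = g (toOption F ∘ e) (toOption F x) none) ∧
    ((∀ i, e i ∈ F) → x ∉ F → extendCol k c F g e x k = freeCol c F g e x) ∧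
    ((¬ ∀ i, e i ∈ F) → extendCol k c F g e x k = white 0) := by
  have hk : k ∉ F := fun h => lt_irrefl _ (hF k h)
  have h0 : ∀ v, v < k → (v ∈ insert k F ↔ v ∈ F) := fun v hv => by
    rw [Finset.mem_insert]
    exact or_iff_right hv.ne
  have h1 : (∀ i, e i ∈ insert k F) ↔ ∀ i, e i ∈ F := forall_congr' fun i => h0 _ (he i)
  unfold extendCol
  simp only [h1, h0 x hx]
  refine ⟨fun h h' => ?_, fun h h' => ?_, fun h => ?_⟩
  · simp [h, h', toOption_of_notMem hk]
  · simp [h, h']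
  · simp [h]

theorem extendCol_param {e : Fin p → ℕ} (he : ∃ i, e i = k) {x y : ℕ}
    (hx : x < k) (hy : y < k) :
    ((∀ i, e i ∈ insert k F) ∧ x ∈ F ∧ y ∈ F → extendCol k c F g e x y =
      g (toOption F ∘ e) (toOption F x) (toOption F y)) ∧
    (¬ ((∀ i, e i ∈ insert k F) ∧ x ∈ F ∧ y ∈ F) → extendCol k c F g e x y = white 0) := by
  have h0 : ∀ v, v < k → (v ∈ insert k F ↔ v ∈ F) := fun v hv => by
    rw [Finset.mem_insert]
    exact or_iff_right hv.ne
  obtain ⟨i, hi⟩ := he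
  have h1 : ¬ ∀ i, e i < k := fun h => (h i).ne hi
  unfold extendCol
  simp only [h0 x hx, h0 y hy]
  refine ⟨fun h => ?_, fun h => ?_⟩
  · rw [if_neg fun h => h1 h.1, if_pos h]
  · rw [if_neg fun h => h1 h.1, if_neg h, if_neg fun h => hy.ne h.2, if_neg fun h => hx.ne h.2]

variable (hF : ∀ f ∈ F, f < k) (hcard : F.card ≤ p + 2) (hc : IsColouring {v | v < k} c)
  (hg : IsColouring Set.univ g)
  (hgc : ∀ (e : Fin p → F) (x y : F), Proper e x y →
    g (fun i => some (e i)) (some x) (some y) = c (fun i => e i) x y)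

theorem toOption_injOn (hk : k ∉ F) : Set.InjOn (toOption F) ((insert k F : Finset ℕ) : Set ℕ) := by
  intro v hv w hw h
  rcases Finset.mem_insert.1 hv with rfl | hv' <;> rcases Finset.mem_insert.1 hw with rfl | hw'
  · rfl
  · rw [toOption_of_notMem hk, toOption_of_mem hw'] at h; simp at h
  · rw [toOption_of_notMem hk, toOption_of_mem hv'] at h; simp at h
  · rw [toOption_of_mem hw', toOption_of_mem hv'] at h; simpa using h

theorem Proper.toOption (hk : k ∉ F) {e : Fin p → ℕ} {x y : ℕ} (he : ∀ i, e i ∈ insert k F)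
    (hx : x ∈ insert k F) (hy : y ∈ insert k F) (h : Proper e x y) :
    Proper (toOption F ∘ e) (Cyl.toOption F x) (Cyl.toOption F y) where
  inj i j hij := h.inj (toOption_injOn hk (he i) (he j) hij)
  ne hxy := h.ne (toOption_injOn hk hx hy hxy)
  left i hi := h.left i (toOption_injOn hk (he i) hx hi)
  right i hi := h.right i (toOption_injOn hk (he i) hy hi)

include hF hcard hc hg hgc

/-- If both edges to `k` are prescribed, `g` allows the triangle; if both are free, they are white
or the ideal red, and any two such colours are compatible with every third one. In the mixed case a
free white is not blocked. A free red means that two nodes of `F` block the whites, and by the bound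
on `F` these are the only nodes of `F` besides the parameters, so the prescribed edge is green. -/
theorem extendCol_tri_new {e : Fin p → ℕ} {x y : ℕ} (he : ∀ i, e i < k) (hx : x < k) (hy : y < k)
    (hxy : Proper e x y) :
    Ok (extendCol k c F g e x y) (extendCol k c F g e x k) (extendCol k c F g e y k) := by
  classical
  have hk : k ∉ F := fun h => lt_irrefl _ (hF k h)
  obtain ⟨x1, x2, x3⟩ := extendCol_new (c := c) (g := g) hF he hx
  obtain ⟨y1, y2, y3⟩ := extendCol_new (c := c) (g := g) hF he hy
  rw [extendCol_old he hx hy]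
  by_cases heF : ∀ i, e i ∈ F
  swap
  · rw [x3 heF, y3 heF]
    exact ok_white_white _ _ _
  have mixed : ∀ x y, x ∈ F → y ∉ F → Proper e x y →
      Ok (c e x y) (g (toOption F ∘ e) (toOption F x) none) (freeCol c F g e y) := by
    intro x y hxF hyF hxy
    rcases freeCol_cases (c := c) (g := g) e y with ⟨j, h1, h2⟩ | ⟨h1, h2, h3⟩
    · rw [h1]
      refine ok_white fun h3 h4 => h2 ⟨x, hxF, hxy.left, ?_, h4⟩
      rwa [hc.symm]
    · rw [h1]
      obtain ⟨f, hf, f1, f2, f3⟩ := h2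
      obtain ⟨f', hf', f1', f2', f3'⟩ := h3
      have hff : f ≠ f' := by
        rintro rfl
        revert f3 f3'
        cases g (toOption F ∘ e) (toOption F f) none with
        | green j t => rintro rfl h; cases h
        | white _ => exact fun h => h.elim
        | red _ => exact fun h => h.elim
      -- Otherwise `x, f, f'` and the `p` parameters would be `p + 3` nodes of `F`.
      have hx' : x = f ∨ x = f' := by
        by_contra! hne
        have hsub : insert x (insert f (insert f' (Finset.univ.image e))) ⊆ F := by
          intro v hv
          simp only [Finset.mem_insert, Finset.mem_image, Finset.mem_univ, true_and] at hv
          rcases hv with rfl | rfl | rfl | ⟨i, rfl⟩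
          exacts [hxF, hf, hf', heF i]
        have h4 := Finset.card_le_card hsub
        rw [Finset.card_insert_of_notMem, Finset.card_insert_of_notMem,
          Finset.card_insert_of_notMem, Finset.card_image_of_injective _ hxy.inj,
          Finset.card_univ, Fintype.card_fin] at h4
        · omega
        · simpa using f1'
        · simp only [Finset.mem_insert, Finset.mem_image, Finset.mem_univ, true_and, not_or,
            not_exists]
          exact ⟨hff, f1⟩
        · simp only [Finset.mem_insert, Finset.mem_image, Finset.mem_univ, true_and, not_or,
            not_exists]
          exact ⟨hne.1, hne.2, hxy.left⟩
      rw [hc.symm]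
      rcases hx' with rfl | rfl
      exacts [ok_green_red _ f3, ok_green_red _ f3']
  by_cases hxF : x ∈ F <;> by_cases hyF : y ∈ F
  · rw [x1 heF hxF, y1 heF hyF]
    have h1 := hxy.toOption hk (fun i => Finset.mem_insert_of_mem (heF i))
      (Finset.mem_insert_of_mem hxF) (Finset.mem_insert_of_mem hyF)
    have h2 := hg.tri (toOption F ∘ e) (toOption F x) (toOption F y) none (fun _ => trivial)
      trivial trivial trivial h1
      ⟨h1.inj, by simp [toOption_of_mem hxF], h1.left, fun i => by simp [toOption_of_mem (heF i)]⟩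
      ⟨h1.inj, by simp [toOption_of_mem hyF], h1.right, fun i => by simp [toOption_of_mem (heF i)]⟩
    have h3 := hgc (fun i => ⟨e i, heF i⟩) ⟨x, hxF⟩ ⟨y, hyF⟩
      ⟨fun i j hij => hxy.inj (congrArg Subtype.val hij), fun h => hxy.ne (congrArg Subtype.val h),
        fun i h => hxy.left i (congrArg Subtype.val h),
        fun i h => hxy.right i (congrArg Subtype.val h)⟩
    have h4 : g (toOption F ∘ e) (toOption F x) (toOption F y) = c e x y := by
      rw [toOption_of_mem hxF, toOption_of_mem hyF, ← h3]
      congr 1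
      funext i
      exact toOption_of_mem (heF i)
    rwa [h4] at h2
  · rw [x1 heF hxF, y2 heF hyF]
    exact mixed x y hxF hyF hxy
  · rw [x2 heF hxF, y1 heF hyF, hc.symm]
    exact (mixed y x hyF hxF hxy.symm).swap₂
  · rw [x2 heF hxF, y2 heF hyF]
    rcases freeCol_cases (c := c) (g := g) e x with ⟨i, h1, -⟩ | ⟨h1, -⟩ <;>
    rcases freeCol_cases (c := c) (g := g) e y with ⟨j, h2, -⟩ | ⟨h2, -⟩ <;> rw [h1, h2]
    exacts [ok_white_white _ _ _, ok_white_red _ _ _, (ok_white_red _ _ _).swap₂,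
      ok_red_red _ trivial]

/-- If `k` is a parameter, all edges are prescribed by `g` or white, and a triangle not wholly
inside `F` has at least two white edges. Otherwise `k` is a vertex of the triangle, which is
`extendCol_tri_new` up to symmetry, or the triangle is old. -/
theorem extendCol_isColouring : IsColouring {v | v < k + 1} (extendCol k c F g) := by
  have hk : k ∉ F := fun h => lt_irrefl _ (hF k h)
  have hsymm := extendCol_symm (k := k) (F := F) hc.symm hg.symm
  refine ⟨hsymm, fun e x y z he hx hy hz hxy hxz hyz => ?_⟩
  have lt : ∀ v : ℕ, v < k + 1 → v ≠ k → v < k := fun v h h' => by omega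
  by_cases hek : ∃ i, e i = k
  · obtain ⟨i, hi⟩ := id hek
    have hx' := lt x hx fun h => hxy.left i (hi.trans h.symm)
    have hy' := lt y hy fun h => hxy.right i (hi.trans h.symm)
    have hz' := lt z hz fun h => hxz.right i (hi.trans h.symm)
    obtain ⟨a1, a2⟩ := extendCol_param (c := c) (F := F) (g := g) hek hx' hy'
    obtain ⟨b1, b2⟩ := extendCol_param (c := c) (F := F) (g := g) hek hx' hz'
    obtain ⟨d1, d2⟩ := extendCol_param (c := c) (F := F) (g := g) hek hy' hz'
    by_cases h : ((∀ i, e i ∈ insert k F) ∧ x ∈ F ∧ y ∈ F)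
    · by_cases hzF : z ∈ F
      · rw [a1 h, b1 ⟨h.1, h.2.1, hzF⟩, d1 ⟨h.1, h.2.2, hzF⟩]
        have hx := Finset.mem_insert_of_mem (b := k) h.2.1
        have hy := Finset.mem_insert_of_mem (b := k) h.2.2
        have hz := Finset.mem_insert_of_mem (b := k) hzF
        exact hg.tri _ _ _ _ (fun _ => trivial) trivial trivial trivial
          (hxy.toOption hk h.1 hx hy) (hxz.toOption hk h.1 hx hz) (hyz.toOption hk h.1 hy hz)
      · rw [b2 fun h => hzF h.2.2, d2 fun h => hzF h.2.2]
        exact ok_white_white _ _ _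
    · rw [a2 h]
      by_cases h' : ((∀ i, e i ∈ insert k F) ∧ x ∈ F ∧ z ∈ F)
      · rw [d2 fun h'' => h ⟨h'.1, h'.2.1, h''.2.1⟩]
        exact (ok_white_white _ _ _).swap₁
      · rw [b2 h']
        exact (ok_white_white _ _ _).swap₂.swap₁.swap₂
  · push Not at hek
    have he' := fun i => lt _ (he i) (hek i)
    have new := fun x y (hx : x < k) (hy : y < k) =>
      extendCol_tri_new hF hcard hc hg hgc (x := x) (y := y) he' hx hy
    by_cases hx' : x = k
    · subst hx'
      rw [hsymm _ x y, hsymm _ x z]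
      exact (new y z (lt y hy hxy.ne.symm) (lt z hz hxz.ne.symm) hyz).swap₁.swap₂
    by_cases hy' : y = k
    · subst hy'
      rw [hsymm _ y z]
      exact (new x z (lt x hx hx') (lt z hz hyz.ne.symm) hxz).swap₁
    by_cases hz' : z = k
    · subst hz'
      exact new x y (lt x hx hx') (lt y hy hy') hxy
    · have hx := lt x hx hx'
      have hy := lt y hy hy'
      have hz := lt z hz hz'
      rw [extendCol_old he' hx hy, extendCol_old he' hx hz, extendCol_old he' hy hz]
      exact hc.tri e x y z he' hx hy hz hxy hxz hyz

omit hcard hc hg in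
theorem extendCol_realizes {e : Fin p → Option F} {x y : Option F} (hp : Proper e x y) :
    extendCol k c F g (fun i => (e i).elim k (↑)) (x.elim k (↑)) (y.elim k (↑)) = g e x y := by
  have hk : k ∉ F := fun h => lt_irrefl _ (hF k h)
  have h1 : ∀ v : Option F, v.elim k (↑) ∈ insert k F := fun v => by
    cases v with
    | none => exact Finset.mem_insert_self _ _
    | some v => exact Finset.mem_insert_of_mem v.2
  have h2 : ∀ v : Option F, toOption F (v.elim k (↑)) = v := fun v => by
    cases v with
    | none => exact toOption_of_notMem hk
    | some v => exact toOption_of_mem v.2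
  unfold extendCol
  split_ifs with h h'
  · have h3 : ∀ v : Option F, v.elim k (↑) < k → ∃ w : F, v = some w := fun v hv => by
      cases v with
      | none => exact (lt_irrefl _ hv).elim
      | some v => exact ⟨v, rfl⟩
    obtain ⟨x, rfl⟩ := h3 x h.2.1
    obtain ⟨y, rfl⟩ := h3 y h.2.2
    choose e' he' using fun i => h3 (e i) (h.1 i)
    obtain rfl : e = fun i => some (e' i) := funext he'
    exact (hgc e' x y (Proper.of_map (f := some) hp)).symm
  · rw [h2, h2]
    congr 1
    funext i
    exact h2 _
  all_goals exact (h' ⟨fun i => h1 _, h1 _, h1 _⟩).elim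

end Step

/-- A colouring of the natural numbers that realizes all one-point extensions of its restrictions
to sets with at most `p + 2` elements. -/
structure IsUniversal (c : (Fin p → ℕ) → ℕ → ℕ → EdgeCol) : Prop extends
    IsColouring Set.univ c where
  extend : ∀ F : Finset ℕ, F.card ≤ p + 2 →
    ∀ g : (Fin p → Option F) → Option F → Option F → EdgeCol, IsColouring Set.univ g →
    (∀ (e : Fin p → F) (x y : F), Proper e x y →
      g (fun i => some (e i)) (some x) (some y) = c (fun i => e i) x y) →
    ∃ k, k ∉ F ∧ ∀ (e : Fin p → Option F) (x y : Option F), Proper e x y →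
      c (fun i => (e i).elim k (↑)) (x.elim k (↑)) (y.elim k (↑)) = g e x y

theorem isColouring_const_white {V : Type u} (D : Set V) :
    IsColouring D fun (_ : Fin p → V) _ _ => white 0 :=
  ⟨fun _ _ _ => rfl, fun _ _ _ _ _ _ _ _ _ _ _ => ok_white_white _ _ _⟩

/-- A set of nodes and the prescribed colours of the edges from a new node to it. -/
abbrev Extension (p : ℕ) :=
  Σ F : Finset ℕ, (Fin p → Option F) → Option F → Option F → EdgeCol

/-- The extension can be applied to the colouring `c` of the numbers below `k`. -/
structure Extension.IsValid (T : Extension p) (k : ℕ) (c : (Fin p → ℕ) → ℕ → ℕ → EdgeCol) :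
    Prop where
  lt : ∀ f ∈ T.1, f < k
  card : T.1.card ≤ p + 2
  isColouring : IsColouring Set.univ T.2
  agree : ∀ (e : Fin p → T.1) (x y : T.1), Proper e x y →
    T.2 (fun i => some (e i)) (some x) (some y) = c (fun i => e i) x y

theorem exists_step (k : ℕ) {c : (Fin p → ℕ) → ℕ → ℕ → EdgeCol} (hc : IsColouring {v | v < k} c)
    (T : Extension p) : ∃ c' : (Fin p → ℕ) → ℕ → ℕ → EdgeCol, IsColouring {v | v < k + 1} c' ∧
      (∀ e x y, (∀ i, e i < k) → x < k → y < k → c' e x y = c e x y) ∧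
      (T.IsValid k c → ∀ (e : Fin p → Option T.1) (x y : Option T.1), Proper e x y →
        c' (fun i => (e i).elim k (↑)) (x.elim k (↑)) (y.elim k (↑)) = T.2 e x y) := by
  by_cases hT : T.IsValid k c
  · exact ⟨extendCol k c T.1 T.2,
      extendCol_isColouring hT.lt hT.card hc hT.isColouring hT.agree,
      fun e x y he hx hy => extendCol_old he hx hy,
      fun _ e x y hp => extendCol_realizes hT.lt hT.agree hp⟩
  · exact ⟨extendCol k c ∅ (fun _ _ _ => white 0),
      extendCol_isColouring (by simp) (by simp) hc (isColouring_const_white _)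
        (fun e x => (Finset.notMem_empty _ x.2).elim),
      fun e x y he hx hy => extendCol_old he hx hy, fun h => (hT h).elim⟩

/-- There are countably many extension problems. Node `k` is added to solve the problem with number
`k.unpair.1`, so each problem recurs at arbitrarily late stages, in particular at one beyond all
nodes of its `F`. -/
theorem exists_isUniversal (p : ℕ) : ∃ c : (Fin p → ℕ) → ℕ → ℕ → EdgeCol, IsUniversal c := by
  have : Nonempty (Extension p) := ⟨⟨∅, fun _ _ _ => white 0⟩⟩
  obtain ⟨enum, henum⟩ := exists_surjective_nat (Extension p)
  choose next hnext using fun (k : ℕ)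
    (c : {c : (Fin p → ℕ) → ℕ → ℕ → EdgeCol // IsColouring {v | v < k} c}) =>
    exists_step k c.2 (enum k.unpair.1)
  let C : ∀ k : ℕ, {c : (Fin p → ℕ) → ℕ → ℕ → EdgeCol // IsColouring {v | v < k} c} :=
    fun k => Nat.rec ⟨fun _ _ _ => white 0, isColouring_const_white _⟩
      (fun k c => ⟨next k c, (hnext k c).1⟩) k
  have hstep : ∀ k e x y, (∀ i, e i < k) → x < k → y < k →
      (C (k + 1)).1 e x y = (C k).1 e x y := fun k => (hnext k (C k)).2.1
  have hreal : ∀ k, (enum k.unpair.1).IsValid k (C k).1 → _ := fun k => (hnext k (C k)).2.2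
  have hstab : ∀ k l e x y, k ≤ l → (∀ i, e i < k) → x < k → y < k →
      (C l).1 e x y = (C k).1 e x y := by
    intro k l e x y hkl he hx hy
    induction l, hkl using Nat.le_induction with
    | base => rfl
    | succ l hkl ih =>
      rw [hstep l e x y (fun i => (he i).trans_le hkl) (hx.trans_le hkl) (hy.trans_le hkl), ih]
  -- A stage at which all nodes concerned are present; by `hstab` the colour is the same at any
  -- later stage.
  let N : (Fin p → ℕ) → ℕ → ℕ → ℕ := fun e x y => (Finset.univ.sup e ⊔ x ⊔ y) + 1
  have hN : ∀ e x y, (∀ i, e i < N e x y) ∧ x < N e x y ∧ y < N e x y := by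
    intro e x y
    refine ⟨fun i => Nat.lt_succ_of_le ?_, Nat.lt_succ_of_le ?_, Nat.lt_succ_of_le ?_⟩
    · exact (Finset.le_sup (Finset.mem_univ i)).trans (le_sup_left.trans le_sup_left)
    · exact le_sup_right.trans le_sup_left
    · exact le_sup_right
  let c : (Fin p → ℕ) → ℕ → ℕ → EdgeCol := fun e x y => (C (N e x y)).1 e x y
  have hc : ∀ k e x y, (∀ i, e i < k) → x < k → y < k → c e x y = (C k).1 e x y := by
    intro k e x y he hx hy
    obtain ⟨h1, h2, h3⟩ := hN e x y
    rcases le_total k (N e x y) with h | h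
    · exact hstab k _ e x y h he hx hy
    · exact (hstab _ k e x y h h1 h2 h3).symm
  refine ⟨c, ⟨⟨fun e x y => ?_, fun e x y z _ _ _ _ hxy hxz hyz => ?_⟩, fun F hF g hg hgc => ?_⟩⟩
  · obtain ⟨h1, h2, h3⟩ := hN e x y
    rw [hc _ e x y h1 h2 h3, hc _ e y x h1 h3 h2, (C _).2.symm]
  · obtain ⟨h1, h2, h3⟩ := hN e x y
    have h4 : N e x y ≤ N e x y ⊔ (z + 1) := le_sup_left
    have h5 : z + 1 ≤ N e x y ⊔ (z + 1) := le_sup_right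
    have h1' := fun i => (h1 i).trans_le h4
    have h2' := h2.trans_le h4
    have h3' := h3.trans_le h4
    rw [hc _ e x y h1' h2' h3', hc _ e x z h1' h2' h5, hc _ e y z h1' h3' h5]
    exact (C _).2.tri e x y z h1' h2' h3' h5 hxy hxz hyz
  · obtain ⟨j, hj⟩ := henum ⟨F, g⟩
    -- The second component makes `k` exceed every element of `F`, since `Nat.pair` dominates both
    -- components.
    set k := Nat.pair j (F.sup id + 1) with hk
    have hlt : ∀ f ∈ F, f < k := fun f hf =>
      (Nat.lt_succ_of_le (Finset.le_sup (f := id) hf)).trans_le (Nat.right_le_pair _ _)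
    have hkj : enum k.unpair.1 = ⟨F, g⟩ := by rw [hk, Nat.unpair_pair, hj]
    have h1 := hreal k
    rw [hkj] at h1
    refine ⟨k, fun h => lt_irrefl _ (hlt k h), fun e x y hp => ?_⟩
    refine Eq.trans ?_ (h1 ⟨hlt, hF, hg, fun e x y hp => ?_⟩ e x y hp)
    · have h2 : ∀ v : Option F, v.elim k (↑) < k + 1 := fun v => by
        cases v with
        | none => exact Nat.lt_succ_self k
        | some v => exact (hlt v v.2).trans (Nat.lt_succ_self k)
      exact hc (k + 1) _ _ _ (fun i => h2 _) (h2 _) (h2 _)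
    · refine (hgc e x y hp).trans ?_
      exact hc k _ _ _ (fun i => hlt _ (e i).2) (hlt _ x.2) (hlt _ y.2)

end Cyl

/-! ### Similarity up to collapse of large reds, and the back-and-forth property. -/

namespace Cyl

open EdgeCol

namespace RedIdx

/-- Forget the reds with index at least `N`. -/
def collapse (N : ℕ) : RedIdx → RedIdx
  | some q => if q.1 < N then some q else none
  | none => none

/-- The red linked to a given red with index at least `N`. -/
def mate (N : ℕ) : RedIdx → RedIdx
  | some q => if q.1 < N then none else some (q.1, !q.2)
  | none => none

/-- A red that collapses to the same red as `s`, and is linked to `r` when necessary. -/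
def fill (N : ℕ) (r s t : RedIdx) : RedIdx :=
  if collapse N s = none then if collapse N t = none then none else mate N r else collapse N s

theorem collapse_collapse {N N' : ℕ} (h : N ≤ N') (r : RedIdx) :
    collapse N (collapse N' r) = collapse N r := by
  rcases r with _ | ⟨m, b⟩
  · rfl
  · by_cases h1 : m < N' <;> by_cases h2 : m < N <;> simp [collapse, h1, h2]
    omega

theorem collapse_mate (N : ℕ) (r : RedIdx) : collapse N (mate N r) = none := by
  rcases r with _ | ⟨m, b⟩
  · rfl
  · by_cases h1 : m < N <;> simp [collapse, mate, h1]

theorem collapse_fill (N : ℕ) (r s t : RedIdx) : collapse N (fill N r s t) = collapse N s := by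
  unfold fill
  split_ifs with h1 h2
  · exact h1.symm
  · rw [collapse_mate, h1]
  · exact collapse_collapse le_rfl s

theorem eq_of_collapse_eq_some {N : ℕ} {r : RedIdx} {q : ℕ × Bool} (h : collapse N r = some q) :
    r = some q ∧ q.1 < N := by
  rcases r with _ | ⟨m, b⟩
  · cases h
  · simp only [collapse] at h
    split_ifs at h with h1
    exact ⟨h, by cases h; exact h1⟩

theorem collapse_linked {N : ℕ} {r s : RedIdx} (h : Linked r s) :
    Linked (collapse N r) (collapse N s) := by
  rcases r with _ | ⟨m, b⟩ <;> rcases s with _ | ⟨m', b'⟩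
  · trivial
  · exact h.elim
  · exact h.elim
  · obtain ⟨h1, h2⟩ := h
    simp only at h1 h2
    subst h1
    by_cases h3 : m < N <;> simp [collapse, h3, Linked, h2]

/-- Linked genuine reds have equal index, so if one survives the collapse then neither is changed by
it. -/
theorem linked_collapse_of_ne {N : ℕ} {r s : RedIdx} (h : Linked r s) (hs : collapse N s ≠ none) :
    Linked (collapse N r) (collapse N s) ∧ collapse N r = r ∧ collapse N r ≠ none ∧
      collapse N s = s := by
  obtain ⟨q, hq⟩ := Option.ne_none_iff_exists'.1 hs
  obtain ⟨rfl, h1⟩ := eq_of_collapse_eq_some hq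
  rcases r with _ | ⟨m, b⟩
  · exact h.elim
  · obtain ⟨h2, h3⟩ := id h
    have h4 : m < N := (show m = q.1 from h2) ▸ h1
    exact ⟨collapse_linked h, by simp [collapse, h4], by simp [collapse, h4], hq⟩

theorem linked_mate {N : ℕ} {r : RedIdx} (h : collapse N r = none) : Linked r (mate N r) := by
  rcases r with _ | ⟨m, b⟩
  · trivial
  · have h1 : ¬ m < N := fun h1 => by simp [collapse, h1] at h
    simp [mate, h1, Linked]

/-- Reds of index below `N` are kept. If `s` and `t` are both large, they become `none` and are
linked. If only one is large, it becomes the mate of `r` when `r` is large; when `r` is small, `r =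
r₀`, and the original link can only be between `r₀` and the small one. If both are small, a link of
either with `r₀` forces `r = r₀`. -/
theorem linked_fill {N : ℕ} {r r₀ s t : RedIdx} (hr : collapse N r = collapse N r₀)
    (h : Linked r₀ s ∨ Linked r₀ t ∨ Linked s t) :
    Linked r (fill N r s t) ∨ Linked r (fill N r t s) ∨ Linked (fill N r s t) (fill N r t s) := by
  have key : ∀ {s t : RedIdx}, collapse N s = none → collapse N t ≠ none →
      (Linked r₀ s ∨ Linked r₀ t ∨ Linked s t) →
      Linked r (fill N r s t) ∨ Linked r (fill N r t s) := by
    intro s t hs ht h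
    by_cases hrn : collapse N r = none
    · left
      rw [fill, if_pos hs, if_neg ht]
      exact linked_mate hrn
    · right
      rw [fill, if_neg ht]
      obtain ⟨q, hq⟩ := Option.ne_none_iff_exists'.1 hrn
      have h1 := (eq_of_collapse_eq_some hq).1
      have h2 := (eq_of_collapse_eq_some (hr.symm.trans hq)).1
      rw [h1, ← h2]
      rcases h with h | h | h
      · exact ((linked_collapse_of_ne h.symm (by rw [← hr]; exact hrn)).2.2.1 hs).elim
      · rw [(linked_collapse_of_ne h ht).2.2.2]
        exact h
      · exact ((linked_collapse_of_ne h ht).2.2.1 hs).elim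
  by_cases hs : collapse N s = none <;> by_cases ht : collapse N t = none
  · refine .inr (.inr ?_)
    rw [fill, fill, if_pos hs, if_pos ht, if_pos hs, if_pos ht]
    trivial
  · exact (key hs ht h).elim .inl fun h => .inr (.inl h)
  · refine (key ht hs ?_).elim (fun h => .inr (.inl h)) .inl
    rcases h with h | h | h
    exacts [.inr (.inl h), .inl h, .inr (.inr h.symm)]
  · have h1 : ∀ u, fill N r s u = collapse N s := fun u => if_neg hs
    have h2 : ∀ u, fill N r t u = collapse N t := fun u => if_neg ht
    rw [h1, h2]
    rcases h with h | h | h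
    · obtain ⟨g1, g2, g3, -⟩ := linked_collapse_of_ne h hs
      obtain ⟨q, hq⟩ := Option.ne_none_iff_exists'.1 g3
      have h3 := (eq_of_collapse_eq_some (hr.trans hq)).1
      rw [hq, ← h3] at g1
      exact .inl g1
    · obtain ⟨g1, g2, g3, -⟩ := linked_collapse_of_ne h ht
      obtain ⟨q, hq⟩ := Option.ne_none_iff_exists'.1 g3
      have h3 := (eq_of_collapse_eq_some (hr.trans hq)).1
      rw [hq, ← h3] at g1
      exact .inr (.inl g1)
    · exact .inr (.inr (collapse_linked h))

end RedIdx

namespace EdgeCol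

/-- Identify all reds with index at least `N`. -/
def collapse (N : ℕ) : EdgeCol → EdgeCol
  | red r => red (RedIdx.collapse N r)
  | a => a

/-- A colour that collapses to the same colour as `b`, for an edge in a triangle with edges of
colours `a` and, up to collapse, `d`. -/
def fill (N : ℕ) : EdgeCol → EdgeCol → EdgeCol → EdgeCol
  | red r, red s, red t => red (RedIdx.fill N r s t)
  | _, red s, _ => red (RedIdx.collapse N s)
  | _, b, _ => b

theorem collapse_collapse {N N' : ℕ} (h : N ≤ N') (a : EdgeCol) :
    collapse N (collapse N' a) = collapse N a := by
  cases a with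
  | red r => exact congrArg red (RedIdx.collapse_collapse h r)
  | _ => rfl

theorem collapse_fill (N : ℕ) (a b d : EdgeCol) : collapse N (fill N a b d) = collapse N b := by
  cases b with
  | red s =>
    cases a with
    | red r =>
      cases d with
      | red t => exact congrArg red (RedIdx.collapse_fill N r s t)
      | _ => exact collapse_collapse le_rfl (red s)
    | _ => exact collapse_collapse le_rfl (red s)
  | _ => cases a <;> rfl

theorem isG_iff_of_collapse_eq {N : ℕ} {a b : EdgeCol} (h : collapse N a = collapse N b)
    (j : Fin 2) : a.IsG j ↔ b.IsG j := by
  cases a <;> cases b <;> simp_all [collapse, IsG]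

theorem eq_white_iff_of_collapse_eq {N : ℕ} {a b : EdgeCol} (h : collapse N a = collapse N b)
    (j : Fin 2) : a = white j ↔ b = white j := by
  cases a <;> cases b <;> simp_all [collapse]

theorem exists_red_of_collapse_eq {N : ℕ} {a : EdgeCol} {r : RedIdx}
    (h : collapse N (red r) = collapse N a) :
    ∃ s, a = red s ∧ RedIdx.collapse N r = RedIdx.collapse N s := by
  cases a with
  | red s => exact ⟨s, rfl, by simpa [collapse] using h⟩
  | _ => simp [collapse] at h

/-- Triangles with equal colours up to collapse are allowed alike, except for the condition on
reds. -/
theorem Ok.of_collapse_eq {N : ℕ} {a b d a' b' d' : EdgeCol} (h : Ok a b d)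
    (ha : collapse N a' = collapse N a) (hb : collapse N b' = collapse N b)
    (hd : collapse N d' = collapse N d)
    (hr : ∀ r s t r₀ s₀ t₀, a' = red r → b' = red s → d' = red t → a = red r₀ → b = red s₀ →
      d = red t₀ → Linked r₀ s₀ ∨ Linked r₀ t₀ ∨ Linked s₀ t₀ →
      Linked r s ∨ Linked r t ∨ Linked s t) : Ok a' b' d' where
  ggg i j k := by
    simp only [isG_iff_of_collapse_eq ha, isG_iff_of_collapse_eq hb, isG_iff_of_collapse_eq hd]
    exact h.ggg i j k
  ggw j := by
    simp only [isG_iff_of_collapse_eq ha, isG_iff_of_collapse_eq hb, ne_eq,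
      eq_white_iff_of_collapse_eq hd]
    exact h.ggw j
  gwg j := by
    simp only [isG_iff_of_collapse_eq ha, isG_iff_of_collapse_eq hd, ne_eq,
      eq_white_iff_of_collapse_eq hb]
    exact h.gwg j
  wgg j := by
    simp only [isG_iff_of_collapse_eq hb, isG_iff_of_collapse_eq hd, ne_eq,
      eq_white_iff_of_collapse_eq ha]
    exact h.wgg j
  rrr r s t h1 h2 h3 := by
    subst h1 h2 h3
    obtain ⟨r₀, rfl, -⟩ := exists_red_of_collapse_eq ha
    obtain ⟨s₀, rfl, -⟩ := exists_red_of_collapse_eq hb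
    obtain ⟨t₀, rfl, -⟩ := exists_red_of_collapse_eq hd
    exact hr r s t r₀ s₀ t₀ rfl rfl rfl rfl rfl rfl (h.rrr _ _ _ rfl rfl rfl)

theorem Ok.collapse {N : ℕ} {a b d : EdgeCol} (h : Ok a b d) :
    Ok (a.collapse N) (b.collapse N) (d.collapse N) := by
  have h1 := fun a => collapse_collapse (le_refl N) a
  refine h.of_collapse_eq (h1 a) (h1 b) (h1 d) ?_
  rintro r s t r₀ s₀ t₀ h1 h2 h3 rfl rfl rfl h
  injection h1 with h1
  injection h2 with h2
  injection h3 with h3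
  subst h1 h2 h3
  exact h.imp RedIdx.collapse_linked (Or.imp RedIdx.collapse_linked RedIdx.collapse_linked)

/-- A triangle can be copied over a given edge with the same collapse, changing the two other edges
only within their collapse classes. This is the amalgamation step of the back-and-forth argument. -/
theorem Ok.fill {N : ℕ} {a a' b d : EdgeCol} (h : Ok a b d)
    (ha : EdgeCol.collapse N a' = EdgeCol.collapse N a) :
    Ok a' (fill N a' b d) (EdgeCol.fill N a' d b) := by
  refine h.of_collapse_eq ha (collapse_fill N a' b d) (collapse_fill N a' d b) ?_
  rintro r s t r₀ s₀ t₀ rfl h2 h3 rfl rfl rfl h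
  injection h2 with h2
  injection h3 with h3
  subst h2 h3
  exact RedIdx.linked_fill (by simpa [EdgeCol.collapse] using ha) h

end EdgeCol

variable {p : ℕ}

/-- Tuples with the same equalities and, up to collapse, the same colours. -/
structure Sim (c : (Fin p → ℕ) → ℕ → ℕ → EdgeCol) (N : ℕ) {ι : Type} (D : Set ι)
    (s t : ι → ℕ) : Prop where
  eq_iff : ∀ i ∈ D, ∀ j ∈ D, (s i = s j ↔ t i = t j)
  col : ∀ (e : Fin p → ι) (x y : ι), (∀ i, e i ∈ D) → x ∈ D → y ∈ D →
    Proper (s ∘ e) (s x) (s y) →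
    (c (s ∘ e) (s x) (s y)).collapse N = (c (t ∘ e) (t x) (t y)).collapse N

namespace Sim

variable {c : (Fin p → ℕ) → ℕ → ℕ → EdgeCol} {N : ℕ} {ι : Type} {D : Set ι} {s t r : ι → ℕ}

theorem proper (h : Sim c N D s t) {e : Fin p → ι} {x y : ι} (he : ∀ i, e i ∈ D) (hx : x ∈ D)
    (hy : y ∈ D) (hp : Proper (s ∘ e) (s x) (s y)) : Proper (t ∘ e) (t x) (t y) where
  inj i j hij := hp.inj ((h.eq_iff _ (he i) _ (he j)).2 hij)
  ne hxy := hp.ne ((h.eq_iff _ hx _ hy).2 hxy)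
  left i hi := hp.left i ((h.eq_iff _ (he i) _ hx).2 hi)
  right i hi := hp.right i ((h.eq_iff _ (he i) _ hy).2 hi)

theorem refl (c : (Fin p → ℕ) → ℕ → ℕ → EdgeCol) (N : ℕ) (D : Set ι) (s : ι → ℕ) :
    Sim c N D s s := ⟨fun _ _ _ _ => Iff.rfl, fun _ _ _ _ _ _ _ => rfl⟩

theorem symm (h : Sim c N D s t) : Sim c N D t s where
  eq_iff i hi j hj := (h.eq_iff i hi j hj).symm
  col e x y he hx hy hp := by
    refine (h.col e x y he hx hy ⟨?_, ?_, ?_, ?_⟩).symm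
    · exact fun i j hij => hp.inj ((h.eq_iff _ (he i) _ (he j)).1 hij)
    · exact fun hxy => hp.ne ((h.eq_iff _ hx _ hy).1 hxy)
    · exact fun i hi => hp.left i ((h.eq_iff _ (he i) _ hx).1 hi)
    · exact fun i hi => hp.right i ((h.eq_iff _ (he i) _ hy).1 hi)

theorem trans (h : Sim c N D s t) (h' : Sim c N D t r) : Sim c N D s r where
  eq_iff i hi j hj := (h.eq_iff i hi j hj).trans (h'.eq_iff i hi j hj)
  col e x y he hx hy hp :=
    (h.col e x y he hx hy hp).trans (h'.col e x y he hx hy (h.proper he hx hy hp))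

theorem mono {N' : ℕ} (hN : N ≤ N') (h : Sim c N' D s t) : Sim c N D s t where
  eq_iff := h.eq_iff
  col e x y he hx hy hp := by
    rw [← collapse_collapse hN, h.col e x y he hx hy hp, collapse_collapse hN]

theorem restrict {D' : Set ι} (hD : D' ⊆ D) (h : Sim c N D s t) : Sim c N D' s t where
  eq_iff i hi j hj := h.eq_iff i (hD hi) j (hD hj)
  col e x y he hx hy hp := h.col e x y (fun i => hD (he i)) (hD hx) (hD hy) hp

theorem congr_right (h : Sim c N D s t) (hD : ∀ i ∈ D, t i = r i) : Sim c N D s r where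
  eq_iff i hi j hj := by rw [h.eq_iff i hi j hj, hD i hi, hD j hj]
  col e x y he hx hy hp := by
    rw [h.col e x y he hx hy hp, hD x hx, hD y hy,
      show t ∘ e = r ∘ e from funext fun i => hD _ (he i)]

end Sim

theorem card_lt_of_proper {V : Finset ℕ} {e : Fin p → ℕ} {x y w : ℕ} (he : ∀ i, e i ∈ V)
    (hx : x ∈ V) (hy : y ∈ V) (hw : w ∈ V) (hxy : Proper e x y) (hxw : Proper e x w)
    (hyw : Proper e y w) : p + 2 < V.card := by
  classical
  have hsub : insert x (insert y (insert w (Finset.univ.image e))) ⊆ V := by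
    intro v hv
    simp only [Finset.mem_insert, Finset.mem_image, Finset.mem_univ, true_and] at hv
    rcases hv with rfl | rfl | rfl | ⟨i, rfl⟩
    exacts [hx, hy, hw, he i]
  have h4 := Finset.card_le_card hsub
  rw [Finset.card_insert_of_notMem, Finset.card_insert_of_notMem,
    Finset.card_insert_of_notMem, Finset.card_image_of_injective _ hxy.inj,
    Finset.card_univ, Fintype.card_fin] at h4
  · omega
  · simpa using hxw.right
  · simp only [Finset.mem_insert, Finset.mem_image, Finset.mem_univ, true_and, not_or, not_exists]
    exact ⟨hyw.ne, hxy.right⟩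
  · simp only [Finset.mem_insert, Finset.mem_image, Finset.mem_univ, true_and, not_or, not_exists]
    exact ⟨hxy.ne, hxw.ne, hxy.left⟩

theorem card_lt_of_proper_four {V : Finset ℕ} {e : Fin p → ℕ} {x y w z : ℕ} (he : ∀ i, e i ∈ V)
    (hx : x ∈ V) (hy : y ∈ V) (hw : w ∈ V) (hz : z ∈ V) (hxy : Proper e x y) (hxw : Proper e x w)
    (hyw : Proper e y w) (hxz : Proper e x z) (hyz : Proper e y z) (hwz : w ≠ z) :
    p + 3 < V.card := by
  classical
  have h1 := card_lt_of_proper (V := V.erase z) (fun i => Finset.mem_erase.2 ⟨hxz.right i, he i⟩)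
    (Finset.mem_erase.2 ⟨hxz.ne, hx⟩) (Finset.mem_erase.2 ⟨hyz.ne, hy⟩)
    (Finset.mem_erase.2 ⟨hwz, hw⟩) hxy hxw hyw
  rw [Finset.card_erase_of_mem hz] at h1
  omega

section Transfer

variable {c : (Fin p → ℕ) → ℕ → ℕ → EdgeCol} {N : ℕ} {F : Finset ℕ} (v : Option F → ℕ)

/-- The node in `F`, with a junk value for the new node. -/
def nodeVal (x : Option F) : ℕ := x.elim 0 (↑)

variable (c N) in
open Classical in
/-- The colour of an edge from the new node to `x`, copied from a similar tuple `v`. -/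
noncomputable def transferNew (e : Fin p → Option F) (x : Option F) : EdgeCol :=
  -- Since `F` has at most `p + 2` nodes, `w` is unique: the new edge lies in at most one triangle
  -- with an old edge, whose actual colour it must fit.
  if h : ∃ w : F, Proper e x (some w) then
    fill N (c (nodeVal ∘ e) (nodeVal x) h.choose) (c (v ∘ e) (v x) (v none))
      (c (v ∘ e) (v (some h.choose)) (v none))
  else (c (v ∘ e) (v x) (v none)).collapse N

variable (c N) in
open Classical in
/-- The colours of a one-point extension of `F`, copied from a similar tuple `v`. -/
noncomputable def transfer (e : Fin p → Option F) (x y : Option F) : EdgeCol :=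
  if ∀ i, e i ≠ none then
    if x ≠ none ∧ y ≠ none then c (nodeVal ∘ e) (nodeVal x) (nodeVal y)
    else if y = none then transferNew c N v e x else transferNew c N v e y
  -- With the new node among the parameters no colour in `F` is prescribed, so the collapsed colours
  -- can be used throughout.
  else (c (v ∘ e) (v x) (v y)).collapse N

variable {v} (hc : IsColouring Set.univ c) (hv : Function.Injective v) (hF : F.card ≤ p + 2)
  (hsim : ∀ (e : Fin p → F) (x y : F), Proper e x y → (c (fun i => e i) x y).collapse N =
    (c (fun i => v (some (e i))) (v (some x)) (v (some y))).collapse N)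

theorem collapse_transferNew (e : Fin p → Option F) (x : Option F) :
    (transferNew c N v e x).collapse N = (c (v ∘ e) (v x) (v none)).collapse N := by
  unfold transferNew
  split_ifs with h
  · exact collapse_fill _ _ _ _
  · exact collapse_collapse le_rfl _

include hsim in
theorem collapse_old {e : Fin p → Option F} {x y : Option F} (he : ∀ i, e i ≠ none) (hx : x ≠ none)
    (hy : y ≠ none) (hp : Proper e x y) : (c (nodeVal ∘ e) (nodeVal x) (nodeVal y)).collapse N =
      (c (v ∘ e) (v x) (v y)).collapse N := by
  choose e' he' using fun i => Option.ne_none_iff_exists'.1 (he i)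
  obtain ⟨x', rfl⟩ := Option.ne_none_iff_exists'.1 hx
  obtain ⟨y', rfl⟩ := Option.ne_none_iff_exists'.1 hy
  obtain rfl : e = fun i => some (e' i) := funext he'
  exact hsim e' x' y' (Proper.of_map (f := some) hp)

include hc hsim in
theorem collapse_transfer {e : Fin p → Option F} {x y : Option F} (hp : Proper e x y) :
    (transfer c N v e x y).collapse N = (c (v ∘ e) (v x) (v y)).collapse N := by
  unfold transfer
  split_ifs with h1 h2 h3
  · exact collapse_old hsim h1 h2.1 h2.2 hp
  · rw [collapse_transferNew, h3]
  · have h4 : x = none := by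
      by_contra h
      exact h2 ⟨h, h3⟩
    rw [collapse_transferNew, h4, hc.symm]
  · exact collapse_collapse le_rfl _

theorem nodeVal_inj {x y : Option F} (hx : x ≠ none) (hy : y ≠ none) (h : nodeVal x = nodeVal y) :
    x = y := by
  obtain ⟨x', rfl⟩ := Option.ne_none_iff_exists'.1 hx
  obtain ⟨y', rfl⟩ := Option.ne_none_iff_exists'.1 hy
  exact congrArg some (Subtype.ext h)

theorem Proper.nodeVal {e : Fin p → Option F} {x y : Option F} (he : ∀ i, e i ≠ none)
    (hx : x ≠ none) (hy : y ≠ none) (hp : Proper e x y) :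
    Proper (Cyl.nodeVal ∘ e) (Cyl.nodeVal x) (Cyl.nodeVal y) where
  inj i j hij := hp.inj (nodeVal_inj (he i) (he j) hij)
  ne h := hp.ne (nodeVal_inj hx hy h)
  left i h := hp.left i (nodeVal_inj (he i) hx h)
  right i h := hp.right i (nodeVal_inj (he i) hy h)

theorem nodeVal_mem {x : Option F} (hx : x ≠ none) : nodeVal x ∈ F := by
  obtain ⟨x', rfl⟩ := Option.ne_none_iff_exists'.1 hx
  exact x'.2

-- The chosen third node is `y`: a different one would give `p + 3` nodes in `F`. So the two new
-- edges of a triangle are filled with reference to each other.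
include hF in
theorem transferNew_eq {e : Fin p → Option F} {x y : Option F} (he : ∀ i, e i ≠ none)
    (hx : x ≠ none) (hy : y ≠ none) (hp : Proper e x y) : transferNew c N v e x =
      fill N (c (nodeVal ∘ e) (nodeVal x) (nodeVal y)) (c (v ∘ e) (v x) (v none))
        (c (v ∘ e) (v y) (v none)) := by
  obtain ⟨y, rfl⟩ := Option.ne_none_iff_exists'.1 hy
  have h : ∃ w : F, Proper e x (some w) := ⟨y, hp⟩
  have h1 : h.choose = y := by
    by_contra hne
    have hw := h.choose_spec
    refine absurd hF (not_le.2 (card_lt_of_proper (e := nodeVal ∘ e) (x := nodeVal x)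
      (y := nodeVal (some y)) (w := nodeVal (some h.choose)) (fun i => nodeVal_mem (he i))
      (nodeVal_mem hx) (nodeVal_mem hy) (nodeVal_mem (by simp)) (hp.nodeVal he hx hy)
      (hw.nodeVal he hx (by simp)) (Proper.nodeVal he hy (by simp)
        ⟨hp.inj, fun h => hne (Option.some_injective _ h).symm, hp.right, hw.right⟩)))
  unfold transferNew
  rw [dif_pos h, h1]
  rfl

include hc in
theorem transfer_symm (e : Fin p → Option F) (x y : Option F) :
    transfer c N v e x y = transfer c N v e y x := by
  unfold transfer
  rw [hc.symm _ (v x)]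
  by_cases hx : x = none <;> by_cases hy : y = none <;> simp [hx, hy, hc.symm _ (nodeVal x)]

-- Old triangles are copied from `c`, triangles at the new node are allowed by `Ok.fill`, and
-- triangles over a parameter sequence through the new node by `Ok.collapse`.
include hc hv hF hsim in
theorem transfer_isColouring : IsColouring Set.univ (transfer c N v) := by
  refine ⟨transfer_symm hc, fun e x y z _ _ _ _ hxy hxz hyz => ?_⟩
  have hok : ∀ x y z, Proper e x y → Proper e x z → Proper e y z →
      Ok (c (v ∘ e) (v x) (v y)) (c (v ∘ e) (v x) (v z)) (c (v ∘ e) (v y) (v z)) :=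
    fun x y z hxy hxz hyz => hc.tri _ _ _ _ (fun _ => trivial) trivial trivial trivial
      (hxy.map hv) (hxz.map hv) (hyz.map hv)
  by_cases he : ∀ i, e i ≠ none
  swap
  · simp only [transfer, if_neg he]
    exact (hok x y z hxy hxz hyz).collapse
  have new : ∀ x y, x ≠ none → y ≠ none → Proper e x y →
      Ok (transfer c N v e x y) (transfer c N v e x none) (transfer c N v e y none) := by
    intro x y hx hy hxy
    have h1 : transfer c N v e x y = c (nodeVal ∘ e) (nodeVal x) (nodeVal y) := by
      simp [transfer, he, hx, hy]
    have h2 : ∀ x, transfer c N v e x none = transferNew c N v e x := by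
      simp [transfer, he]
    rw [h1, h2, h2, transferNew_eq hF he hx hy hxy, transferNew_eq hF he hy hx hxy.symm,
      hc.symm _ (nodeVal y)]
    exact (hok x y none hxy ⟨hxy.inj, hx, hxy.left, he⟩ ⟨hxy.inj, hy, hxy.right, he⟩).fill
      (collapse_old hsim he hx hy hxy)
  by_cases hx : x = none
  · subst hx
    rw [transfer_symm hc _ none y, transfer_symm hc _ none z]
    exact (new y z hxy.ne.symm hxz.ne.symm hyz).swap₁.swap₂
  by_cases hy : y = none
  · subst hy
    rw [transfer_symm hc _ none z]
    exact (new x z hx hyz.ne.symm hxz).swap₁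
  by_cases hz : z = none
  · subst hz
    exact new x y hx hy hxy
  · have h1 : ∀ x y, x ≠ none → y ≠ none →
        transfer c N v e x y = c (nodeVal ∘ e) (nodeVal x) (nodeVal y) := by
      intro x y hx hy
      simp [transfer, he, hx, hy]
    rw [h1 x y hx hy, h1 x z hx hz, h1 y z hy hz]
    exact hc.tri _ _ _ _ (fun _ => trivial) trivial trivial trivial
      (hxy.nodeVal he hx hy) (hxz.nodeVal he hx hz) (hyz.nodeVal he hy hz)

end Transfer

/-- Similar tuples have similar one-point extensions. -/
theorem IsUniversal.exists_update {c : (Fin p → ℕ) → ℕ → ℕ → EdgeCol} (hc : IsUniversal c) {N : ℕ}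
    {s t : Fin (p + 3) → ℕ} {i : Fin (p + 3)} (h : Sim c N {i}ᶜ t s) :
    ∃ z, Sim c N Set.univ t (Function.update s i z) := by
  classical
  -- If `t i` repeats another entry, the same repetition is made in `s`. Otherwise a genuinely new
  -- node is required over the at most `p + 2` other entries of `s`.
  by_cases hi : ∃ j, j ≠ i ∧ t i = t j
  · obtain ⟨j, hj, hij⟩ := hi
    let σ : Fin (p + 3) → Fin (p + 3) := fun k => if k = i then j else k
    have hσ : ∀ k, σ k ∈ ({i}ᶜ : Set (Fin (p + 3))) := fun k => by
      by_cases hk : k = i <;> simp [σ, hk, hj]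
    have h1 : ∀ k, t k = t (σ k) := fun k => by
      by_cases hk : k = i <;> simp [σ, hk, hij]
    have h2 : ∀ k, Function.update s i (s j) k = s (σ k) := fun k => by
      by_cases hk : k = i
      · subst hk; simp [σ]
      · simp [σ, hk]
    have h1' : ∀ e : Fin p → Fin (p + 3), t ∘ e = t ∘ (σ ∘ e) := fun e => funext fun _ => h1 _
    have h2' : ∀ e : Fin p → Fin (p + 3), Function.update s i (s j) ∘ e = s ∘ (σ ∘ e) :=
      fun e => funext fun _ => h2 _
    refine ⟨s j, ⟨fun k _ l _ => ?_, fun e x y _ _ _ hp => ?_⟩⟩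
    · rw [h1 k, h1 l, h2, h2]
      exact h.eq_iff _ (hσ k) _ (hσ l)
    · rw [h1' e, h1 x, h1 y] at hp ⊢
      rw [h2, h2, h2']
      exact h.col _ _ _ (fun i => hσ _) (hσ x) (hσ y) hp
  · push Not at hi
    set F : Finset ℕ := (Finset.univ.erase i).image s with hFdef
    have hF : F.card ≤ p + 2 := by
      refine Finset.card_image_le.trans ?_
      rw [Finset.card_erase_of_mem (Finset.mem_univ i), Finset.card_univ, Fintype.card_fin]
      omega
    have hidx : ∀ f : F, ∃ j, j ≠ i ∧ s j = f := fun f => by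
      obtain ⟨j, hj, hjf⟩ := Finset.mem_image.1 f.2
      exact ⟨j, (Finset.mem_erase.1 hj).1, hjf⟩
    choose idx hidx1 hidx2 using hidx
    -- The matching nodes of `t`, with the new node matched to `t i`; injective because `s` and `t`
    -- have the same equalities off `i` and `t i` is not repeated.
    let v : Option F → ℕ := fun x => x.elim (t i) (fun f => t (idx f))
    have hv : Function.Injective v := by
      rintro (_ | f) (_ | f') hff
      · rfl
      · exact (hi _ (hidx1 f') hff).elim
      · exact (hi _ (hidx1 f) hff.symm).elim
      · refine congrArg some (Subtype.ext ?_)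
        rw [← hidx2 f, ← hidx2 f']
        exact (h.eq_iff _ (hidx1 f) _ (hidx1 f')).1 hff
    have hsim : ∀ (e : Fin p → F) (x y : F), Proper e x y → (c (fun i => e i) x y).collapse N =
        (c (fun i => v (some (e i))) (v (some x)) (v (some y))).collapse N := by
      intro e x y hp
      have h1 := h.col (fun i => idx (e i)) (idx x) (idx y) (fun _ => hidx1 _) (hidx1 _)
        (hidx1 _) (Proper.map (f := fun f => v (some f))
          (fun f f' hff => Option.some_injective _ (hv hff)) hp)
      refine Eq.trans ?_ h1.symm
      simp only [Function.comp_def, hidx2]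
    obtain ⟨k, hk, hkc⟩ := hc.extend F hF (transfer c N v)
      (transfer_isColouring hc.toIsColouring hv hF hsim)
      (fun e x y hp => by simp [transfer, nodeVal, Function.comp_def])
    have hmem : ∀ j, j ≠ i → s j ∈ F := fun j hj =>
      Finset.mem_image_of_mem _ (Finset.mem_erase.2 ⟨hj, Finset.mem_univ j⟩)
    let u : Fin (p + 3) → Option F := fun j => if h : j = i then none else some ⟨s j, hmem j h⟩
    have hu1 : ∀ j, Function.update s i k j = (u j).elim k (↑) := fun j => by
      by_cases hj : j = i
      · subst hj; simp [u]
      · simp [u, hj]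
    have hu2 : ∀ j, t j = v (u j) := fun j => by
      by_cases hj : j = i
      · subst hj; simp [u, v]
      · simp only [u, hj, v, dif_neg, not_false_eq_true, Option.elim_some]
        exact (h.eq_iff _ hj _ (hidx1 _)).2 (hidx2 ⟨s j, hmem j hj⟩).symm
    refine ⟨k, ⟨fun j _ l _ => ?_, fun e x y _ _ _ hp => ?_⟩⟩
    · have hkm : ∀ j, j ≠ i → k ≠ s j := fun j hj h => hk (h ▸ hmem j hj)
      by_cases hj : j = i <;> by_cases hl : l = i
      · rw [hj, hl]; simp
      · subst hj
        simp [hl, hi l hl, hkm l hl]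
      · subst hl
        simp [hj, (hi j hj).symm, (hkm j hj).symm]
      · simp only [Function.update_of_ne hj, Function.update_of_ne hl]
        exact h.eq_iff j hj l hl
    · have ht : t = v ∘ u := funext hu2
      have h1 : Proper (u ∘ e) (u x) (u y) := by
        rw [ht] at hp
        exact Proper.of_map (f := v) hp
      have h2 := hkc _ _ _ h1
      have h3 := collapse_transfer (N := N) hc.toIsColouring hsim h1
      rw [← h2] at h3
      rw [ht]
      refine h3.symm.trans ?_
      rw [hu1, hu1]
      congr 3
      funext l
      exact (hu1 (e l)).symm

/-- Every finite colouring with at most `p + 3` nodes is realized in a universal colouring. -/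
theorem IsUniversal.exists_realization {c : (Fin p → ℕ) → ℕ → ℕ → EdgeCol} (hc : IsUniversal c)
    {g : (Fin p → ℕ) → ℕ → ℕ → EdgeCol} (V : Finset ℕ) (hV : V.card ≤ p + 3)
    (hg : IsColouring (V : Set ℕ) g) :
    ∃ θ : ℕ → ℕ, Set.InjOn θ V ∧ ∀ (e : Fin p → ℕ) (x y : ℕ), (∀ i, e i ∈ V) → x ∈ V → y ∈ V →
      Proper e x y → c (θ ∘ e) (θ x) (θ y) = g e x y := by
  classical
  induction V using Finset.induction_on with
  | empty => exact ⟨id, by simp, fun _ _ _ _ hx => (Finset.notMem_empty _ hx).elim⟩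
  | insert a V haV ih =>
    rw [Finset.card_insert_of_notMem haV] at hV
    obtain ⟨θ, hθ, hθg⟩ := ih (by omega) ⟨hg.symm, fun e x y z he hx hy hz =>
      hg.tri e x y z (fun i => Finset.mem_insert_of_mem (he i)) (Finset.mem_insert_of_mem hx)
        (Finset.mem_insert_of_mem hy) (Finset.mem_insert_of_mem hz)⟩
    set F := V.image θ with hFdef
    have hF : F.card ≤ p + 2 := Finset.card_image_le.trans (by omega)
    have hpre : ∀ f : F, ∃ x ∈ V, θ x = f := fun f => Finset.mem_image.1 f.2
    choose pre hpre1 hpre2 using hpre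
    let ψ : Option F → ℕ := fun x => x.elim a pre
    have hψ : Function.Injective ψ := by
      rintro (_ | f) (_ | f') h
      · rfl
      · exact (haV (by rw [show a = pre f' from h]; exact hpre1 f')).elim
      · exact (haV (by rw [show a = pre f from h.symm]; exact hpre1 f)).elim
      · refine congrArg some (Subtype.ext ?_)
        rw [← hpre2 f, ← hpre2 f']
        exact congrArg θ h
    have hψV : ∀ x, ψ x ∈ insert a V := by
      rintro (_ | f)
      exacts [Finset.mem_insert_self _ _, Finset.mem_insert_of_mem (hpre1 f)]
    obtain ⟨k, hk, hkc⟩ := hc.extend F hF (fun e x y => g (ψ ∘ e) (ψ x) (ψ y))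
      ⟨fun e x y => hg.symm _ _ _, fun e x y z _ _ _ _ hxy hxz hyz =>
        hg.tri _ _ _ _ (fun i => hψV _) (hψV _) (hψV _) (hψV _) (hxy.map hψ) (hxz.map hψ)
          (hyz.map hψ)⟩
      (fun e x y hp => by
        refine (hθg _ _ _ (fun i => hpre1 (e i)) (hpre1 x) (hpre1 y) (Proper.map (f := pre)
          (fun f f' hff => Option.some_injective _ (hψ hff)) hp)).symm.trans ?_
        simp only [Function.comp_def, hpre2])
    have hmem : ∀ x ∈ V, θ x ∈ F := fun x hx => Finset.mem_image_of_mem _ hx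
    let u : ℕ → Option F := fun x => if h : x ∈ V then some ⟨θ x, hmem x h⟩ else none
    have hu1 : ∀ x ∈ insert a V, Function.update θ a k x = (u x).elim k (↑) := by
      intro x hx
      rcases Finset.mem_insert.1 hx with rfl | hx
      · simp [u, haV]
      · have : x ≠ a := fun h => haV (h ▸ hx)
        simp [u, hx, this]
    have hu2 : ∀ x ∈ insert a V, ψ (u x) = x := by
      intro x hx
      rcases Finset.mem_insert.1 hx with rfl | hx
      · simp [u, haV, ψ]
      · simp only [u, hx, ψ, dif_pos, Option.elim_some]
        exact hθ (hpre1 _) hx (hpre2 ⟨θ x, hmem x hx⟩)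
    refine ⟨Function.update θ a k, ?_, fun e x y he hx hy hp => ?_⟩
    · intro x hx y hy hxy
      rw [hu1 x hx, hu1 y hy] at hxy
      rw [← hu2 x hx, ← hu2 y hy]
      congr 1
      generalize u x = X at hxy
      generalize u y = Y at hxy
      rcases X with _ | f <;> rcases Y with _ | f'
      · rfl
      · exact (hk (by rw [show k = f' from hxy]; exact f'.2)).elim
      · exact (hk (by rw [show k = f from hxy.symm]; exact f.2)).elim
      · exact congrArg some (Subtype.ext hxy)
    · have h1 : Proper (u ∘ e) (u x) (u y) := by
        refine Proper.of_map (f := ψ) ?_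
        rw [hu2 x hx, hu2 y hy, show ψ ∘ (u ∘ e) = e from funext fun i => hu2 _ (he i)]
        exact hp
      have h2 := hkc _ _ _ h1
      rw [hu2 x hx, hu2 y hy, show ψ ∘ (u ∘ e) = e from funext fun i => hu2 _ (he i)] at h2
      rw [← h2, hu1 x hx, hu1 y hy]
      congr 1
      funext i
      exact hu1 _ (he i)

end Cyl

/-! ### Set algebras, and the completion of an atomic algebra as a complex algebra. -/

namespace Cyl

theorem isCA_setAlg (n : ℕ) (U : Type u) : IsCA (setAlg n U) := by
  classical
  constructor
  · intro i
    refine Set.eq_empty_iff_forall_notMem.2 ?_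
    rintro s ⟨t, ht, -⟩
    exact ht
  · exact fun i X s hs => ⟨s, hs, fun _ _ => rfl⟩
  · intro i X Y
    refine Set.ext fun s => ⟨?_, ?_⟩
    · rintro ⟨t, ⟨htX, r, hr, htr⟩, hst⟩
      exact ⟨⟨t, htX, hst⟩, r, hr, fun j hj => (hst j hj).trans (htr j hj)⟩
    · rintro ⟨⟨t, htX, hst⟩, r, hr, hsr⟩
      exact ⟨t, ⟨htX, r, hr, fun j hj => (hst j hj).symm.trans (hsr j hj)⟩, hst⟩
  · have key : ∀ (i j : Fin n) (X : Set (Fin n → U)),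
        (setAlg n U).c i ((setAlg n U).c j X) ≤ (setAlg n U).c j ((setAlg n U).c i X) := by
      rintro i j X s ⟨t, ⟨r, hr, htr⟩, hst⟩
      refine ⟨fun k => if k = j then r k else s k,
        ⟨r, hr, fun k hk => ?_⟩, fun k hk => (if_neg hk).symm⟩
      by_cases hkj : k = j
      · exact if_pos hkj
      · exact (if_neg hkj).trans ((hst k hk).trans (htr k hkj))
    exact fun i j X => le_antisymm (key i j X) (key j i X)
  · exact fun i => Set.eq_univ_of_forall fun s => rfl
  · intro i j k hi hj
    refine Set.ext fun s => ⟨fun h => ?_, ?_⟩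
    · refine ⟨Function.update s k (s i), ⟨?_, ?_⟩, fun l hl => (Function.update_of_ne hl _ _).symm⟩
      · simp [setAlg, Function.update_of_ne hi.symm]
      · have h' : s i = s j := h
        simp [setAlg, Function.update_of_ne hj.symm, h']
    · rintro ⟨t, ⟨h1, h2⟩, hst⟩
      have h1' : t i = t k := h1
      have h2' : t k = t j := h2
      exact (hst i hi.symm).trans (h1'.trans (h2'.trans (hst j hj.symm).symm))
  · intro i j X hij
    refine Set.eq_empty_iff_forall_notMem.2 ?_
    rintro s ⟨⟨t, ⟨ht, htX⟩, hst⟩, r, ⟨hr, hrX⟩, hsr⟩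
    refine hrX ?_
    have htr : t = r := by
      funext k
      by_cases hk : k = i
      · subst hk
        have ht' : t k = t j := ht
        have hr' : r k = r j := hr
        rw [ht', hr', ← hst j hij.symm, ← hsr j hij.symm]
      · rw [← hst k hk, ← hsr k hk]
    exact htr ▸ htX

theorem IsEmbedding.isCA {n : ℕ} {A : Alg.{u} n} {B : Alg.{v} n}
    {f : BoundedLatticeHom A.carrier B.carrier} (hf : IsEmbedding A B f) (hB : IsCA B) :
    IsCA A where
  c_bot i := hf.injective (by rw [hf.map_c, map_bot, hB.c_bot])
  le_c i x := by
    rw [← inf_eq_left]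
    exact hf.injective (by rw [map_inf, hf.map_c, inf_eq_left.2 (hB.le_c i _)])
  c_inf_c i x y := hf.injective (by
    rw [hf.map_c, map_inf, hf.map_c, hB.c_inf_c, map_inf, hf.map_c, hf.map_c])
  c_comm i j x := hf.injective (by rw [hf.map_c, hf.map_c, hB.c_comm, hf.map_c, hf.map_c])
  d_self i := hf.injective (by rw [hf.map_d, hB.d_self, map_top])
  d_eq i j k hi hj := hf.injective (by
    rw [hf.map_d, hf.map_c, map_inf, hf.map_d, hf.map_d, hB.d_eq i j k hi hj])
  c_d_disjoint i j x hij := hf.injective (by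
    rw [map_inf, hf.map_c, hf.map_c, map_inf, map_inf, map_compl', hf.map_d,
      hB.c_d_disjoint i j _ hij, map_bot])

theorem le_sup_iff_of_isAtom {B : Type u} [BooleanAlgebra B] {a x y : B} (ha : IsAtom a) :
    a ≤ x ⊔ y ↔ a ≤ x ∨ a ≤ y := by
  rw [← IsAtom.not_disjoint_iff_le ha, ← IsAtom.not_disjoint_iff_le ha,
    ← IsAtom.not_disjoint_iff_le ha, disjoint_sup_right, not_and_or]

section AtomStructure

variable {n : ℕ} {B : Alg.{u} n} (hB : IsCA B)

include hB

/-- Each `c i` is self-conjugate: if `b` were disjoint from `c i a`, so would be `c i b`, which lies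
above `a`. -/
theorem IsCA.le_c_symm (i : Fin n) {a b : B.carrier} (hb : IsAtom b) (ha : a ≠ ⊥)
    (h : a ≤ B.c i b) : b ≤ B.c i a := by
  rw [← hb.not_disjoint_iff_le, disjoint_iff]
  intro h1
  have h2 := hB.c_inf_eq_bot i (hB.c_c i a) h1
  exact ha (le_bot_iff.1 (h2 ▸ le_inf h (hB.le_c i a)))

/-- Self-conjugacy supplies the complete additivity needed here: `x ⊓ c i a` is nonzero when `a ≤ c
i x`, and any atom `b` below it satisfies `a ≤ c i b` by symmetry. -/
theorem IsCA.le_c_iff_exists_atom [IsAtomic B.carrier] (i : Fin n) {a x : B.carrier}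
    (ha : IsAtom a) : a ≤ B.c i x ↔ ∃ b, IsAtom b ∧ b ≤ x ∧ a ≤ B.c i b := by
  refine ⟨fun h => ?_, fun ⟨b, _, hbx, hab⟩ => hab.trans (hB.c_mono i hbx)⟩
  rcases eq_bot_or_exists_atom_le (x ⊓ B.c i a) with h1 | ⟨b, hb, hbx⟩
  · have h2 := hB.c_inf_c i x a
    rw [h1, hB.c_bot] at h2
    exact (ha.1 (le_bot_iff.1 (h2 ▸ le_inf h (hB.le_c i a)))).elim
  · exact ⟨b, hb, hbx.trans inf_le_left,
      hB.le_c_symm i ha hb.1 (hbx.trans inf_le_right)⟩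

theorem IsCA.le_c_trans (i : Fin n) {a b x : B.carrier} (hab : a ≤ B.c i b) (hbx : b ≤ B.c i x) :
    a ≤ B.c i x :=
  hab.trans ((hB.c_mono i hbx).trans (hB.c_c i x).le)

/-- The complex algebra of the atom structure of an atomic cylindric algebra is cylindric. -/
theorem IsCA.isCA_Cm_At [IsAtomic B.carrier] : IsCA (Cm (At B)) := by
  have symm : ∀ (i : Fin n) (a b : (At B).carrier), (At B).T i a b → (At B).T i b a :=
    fun i a b h => hB.le_c_symm i b.2 a.2.1 h
  have trans : ∀ (i : Fin n) (a b d : (At B).carrier), (At B).T i a b → (At B).T i b d →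
      (At B).T i a d := fun i a b d h h' => hB.le_c_trans i h h'
  constructor
  · intro i
    refine Set.eq_empty_iff_forall_notMem.2 ?_
    rintro a ⟨b, hb, -⟩
    exact hb
  · exact fun i X a ha => ⟨a, ha, hB.le_c i a.1⟩
  · intro i X Y
    refine Set.ext fun a => ⟨?_, ?_⟩
    · rintro ⟨b, ⟨hbX, d, hd, hbd⟩, hab⟩
      exact ⟨⟨b, hbX, hab⟩, d, hd, trans i a b d hab hbd⟩
    · rintro ⟨⟨b, hbX, hab⟩, d, hd, had⟩
      exact ⟨b, ⟨hbX, d, hd, trans i b a d (symm i a b hab) had⟩, hab⟩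
  · have key : ∀ (i j : Fin n) (X : Set (At B).carrier),
        (Cm (At B)).c i ((Cm (At B)).c j X) ≤ (Cm (At B)).c j ((Cm (At B)).c i X) := by
      rintro i j X a ⟨b, ⟨d, hd, hbd⟩, hab⟩
      have h1 : a.1 ≤ B.c i (B.c j d.1) := le_trans hab (hB.c_mono i hbd)
      rw [hB.c_comm] at h1
      obtain ⟨b', hb', hbd', hab'⟩ := (hB.le_c_iff_exists_atom j a.2).1 h1
      exact ⟨⟨b', hb'⟩, ⟨d, hd, hbd'⟩, hab'⟩
    exact fun i j X => le_antisymm (key i j X) (key j i X)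
  · exact fun i => Set.eq_univ_of_forall fun a => le_top.trans (hB.d_self i).ge
  · intro i j k hi hj
    refine Set.ext fun a => ?_
    refine Iff.trans (b := a.1 ≤ B.c k (B.d i k ⊓ B.d k j)) ?_ ?_
    · rw [← hB.d_eq i j k hi hj]
      rfl
    · rw [hB.le_c_iff_exists_atom k a.2]
      refine ⟨fun ⟨b, hb, hbd, hab⟩ => ⟨⟨b, hb⟩, le_inf_iff.1 hbd, hab⟩, ?_⟩
      rintro ⟨b, hbd, hab⟩
      exact ⟨b.1, b.2, le_inf hbd.1 hbd.2, hab⟩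
  · intro i j X hij
    refine Set.eq_empty_iff_forall_notMem.2 ?_
    rintro a ⟨⟨b, ⟨hbd, hbX⟩, hab⟩, b', ⟨hbd', hbX'⟩, hab'⟩
    have hne : b ≠ b' := fun h => hbX' (h ▸ hbX)
    have hbd : b.1 ≤ B.d i j := hbd
    have hbd' : b'.1 ≤ B.d i j := hbd'
    have h1 : b'.1 ≤ b.1ᶜ := le_compl_iff_disjoint_right.2
      (IsAtom.disjoint_of_ne b'.2 b.2 fun h => hne (Subtype.ext h.symm))
    have h2 : b.1 ≤ B.c i (B.d i j ⊓ b.1) ⊓ B.c i (B.d i j ⊓ b.1ᶜ) :=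
      le_inf (le_trans (le_inf hbd le_rfl) (hB.le_c i _))
        ((trans i b a b' (symm i a b hab) hab').trans (hB.c_mono i (le_inf hbd' h1)))
    rw [hB.c_d_disjoint i j _ hij] at h2
    exact b.2.1 (le_bot_iff.1 h2)

/-- The complex algebra of the atom structure of an atomic cylindric algebra is its completion. -/
theorem IsCA.isCompletion_Cm_At [IsAtomic B.carrier] : IsCompletion B (Cm (At B)) := by
  let f : BoundedLatticeHom B.carrier (Cm (At B)).carrier :=
    { toFun := fun x => {a : (At B).carrier | a.1 ≤ x}
      map_sup' := fun x y => Set.ext fun a => le_sup_iff_of_isAtom a.2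
      map_inf' := fun x y => Set.ext fun a => le_inf_iff
      map_top' := Set.eq_univ_of_forall fun a => le_top
      map_bot' := Set.eq_empty_iff_forall_notMem.2 fun a ha => a.2.1 (le_bot_iff.1 ha) }
  refine ⟨hB.isCA_Cm_At, fun X => ⟨(⋃₀ X : Set (At B).carrier), ?_⟩, f, ⟨?_, ?_, ?_⟩, ?_⟩
  · exact ⟨fun Y hY => Set.subset_sUnion_of_mem hY, fun Z hZ => Set.sUnion_subset hZ⟩
  · intro x y hxy
    exact BooleanAlgebra.eq_iff_atom_le_iff.2 fun a ha => Set.ext_iff.1 hxy ⟨a, ha⟩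
  · intro i x
    refine Set.ext fun a => (hB.le_c_iff_exists_atom i a.2).trans ?_
    exact ⟨fun ⟨b, hb, hbx, hab⟩ => ⟨⟨b, hb⟩, hbx, hab⟩, fun ⟨b, hbx, hab⟩ => ⟨b.1, b.2, hbx, hab⟩⟩
  · exact fun i j => rfl
  · intro Y hY
    obtain ⟨a, ha⟩ := Set.nonempty_iff_ne_empty.2 hY
    refine ⟨a.1, a.2.1, fun b hb => ?_⟩
    have h1 : b = a := Subtype.ext ((IsAtom.le_iff_eq a.2 b.2.1).1 hb)
    exact h1 ▸ ha

end AtomStructure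

/-- A cylindric set algebra, as a subalgebra of the full one. -/
def subSetAlg {n : ℕ} {U : Type u} (L : BooleanSubalgebra (Set (Fin n → U)))
    (hc : ∀ i, ∀ Y ∈ L, (setAlg n U).c i Y ∈ L) (hd : ∀ i j, (setAlg n U).d i j ∈ L) :
    Alg.{u} n where
  carrier := L
  ba := inferInstance
  c i Y := ⟨(setAlg n U).c i Y.1, hc i Y.1 Y.2⟩
  d i j := ⟨(setAlg n U).d i j, hd i j⟩

section SubSetAlg

variable {n : ℕ} {U : Type u} {L : BooleanSubalgebra (Set (Fin n → U))}
  {hc : ∀ i, ∀ Y ∈ L, (setAlg n U).c i Y ∈ L} {hd : ∀ i j, (setAlg n U).d i j ∈ L}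

theorem isEmbedding_subtype : IsEmbedding (subSetAlg L hc hd) (setAlg n U) L.subtype where
  injective := Subtype.val_injective
  map_c _ _ := rfl
  map_d _ _ := rfl

theorem representable_subSetAlg : Representable (subSetAlg L hc hd) :=
  ⟨PUnit, fun _ => U,
    { toFun := fun Y _ => Y.1
      map_sup' := fun _ _ => rfl
      map_inf' := fun _ _ => rfl
      map_top' := rfl
      map_bot' := rfl },
    ⟨fun _ _ h => Subtype.ext (congrFun h PUnit.unit), fun _ _ => rfl, fun _ _ => rfl⟩⟩

/-- A relation of arity `n` is viewed as one of arity `n + k` that ignores the last `k` coordinates.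
A nonempty base makes this injective; `ULift` only adjusts universes. -/
theorem sNr_subSetAlg [Nonempty U] (k : ℕ) : SNr.{max u v, u} n k (subSetAlg L hc hd) := by
  classical
  let ρ : (Fin (n + k) → ULift.{v} U) → Fin n → U := fun s i => (s (Fin.castAdd k i)).down
  refine ⟨setAlg (n + k) (ULift.{v} U), isCA_setAlg _ _,
    { toFun := fun Y => ρ ⁻¹' Y.1
      map_sup' := fun _ _ => rfl
      map_inf' := fun _ _ => rfl
      map_top' := rfl
      map_bot' := rfl }, ?_, ?_, ?_, ?_⟩
  · intro Y Z hYZ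
    have hρ : Function.Surjective ρ := fun t =>
      ⟨Fin.append (fun i => ⟨t i⟩) fun _ => ⟨Classical.arbitrary U⟩, funext fun i => by simp [ρ]⟩
    exact Subtype.ext (hρ.preimage_injective hYZ)
  · intro Y j
    refine le_antisymm ?_ ((isCA_setAlg _ _).le_c _ _)
    rintro s ⟨t, ht, hst⟩
    have : ρ s = ρ t := funext fun i => congrArg ULift.down (hst _ (by
      intro h
      have := congrArg Fin.val h
      simp at this
      omega))
    exact show ρ s ∈ Y.1 from this ▸ ht
  · intro i Y
    refine Set.ext fun s => ⟨?_, ?_⟩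
    · rintro ⟨t, ht, hst⟩
      refine ⟨Function.update s (Fin.castAdd k i) ⟨t i⟩, ?_,
        fun j hj => (Function.update_of_ne hj _ _).symm⟩
      have : ρ (Function.update s (Fin.castAdd k i) ⟨t i⟩) = t := by
        funext j
        by_cases hj : j = i
        · subst hj; simp [ρ]
        · have : Fin.castAdd k j ≠ Fin.castAdd k i := fun h => hj (Fin.castAdd_injective _ _ h)
          simp only [ρ, Function.update_of_ne this]
          exact hst j hj
      exact show _ ∈ Y.1 from this.symm ▸ ht
    · rintro ⟨t, ht, hst⟩
      exact ⟨ρ t, ht, fun j hj => congrArg ULift.down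
        (hst _ fun h => hj (Fin.castAdd_injective _ _ h))⟩
  · intro i j
    exact Set.ext fun s => ULift.down_injective.eq_iff

end SubSetAlg

end Cyl

/-! ### The atomic algebra of relations invariant under similarity. -/

namespace Cyl

open EdgeCol

namespace EdgeCol

/-- The index of a red, and `0` for other colours. -/
def height : EdgeCol → ℕ
  | red (some q) => q.1
  | _ => 0

theorem collapse_of_height_lt {N : ℕ} {a : EdgeCol} (h : a.height < N) : a.collapse N = a := by
  rcases a with _ | _ | (_ | ⟨m, b⟩)
  · rfl
  · rfl
  · rfl
  · have h' : m < N := h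
    simp [collapse, RedIdx.collapse, h']

theorem eq_of_forall_collapse_eq {a b : EdgeCol} (h : ∀ N, a.collapse N = b.collapse N) :
    a = b := by
  have h1 := h (a.height ⊔ b.height + 1)
  rwa [collapse_of_height_lt (Nat.lt_succ_of_le le_sup_left),
    collapse_of_height_lt (Nat.lt_succ_of_le le_sup_right)] at h1

theorem eq_of_collapse_eq {N : ℕ} {a b : EdgeCol} (h : a.collapse N = b) (hb : b ≠ red none) :
    a = b := by
  rcases a with _ | _ | r
  · exact h
  · exact h
  · subst h
    have h1 : RedIdx.collapse N r ≠ none := fun h => hb (congrArg red h)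
    obtain ⟨q, hq⟩ := Option.ne_none_iff_exists'.1 h1
    have h2 := (RedIdx.eq_of_collapse_eq_some hq).1
    show red r = red (RedIdx.collapse N r)
    rw [hq, h2]

open Classical in
/-- Replace the additional shade of red by a half of the red with index `N`. -/
noncomputable def split (N : ℕ) (P : Prop) : EdgeCol → EdgeCol
  | red r => red (r.elim (some (N, decide P)) some)
  | a => a

theorem collapse_split (N : ℕ) (P : Prop) (a : EdgeCol) :
    (a.split N P).collapse N = a.collapse N := by
  rcases a with _ | _ | (_ | _) <;> simp [split, collapse, RedIdx.collapse]

theorem split_ne_red_none (N : ℕ) (P : Prop) (a : EdgeCol) : a.split N P ≠ red none := by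
  rcases a with _ | _ | (_ | _) <;> simp [split]

/-- Among the edges coloured `none`, exactly the one with the smallest opposite node receives the
half `true`. If there are at least two such edges, both halves of the red `N` occur. If there is at
most one, the given link does not involve it and persists. -/
theorem linked_split {N x y z : ℕ} (hxy : x ≠ y) (hxz : x ≠ z) (hyz : y ≠ z) {r s t : RedIdx}
    (h : Linked r s ∨ Linked r t ∨ Linked s t) {P Q R : Prop} [Decidable P] [Decidable Q]
    [Decidable R]
    (hP : P ↔ (s = none → z < y) ∧ (t = none → z < x))
    (hQ : Q ↔ (r = none → y < z) ∧ (t = none → y < x))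
    (hR : R ↔ (r = none → x < z) ∧ (s = none → x < y)) :
    Linked (r.elim (some (N, decide P)) some) (s.elim (some (N, decide Q)) some) ∨
    Linked (r.elim (some (N, decide P)) some) (t.elim (some (N, decide R)) some) ∨
    Linked (s.elim (some (N, decide Q)) some) (t.elim (some (N, decide R)) some) := by
  rcases r with _ | r <;> rcases s with _ | s <;> rcases t with _ | t <;>
    simp only [Linked, Option.elim, decide_eq_decide, true_and, ne_eq, reduceCtorEq, false_imp_iff,
      true_imp_iff, and_true, or_false, false_or, or_self] at h hP hQ hR ⊢
  · by_cases hP' : P <;> by_cases hQ' : Q <;> by_cases hR' : R <;> simp_all <;> omega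
  · left; by_cases hP' : P <;> by_cases hQ' : Q <;> simp_all <;> omega
  · right; left; by_cases hP' : P <;> by_cases hR' : R <;> simp_all <;> omega
  · exact .inr (.inr h)
  · right; right; by_cases hP' : Q <;> by_cases hR' : R <;> simp_all <;> omega
  · exact .inr (.inl h)
  · exact .inl h
  · exact h

end EdgeCol

variable {p : ℕ} (c : (Fin p → ℕ) → ℕ → ℕ → EdgeCol)

/-- The additional shade of red does not occur in the tuple. -/
def Genuine (t : Fin (p + 3) → ℕ) : Prop :=
  ∀ (e : Fin p → Fin (p + 3)) (x y : Fin (p + 3)), Proper (t ∘ e) (t x) (t y) →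
    c (t ∘ e) (t x) (t y) ≠ red none

variable {c}

/-- Take `N` above the indices of the finitely many reds in `t`: then nothing in `t` is collapsed,
and `none` is not among its colours, so similarity up to `N` is exact. -/
theorem Genuine.exists_bound {t : Fin (p + 3) → ℕ} (ht : Genuine c t) :
    ∃ N, ∀ u, Sim c N Set.univ t u → ∀ N', Sim c N' Set.univ t u := by
  let f : (Fin p → Fin (p + 3)) × Fin (p + 3) × Fin (p + 3) → ℕ :=
    fun q => (c (t ∘ q.1) (t q.2.1) (t q.2.2)).height
  refine ⟨Finset.univ.sup f + 1, fun u hu N' => ⟨hu.eq_iff, fun e x y he hx hy hp => ?_⟩⟩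
  have h1 := hu.col e x y he hx hy hp
  rw [collapse_of_height_lt (Nat.lt_succ_of_le (Finset.le_sup (f := f)
    (Finset.mem_univ (e, x, y))))] at h1
  rw [eq_of_collapse_eq h1.symm (ht e x y hp)]

/-- In a triangle with nodes `x, y` and `w ∈ V`, the edge from `x` to `y` is smaller than the other
edges of the additional shade of red, if edges are ordered inversely to the opposite nodes. -/
def OppositeLeast (c : (Fin p → ℕ) → ℕ → ℕ → EdgeCol) (V : Finset ℕ) (e : Fin p → ℕ)
    (x y : ℕ) : Prop :=
  ∀ w ∈ V, Proper e x w → Proper e y w →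
    (c e x w = red none → w < y) ∧ (c e y w = red none → w < x)

theorem oppositeLeast_comm {V : Finset ℕ} {e : Fin p → ℕ} {x y : ℕ} :
    OppositeLeast c V e x y ↔ OppositeLeast c V e y x :=
  ⟨fun h w hw h1 h2 => (h w hw h2 h1).symm, fun h w hw h1 h2 => (h w hw h2 h1).symm⟩

/-- Among `p + 3` nodes, `p` of which are parameters, an edge has only one opposite node. Hence the
splitting of an edge, defined through all opposite nodes, is decided inside a single triangle. -/
theorem oppositeLeast_iff {V : Finset ℕ} (hV : V.card ≤ p + 3) {e : Fin p → ℕ} {x y z : ℕ}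
    (he : ∀ i, e i ∈ V) (hx : x ∈ V) (hy : y ∈ V) (hz : z ∈ V) (hxy : Proper e x y)
    (hxz : Proper e x z) (hyz : Proper e y z) : OppositeLeast c V e x y ↔
      (c e x z = red none → z < y) ∧ (c e y z = red none → z < x) := by
  refine ⟨fun h => h z hz hxz hyz, fun h w hw hxw hyw => ?_⟩
  obtain rfl : w = z := by
    by_contra hne
    exact absurd hV (not_le.2 (card_lt_of_proper_four he hx hy hw hz hxy hxw hyw hxz hyz hne))
  exact h

theorem isColouring_split (hc : IsColouring Set.univ c) {V : Finset ℕ} (hV : V.card ≤ p + 3)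
    (N : ℕ) : IsColouring (V : Set ℕ)
      fun e x y => (c e x y).split N (OppositeLeast c V e x y) := by
  classical
  refine ⟨fun e x y => by rw [hc.symm]; simp only [oppositeLeast_comm (x := x)], ?_⟩
  intro e x y z he hx hy hz hxy hxz hyz
  refine (hc.tri e x y z (fun _ => trivial) trivial trivial trivial hxy hxz hyz).of_collapse_eq
    (collapse_split N _ _) (collapse_split N _ _) (collapse_split N _ _) ?_
  intro r s t r₀ s₀ t₀ hr hs ht hr₀ hs₀ ht₀ h
  rw [hr₀] at hr
  rw [hs₀] at hs
  rw [ht₀] at ht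
  injection hr with hr
  injection hs with hs
  injection ht with ht
  subst hr hs ht
  refine linked_split hxy.ne hxz.ne hyz.ne h ?_ ?_ ?_
  · rw [oppositeLeast_iff hV he hx hy hz hxy hxz hyz, hs₀, ht₀]
    simp
  · rw [oppositeLeast_iff hV he hx hz hy hxz hxy hyz.symm, hc.symm e z y, hr₀, ht₀]
    simp
  · rw [oppositeLeast_iff hV he hy hz hx hyz hxy.symm hxz.symm, hc.symm e y x, hc.symm e z x,
      hr₀, hs₀]
    simp

/-- Every tuple is similar to one without the additional shade of red. -/
theorem IsUniversal.exists_genuine (hc : IsUniversal c) (N : ℕ) (s : Fin (p + 3) → ℕ) :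
    ∃ t, Sim c N Set.univ s t ∧ Genuine c t := by
  classical
  have hV : (Finset.univ.image s).card ≤ p + 3 := by
    simpa using Finset.card_image_le (s := Finset.univ) (f := s)
  have hm : ∀ i, s i ∈ Finset.univ.image s := fun i =>
    Finset.mem_image_of_mem s (Finset.mem_univ i)
  obtain ⟨θ, hθ, hθc⟩ := hc.exists_realization _ hV (isColouring_split hc.toIsColouring hV N)
  have h1 := fun (e : Fin p → Fin (p + 3)) x y => hθc (s ∘ e) (s x) (s y) (fun _ => hm _) (hm x)
    (hm y)
  refine ⟨θ ∘ s, ⟨fun i _ j _ => ?_, fun e x y _ _ _ hp => ?_⟩, fun e x y hp => ?_⟩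
  · exact (hθ.eq_iff (hm i) (hm j)).symm
  · exact (collapse_split N _ _).symm.trans (congrArg (collapse N) (h1 e x y hp).symm)
  · exact ne_of_eq_of_ne (h1 e x y (Proper.of_map hp)) (split_ne_red_none _ _ _)

/-- The relations that are unions of similarity classes, for some bound on reds. -/
def simAlg (c : (Fin p → ℕ) → ℕ → ℕ → EdgeCol) : BooleanSubalgebra (Set (Fin (p + 3) → ℕ)) where
  carrier := {Y | ∃ N, ∀ s t, Sim c N Set.univ s t → s ∈ Y → t ∈ Y}
  supClosed' := by
    rintro Y ⟨N, hN⟩ Z ⟨N', hN'⟩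
    exact ⟨N ⊔ N', fun _ _ hst hs => hs.imp (hN _ _ (hst.mono le_sup_left))
      (hN' _ _ (hst.mono le_sup_right))⟩
  infClosed' := by
    rintro Y ⟨N, hN⟩ Z ⟨N', hN'⟩
    exact ⟨N ⊔ N', fun _ _ hst hs => hs.imp (hN _ _ (hst.mono le_sup_left))
      (hN' _ _ (hst.mono le_sup_right))⟩
  compl_mem' := by
    rintro Y ⟨N, hN⟩
    exact ⟨N, fun _ _ hst hs ht => hs (hN _ _ hst.symm ht)⟩
  bot_mem' := ⟨0, fun _ _ _ h => h⟩

/-- The same bound `N` works: a witness for `s` is transported to `t` by the back-and-forth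
property. -/
theorem IsUniversal.c_mem_simAlg (hc : IsUniversal c) (i : Fin (p + 3)) (Y : Set (Fin (p + 3) → ℕ))
    (hY : Y ∈ simAlg c) : (setAlg (p + 3) ℕ).c i Y ∈ simAlg c := by
  classical
  obtain ⟨N, hN⟩ := hY
  refine ⟨N, ?_⟩
  rintro s t hst ⟨u, hu, hsu⟩
  obtain ⟨z, hz⟩ := hc.exists_update (s := t) (t := u) (i := i)
    ((hst.symm.restrict (Set.subset_univ _)).congr_right fun j hj => hsu j hj).symm
  exact ⟨_, hN _ _ hz hu, fun j hj => (Function.update_of_ne hj _ _).symm⟩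

theorem d_mem_simAlg (i j : Fin (p + 3)) : (setAlg (p + 3) ℕ).d i j ∈ simAlg c :=
  ⟨0, fun _ _ hst hs => (hst.eq_iff i trivial j trivial).1 hs⟩

/-- The algebra of unions of similarity classes. -/
def simSetAlg (hc : IsUniversal c) : Alg.{0} (p + 3) :=
  subSetAlg (simAlg c) hc.c_mem_simAlg d_mem_simAlg

/-- The class is an exact similarity class, while every member of the algebra is closed under
similarity up to some bound, so it contains the class or misses it. -/
theorem isAtom_of_genuine {t : Fin (p + 3) → ℕ} {N : ℕ}
    (hN : ∀ u, Sim c N Set.univ t u → ∀ N', Sim c N' Set.univ t u) {a : simAlg c}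
    (ha : a.1 = {u | Sim c N Set.univ t u}) : IsAtom a := by
  have hmem : ∀ u, u ∈ a.1 ↔ Sim c N Set.univ t u := fun u => by rw [ha]; rfl
  refine ⟨fun h => ?_, fun Y hY => ?_⟩
  · have h1 : t ∈ a.1 := (hmem t).2 (Sim.refl _ _ _ _)
    rw [h] at h1
    exact h1
  · by_contra hne
    have h1 : Y.1.Nonempty := Set.nonempty_iff_ne_empty.2 fun h => hne (Subtype.ext h)
    obtain ⟨s, hs⟩ := h1
    obtain ⟨M, hM⟩ := Y.2
    refine hY.not_ge fun u hu => ?_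
    exact hM s u (((hN s ((hmem s).1 (hY.le hs)) M).symm).trans (hN u ((hmem u).1 hu) M)) hs

/-- A nonempty member is closed under similarity up to some `M`, hence contains a genuine tuple
together with its whole exact class. -/
theorem IsUniversal.exists_class (hc : IsUniversal c) {Y : simAlg c} (hY : Y ≠ ⊥) :
    ∃ (t : Fin (p + 3) → ℕ) (N : ℕ) (a : simAlg c), Genuine c t ∧
      (∀ u, Sim c N Set.univ t u → ∀ N', Sim c N' Set.univ t u) ∧
      a.1 = {u | Sim c N Set.univ t u} ∧ a ≤ Y := by
  have h1 : Y.1.Nonempty := Set.nonempty_iff_ne_empty.2 fun h => hY (Subtype.ext h)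
  obtain ⟨s, hs⟩ := h1
  obtain ⟨M, hM⟩ := Y.2
  obtain ⟨t, hst, ht⟩ := hc.exists_genuine M s
  obtain ⟨N, hN⟩ := ht.exists_bound
  exact ⟨t, N, ⟨{u | Sim c N Set.univ t u}, N, fun u v huv hu => Sim.trans hu huv⟩, ht, hN, rfl,
    fun u hu => hM t u (hN u hu M) (hM s t hst hs)⟩

theorem IsUniversal.isAtomic (hc : IsUniversal c) : IsAtomic (simAlg c) := by
  refine ⟨fun Y => or_iff_not_imp_left.2 fun hY => ?_⟩
  obtain ⟨t, N, a, -, hN, ha, haY⟩ := hc.exists_class hY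
  exact ⟨a, isAtom_of_genuine hN ha, haY⟩

/-- The tuples in an atom are exactly similar. -/
theorem IsUniversal.atom_spec (hc : IsUniversal c) {a : simAlg c} (ha : IsAtom a) :
    (∃ t, t ∈ a.1) ∧ ∀ t ∈ a.1, Genuine c t ∧ ∀ u, (u ∈ a.1 ↔ ∀ N, Sim c N Set.univ t u) := by
  obtain ⟨t, N, b, ht, hN, hb, hba⟩ := hc.exists_class ha.1
  obtain rfl : b = a := (ha.le_iff_eq (isAtom_of_genuine hN hb).1).1 hba
  have hmem : ∀ u, u ∈ b.1 ↔ ∀ N, Sim c N Set.univ t u := fun u => by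
    rw [hb]
    exact ⟨hN u, fun h => h N⟩
  refine ⟨⟨t, (hmem t).2 fun N => Sim.refl _ _ _ _⟩, fun u hu => ⟨fun e x y hp => ?_, fun v => ?_⟩⟩
  · have h1 := fun N => ((hmem u).1 hu N).symm.col e x y (fun _ => trivial) trivial trivial hp
    rw [eq_of_forall_collapse_eq h1]
    exact ht e x y (((hmem u).1 hu 0).symm.proper (fun _ => trivial) trivial trivial hp)
  · rw [hmem v]
    exact forall_congr' fun N => ⟨fun h => ((hmem u).1 hu N).symm.trans h,
      fun h => ((hmem u).1 hu N).trans h⟩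

/-- Tuples without the additional shade of red belong to atoms. -/
theorem Genuine.exists_atom {t : Fin (p + 3) → ℕ} (ht : Genuine c t) :
    ∃ a : simAlg c, IsAtom a ∧ t ∈ a.1 := by
  obtain ⟨N, hN⟩ := ht.exists_bound
  exact ⟨⟨{u | Sim c N Set.univ t u}, N, fun u v huv hu => Sim.trans hu huv⟩,
    isAtom_of_genuine hN rfl, Sim.refl _ _ _ _⟩

end Cyl

/-! ### Two halves of red do not suffice: the completion is not neatly embeddable. -/

namespace Cyl

open EdgeCol

/-- The kinds of colours: the index of a red is forgotten. -/
abbrev Kind := (Fin 2 × Fin 6) ⊕ (Fin 2 ⊕ Option Bool)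

namespace EdgeCol

/-- The kind of a colour. -/
def kind : EdgeCol → Kind
  | green j t => .inl (j, t)
  | white j => .inr (.inl j)
  | red r => .inr (.inr (r.map Prod.snd))

theorem eq_green_of_kind_eq {a : EdgeCol} {j : Fin 2} {t : Fin 6}
    (h : a.kind = .inl (j, t)) : a = green j t := by
  cases a <;> simp_all [kind]

theorem eq_white_of_kind_eq {a : EdgeCol} {j : Fin 2} (h : a.kind = .inr (.inl j)) :
    a = white j := by
  cases a <;> simp_all [kind]

theorem eq_red_of_kind_eq {a : EdgeCol} {b : Bool} (h : a.kind = .inr (.inr (some b))) :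
    ∃ m, a = red (some (m, b)) := by
  rcases a with _ | _ | (_ | ⟨m, b'⟩) <;> simp_all [kind]

end EdgeCol

variable {p : ℕ}

section Cone

/-- A cone with base nodes `p, p + 1`, apex `p + 2` and tint `t`, for the parameters `0, …, p - 1`;
everything else is white. -/
def conePattern (p : ℕ) (t : Fin 6) (e : Fin p → ℕ) (x y : ℕ) : EdgeCol :=
  if (∀ i, e i = i) ∧ (x = p + 2 ∨ y = p + 2) then
    if x = p ∨ y = p then green 0 t else green 1 0
  else white 0

theorem isColouring_conePattern (t : Fin 6) :
    IsColouring (Finset.range (p + 3) : Set ℕ) (conePattern p t) := by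
  refine ⟨fun e x y => ?_, fun e x y z _ hx hy hz hxy hxz hyz => ?_⟩
  · simp only [conePattern, or_comm]
  · by_cases he : ∀ i, e i = i
    swap
    · simp only [conePattern, he, false_and, if_false]
      exact ok_white_white _ _ _
    have h1 : Ok (green 0 t) (green 1 0) (white 0) := ok_white fun _ h => by cases h
    have h2 := h1.swap₁
    have h3 := h1.swap₂
    have h4 := h2.swap₂
    have h5 := h3.swap₁
    have h6 := h4.swap₁
    have hge : ∀ v, v ∈ (Finset.range (p + 3) : Set ℕ) → (∀ i, e i ≠ v) →
        v = p ∨ v = p + 1 ∨ v = p + 2 := by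
      intro v hv h
      have hv' : v < p + 3 := by simpa using hv
      have : ¬ v < p := fun hv => h ⟨v, hv⟩ (he _)
      omega
    have n1 := hxy.ne
    have n2 := hxz.ne
    have n3 := hyz.ne
    have a0 : p + 1 ≠ p := by omega
    have a1 : p + 2 ≠ p := by omega
    have a2 : p ≠ p + 2 := by omega
    rcases hge x hx hxy.left with rfl | rfl | rfl <;>
      rcases hge y hy hxy.right with rfl | rfl | rfl <;>
      rcases hge z hz hxz.right with rfl | rfl | rfl <;>
      first
      | exact absurd rfl n1
      | exact absurd rfl n2
      | exact absurd rfl n3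
      | simpa [conePattern, he] using h1
      | simpa [conePattern, he] using h2
      | simpa [conePattern, he] using h3
      | simpa [conePattern, he] using h4
      | simpa [conePattern, he] using h5
      | simpa [conePattern, he] using h6

end Cone

variable {c : (Fin p → ℕ) → ℕ → ℕ → EdgeCol}

theorem IsUniversal.exists_cone (hc : IsUniversal c) (t : Fin 6) :
    ∃ u : Fin (p + 3) → ℕ, Function.Injective u ∧
      ∀ (e : Fin p → Fin (p + 3)) (x y : Fin (p + 3)), Proper (u ∘ e) (u x) (u y) →
        c (u ∘ e) (u x) (u y) = conePattern p t (fun i => e i) x y := by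
  obtain ⟨θ, hθ, hθc⟩ := hc.exists_realization (Finset.range (p + 3)) (by simp)
    (isColouring_conePattern t)
  have hm : ∀ i : Fin (p + 3), i.1 ∈ Finset.range (p + 3) := fun i => Finset.mem_range.2 i.2
  exact ⟨fun i => θ i, fun i j hij => Fin.ext (hθ (hm i) (hm j) hij), fun e x y hp =>
    hθc (fun i => e i) x y (fun i => hm _) (hm x) (hm y) (Proper.of_map (f := θ) hp)⟩

theorem genuine_of_cone {t : Fin 6} {u : Fin (p + 3) → ℕ}
    (hu : ∀ (e : Fin p → Fin (p + 3)) (x y : Fin (p + 3)), Proper (u ∘ e) (u x) (u y) →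
        c (u ∘ e) (u x) (u y) = conePattern p t (fun i => e i) x y) : Genuine c u := by
  intro e x y hp
  rw [hu e x y hp, conePattern]
  split_ifs <;> simp

variable (c) in
open Classical in
/-- The kind of the colour of the edge between two of the last three nodes of a tuple. -/
noncomputable def tupleLabel (u : Fin (p + 3) → ℕ) (x y : Fin 3) : Option Kind :=
  if Proper (u ∘ Fin.castAdd 3) (u (Fin.natAdd p x)) (u (Fin.natAdd p y)) then
    some (c (u ∘ Fin.castAdd 3) (u (Fin.natAdd p x)) (u (Fin.natAdd p y))).kind
  else none

theorem tupleLabel_congr {D : Set (Fin (p + 3))} {u v : Fin (p + 3) → ℕ}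
    (h : ∀ N, Sim c N D u v) {x y : Fin 3} (he : ∀ i, Fin.castAdd 3 i ∈ D)
    (hx : Fin.natAdd p x ∈ D) (hy : Fin.natAdd p y ∈ D) :
    tupleLabel c u x y = tupleLabel c v x y := by
  unfold tupleLabel
  by_cases hp : Proper (u ∘ Fin.castAdd 3) (u (Fin.natAdd p x)) (u (Fin.natAdd p y))
  · rw [if_pos hp, if_pos ((h 0).proper he hx hy hp),
      eq_of_forall_collapse_eq fun N => (h N).col _ _ _ he hx hy hp]
  · rw [if_neg hp, if_neg fun h' => hp ((h 0).symm.proper he hx hy h')]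

/-- Together with `sim_of_le_c`, this describes accessibility between atoms by exact similarity off
one coordinate; the back-and-forth property passes from one pair of tuples to all tuples of the
atom. -/
theorem IsUniversal.le_c_of_sim (hc : IsUniversal c) {a b : simAlg c} (ha : IsAtom a)
    (hb : IsAtom b) {u v : Fin (p + 3) → ℕ} (hu : u ∈ a.1) (hv : v ∈ b.1) {i : Fin (p + 3)}
    (h : ∀ N, Sim c N {i}ᶜ u v) : a.1 ⊆ (setAlg (p + 3) ℕ).c i b.1 := by
  classical
  intro s hs
  obtain ⟨N, hN⟩ := (((hc.atom_spec hb).2 v hv).1).exists_bound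
  have h1 := (((hc.atom_spec ha).2 u hu).2 s).1 hs N
  obtain ⟨z, hz⟩ := hc.exists_update (s := s) (t := v) (i := i)
    ((h N).symm.trans (h1.restrict (Set.subset_univ _)))
  exact ⟨_, (((hc.atom_spec hb).2 v hv).2 _).2 (hN _ hz),
    fun j hj => (Function.update_of_ne hj _ _).symm⟩

theorem sim_of_le_c (hc : IsUniversal c) {a b : simAlg c} (hb : IsAtom b)
    {u v : Fin (p + 3) → ℕ} (hu : u ∈ a.1) (hv : v ∈ b.1) {i : Fin (p + 3)}
    (h : a.1 ⊆ (setAlg (p + 3) ℕ).c i b.1) (N : ℕ) : Sim c N {i}ᶜ u v := by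
  obtain ⟨t, ht, hut⟩ := h hu
  exact ((((((hc.atom_spec hb).2 v hv).2 t).1 ht N).restrict (Set.subset_univ _)).congr_right
    fun j hj => (hut j hj).symm).symm

theorem tupleLabel_eq_some {u : Fin (p + 3) → ℕ} {x y : Fin 3} {k : Kind} :
    tupleLabel c u x y = some k ↔
      Proper (u ∘ Fin.castAdd 3) (u (Fin.natAdd p x)) (u (Fin.natAdd p y)) ∧
        (c (u ∘ Fin.castAdd 3) (u (Fin.natAdd p x)) (u (Fin.natAdd p y))).kind = k := by
  unfold tupleLabel
  split_ifs with h <;> simp [h]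

theorem eq_of_tupleLabel_eq_none {u : Fin (p + 3) → ℕ} {x y z : Fin 3} {k k' : Kind}
    (h₁ : tupleLabel c u x y = some k) (h₂ : tupleLabel c u x z = some k')
    (h₃ : tupleLabel c u y z = none) : k = k' := by
  obtain ⟨p1, e1⟩ := tupleLabel_eq_some.1 h₁
  obtain ⟨p2, e2⟩ := tupleLabel_eq_some.1 h₂
  have h4 : u (Fin.natAdd p y) = u (Fin.natAdd p z) := by
    by_contra h
    rw [tupleLabel, if_pos ⟨p1.inj, h, p1.right, p2.right⟩] at h₃
    cases h₃
  rw [← e1, ← e2, h4]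

theorem exists_ok_of_tupleLabel (hc : IsColouring Set.univ c) {u : Fin (p + 3) → ℕ}
    (hu : Genuine c u) {x y z : Fin 3} {k₁ k₂ k₃ : Kind}
    (h₁ : tupleLabel c u x y = some k₁) (h₂ : tupleLabel c u x z = some k₂)
    (h₃ : tupleLabel c u y z = some k₃) :
    ∃ a b d : EdgeCol, a.kind = k₁ ∧ b.kind = k₂ ∧ d.kind = k₃ ∧ Ok a b d ∧ d ≠ red none := by
  obtain ⟨p1, e1⟩ := tupleLabel_eq_some.1 h₁
  obtain ⟨p2, e2⟩ := tupleLabel_eq_some.1 h₂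
  obtain ⟨p3, e3⟩ := tupleLabel_eq_some.1 h₃
  exact ⟨_, _, _, e1, e2, e3, hc.tri _ _ _ _ (fun _ => trivial) trivial trivial trivial p1 p2 p3,
    hu _ _ _ p3⟩

/-- Five cones with different tints over a base that already carries a cone cannot be amalgamated
with only two kinds of red between their apices. -/
theorem false_of_labelling {F : Type u} {A : CylFrame (Fin 7) F}
    {e : F → Fin 7 → Fin 7 → Option Kind}
    (he : A.IsLabelling e)
    (hapex : ∀ V i j t t', i ≠ j → 2 ≤ i → 2 ≤ j → t ≠ t' →
      e V 0 i = some (.inl (0, t)) → e V 1 i = some (.inl (1, 0)) →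
      e V 0 j = some (.inl (0, t')) → e V 1 j = some (.inl (1, 0)) →
      ∃ b, e V i j = some (.inr (.inr (some b))))
    (hred : ∀ V i j k b, i ≠ j → i ≠ k → j ≠ k → e V i j = some (.inr (.inr (some b))) →
      e V i k = some (.inr (.inr (some b))) → e V j k ≠ some (.inr (.inr (some b))))
    {U : F} (hU₀ : e U 0 2 = some (.inl (0, 0))) (hU₁ : e U 1 2 = some (.inl (1, 0)))
    (hext : ∀ t : Fin 6, ∃ V, A.R 3 U V ∧ e V 0 3 = some (.inl (0, t)) ∧
      e V 1 3 = some (.inl (1, 0))) : False := by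
  choose X hX hX₀ hX₁ using hext
  have hXa : ∀ t, e (X t) 0 2 = some (.inl (0, 0)) ∧ e (X t) 1 2 = some (.inl (1, 0)) := fun t => by
    rw [← he.inv 3 0 2 _ _ (by decide) (by decide) (by decide) (hX t),
      ← he.inv 3 1 2 _ _ (by decide) (by decide) (by decide) (hX t)]
    exact ⟨hU₀, hU₁⟩
  have h1 : ∀ t, t ≠ 0 → ∃ b, e (X t) 2 3 = some (.inr (.inr (some b))) := fun t ht =>
    hapex (X t) 2 3 0 t (by decide) (by decide) (by decide) ht.symm (hXa t).1 (hXa t).2 (hX₀ t)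
      (hX₁ t)
  choose! β hβ using h1
  have hRX : ∀ t t', A.R 3 (X t) (X t') := fun t t' =>
    (A.equiv 3).trans ((A.equiv 3).symm (hX t)) (hX t')
  -- Five tints and two halves: three of the five new apexes are joined to the apex `2` by the same
  -- half `ε`.
  obtain ⟨ε, -, hε⟩ := Finset.exists_lt_card_fiber_of_mul_lt_card_of_maps_to
    (s := (Finset.univ : Finset (Fin 6)).erase 0) (t := (Finset.univ : Finset Bool))
    (f := β) (n := 2) (fun _ _ => Finset.mem_univ _) (by decide)
  obtain ⟨t₁, t₂, t₃, ht₁, ht₂, ht₃, h12, h13, h23⟩ := Finset.two_lt_card_iff.1 hε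
  simp only [Finset.mem_filter, Finset.mem_erase, Finset.mem_univ, and_true] at ht₁ ht₂ ht₃
  -- a point with the coordinate `3` of `V` at `i`, and the other coordinates of `V'`
  have amalg : ∀ V V' i, 3 ≠ i → A.R 3 V V' → ∃ W, A.R 3 (A.sub i 3 V) W ∧
      (∀ x, x ≠ 3 → x ≠ i → e W x i = e V x 3) ∧
      ∀ x y, x ≠ y → x ≠ i → y ≠ i → e W x y = e V' x y := by
    intro V V' i hi hR
    obtain ⟨W, hW1, hW2⟩ := A.comm i 3 _ _ _
      ((A.equiv i).symm (CylFrame.R_sub (j := 3) V)) hR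
    refine ⟨W, hW1, fun x hx hxi => ?_, fun x y hxy hx hy => ?_⟩
    · rw [← he.inv 3 x i _ _ hxi hx.symm hi hW1]
      exact he.sub_right hxi.symm hx.symm hi.symm V
    · exact he.inv i x y _ _ hxy hx.symm hy.symm hW2
  -- The apex of tint `t₁` is copied to coordinate `4` beside the apex of tint `t` at `3`. Both see
  -- `2` in `ε`, so they see each other in the other half.
  have pair : ∀ t, t ≠ 0 → β t = ε → t₁ ≠ t → ∃ W, A.R 3 (A.sub 4 3 (X t₁)) W ∧
      (e W 0 3 = some (.inl (0, t)) ∧ e W 1 3 = some (.inl (1, 0))) ∧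
      e W 2 3 = some (.inr (.inr (some ε))) ∧ e W 4 3 = some (.inr (.inr (some (!ε)))) := by
    intro t ht hβt htt
    obtain ⟨W, hW, hW4, hWo⟩ := amalg (X t₁) (X t) 4 (by decide) (hRX _ _)
    have w0 := (hWo 0 3 (by decide) (by decide) (by decide)).trans (hX₀ t)
    have w1 := (hWo 1 3 (by decide) (by decide) (by decide)).trans (hX₁ t)
    have w2 := (hWo 2 3 (by decide) (by decide) (by decide)).trans (hβ t ht)
    have v0 := (hW4 0 (by decide) (by decide)).trans (hX₀ t₁)
    have v1 := (hW4 1 (by decide) (by decide)).trans (hX₁ t₁)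
    have v2 := (hW4 2 (by decide) (by decide)).trans (hβ t₁ ht₁.1)
    rw [hβt] at w2
    rw [ht₁.2] at v2
    obtain ⟨b, hb⟩ := hapex W 4 3 t₁ t (by decide) (by decide) (by decide) htt v0 v1 w0 w1
    have hbε : b ≠ ε := by
      rintro rfl
      exact hred W 2 4 3 b (by decide) (by decide) (by decide) v2 w2 hb
    obtain rfl : b = !ε := by cases b <;> cases ε <;> simp_all
    exact ⟨W, hW, ⟨w0, w1⟩, w2, hb⟩
  obtain ⟨W₂, hW₂, a01, a2, a4⟩ := pair t₂ ht₂.1 ht₂.2 h12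
  obtain ⟨W₃, hW₃, b01, b2, b4⟩ := pair t₃ ht₃.1 ht₃.2 h13
  -- `W₂` and `W₃` differ only at coordinate `3`, both having the apex of tint `t₁` at `4`. In `Z`
  -- the three apexes at `4, 5, 3` stand together: the edge from `5` to `3` cannot be `ε` because of
  -- `2`, nor the other half because of `4`.
  obtain ⟨Z, -, hZ5, hZo⟩ := amalg W₂ W₃ 5 (by decide)
    ((A.equiv 3).trans ((A.equiv 3).symm hW₂) hW₃)
  have w0 := (hZo 0 3 (by decide) (by decide) (by decide)).trans b01.1
  have w1 := (hZo 1 3 (by decide) (by decide) (by decide)).trans b01.2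
  have w2 := (hZo 2 3 (by decide) (by decide) (by decide)).trans b2
  have w4 := (hZo 4 3 (by decide) (by decide) (by decide)).trans b4
  have v0 := (hZ5 0 (by decide) (by decide)).trans a01.1
  have v1 := (hZ5 1 (by decide) (by decide)).trans a01.2
  have v2 := (hZ5 2 (by decide) (by decide)).trans a2
  have v4 := (hZ5 4 (by decide) (by decide)).trans a4
  obtain ⟨b, hb⟩ := hapex Z 5 3 t₂ t₃ (by decide) (by decide) (by decide) h23 v0 v1 w0 w1
  rcases eq_or_ne b ε with rfl | hbε
  · exact hred Z 2 5 3 b (by decide) (by decide) (by decide) v2 w2 hb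
  · obtain rfl : b = !ε := by cases b <;> cases ε <;> simp_all
    exact hred Z 4 5 3 _ (by decide) (by decide) (by decide) v4 w4 hb

/-- The first `p` coordinates are kept as parameters, and the other seven coordinates of `D` form
the frame. Labels are kinds, of which there are finitely many; the classes of atoms with a given
half of red are available because the complex algebra contains all sets of atoms. -/
theorem not_SNr_Cm_At_simSetAlg (hc : IsUniversal c) :
    ¬ SNr.{u, 0} (p + 3) 4 (Cm (At (simSetAlg hc))) := by
  intro hS
  have hcone := hc.exists_cone
  choose u hu huc using hcone
  choose a ha hua using fun t => (genuine_of_cone (huc t)).exists_atom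
  let rep : (At (simSetAlg hc)).carrier → Fin (p + 3) → ℕ := fun a => (hc.atom_spec a.2).1.choose
  have hrep : ∀ a, rep a ∈ a.1.1 := fun a => (hc.atom_spec a.2).1.choose_spec
  -- Away from the apex all edges of either pattern are white, so the tints cannot be distinguished.
  have hsim : ∀ (t s : Fin 6) N, Sim c N {Fin.natAdd p 2}ᶜ (u t) (u s) := by
    refine fun t s N => ⟨fun i _ j _ => by rw [(hu t).eq_iff, (hu s).eq_iff], ?_⟩
    intro e x y he hx hy hp
    have hp' : Proper e x y := Proper.of_map hp
    rw [huc t e x y hp, huc s e x y (hp'.map (hu s))]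
    have hne : ∀ i : Fin (p + 3), i ∈ ({Fin.natAdd p 2}ᶜ : Set (Fin (p + 3))) → i.1 ≠ p + 2 :=
      fun i hi h => hi (Fin.ext h)
    simp [conePattern, hne x hx, hne y hy]
  have htup : ∀ t x, x ≠ 2 → tupleLabel c (rep ⟨a t, ha t⟩) x 2 =
      some (conePattern p t (fun i => i) (p + x) (p + 2)).kind := by
    intro t x hx
    have h1 : tupleLabel c (rep ⟨a t, ha t⟩) x 2 = tupleLabel c (u t) x 2 :=
      (tupleLabel_congr (D := Set.univ) (((hc.atom_spec (ha t)).2 _ (hua t)).2 _ |>.1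
        (hrep ⟨a t, ha t⟩)) (fun _ => trivial) trivial trivial).symm
    have h2 : Proper (u t ∘ Fin.castAdd 3) (u t (Fin.natAdd p x)) (u t (Fin.natAdd p 2)) := by
      refine Proper.map (hu t) ⟨Fin.castAdd_injective _ _, fun h => hx ?_, fun i h => ?_,
        fun i h => ?_⟩
      · simpa using h
      · have h1 := congrArg Fin.val h
        have h2 := i.2
        simp at h1
        omega
      · have h1 := congrArg Fin.val h
        have h2 := i.2
        simp at h1
        omega
    rw [h1, tupleLabel, if_pos h2, huc _ _ _ _ h2]
    rfl
  obtain ⟨F, A, e, he, htri, U, hU, hext⟩ := hS.exists_labelling (ι := Fin 7) (κ := Fin 3)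
    (by simp) (φ := fun j => ⟨p + j, by omega⟩) (fun i j h => by simpa [Fin.ext_iff] using h)
    (inn := Fin.castLE (by omega)) (Fin.castLE_injective _) (pos := Fin.natAdd p)
    (fun x => rfl)
    (fun i hi => by
      have h1 : 3 ≤ i.1 := by
        by_contra h
        exact hi ⟨i, by omega⟩ rfl
      exact ⟨⟨i - 3, by omega⟩, Fin.ext (by simp; omega)⟩)
    (k₀ := 0) (k₁ := 1) (k₂ := 2) (by decide) (by decide) (by decide)
    (fun a => tupleLabel c (rep a))
    (by
      intro z x y a b _ hzx hzy hT
      refine tupleLabel_congr (sim_of_le_c hc b.2 (hrep a) (hrep b) hT) (fun i h => ?_)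
        (fun h => hzx ?_) (fun h => hzy ?_)
      · have h1 := congrArg Fin.val h
        have h2 := i.2
        simp at h1
        omega
      · simpa using h.symm
      · simpa using h.symm)
    (by
      intro x x' y a _ _ hE
      have h1 : rep a (Fin.natAdd p x) = rep a (Fin.natAdd p x') := hE (hrep a)
      unfold tupleLabel
      rw [h1])
    (by
      intro x y y' a _ _ hE
      have h1 : rep a (Fin.natAdd p y) = rep a (Fin.natAdd p y') := hE (hrep a)
      unfold tupleLabel
      rw [h1])
    2 (fun t => ⟨a t, ha t⟩) (0 : Fin 6)
    (hc.le_c_of_sim (ha 0) (ha 0) (hua 0) (hua 0) fun N => Sim.refl _ _ _ _)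
    (fun b t hb => hc.le_c_of_sim b.2 (ha t) (hrep b) (hua t) fun N =>
      (sim_of_le_c hc (ha 0) (hrep b) (hua 0) hb N).trans (hsim 0 t N))
  have tri : ∀ V i j k k₁ k₂ k₃, i ≠ j → i ≠ k → j ≠ k → e V i j = some k₁ → e V i k = some k₂ →
      e V j k = some k₃ → ∃ a b d : EdgeCol, a.kind = k₁ ∧ b.kind = k₂ ∧ d.kind = k₃ ∧ Ok a b d ∧
        d ≠ red none := by
    intro V i j k k₁ k₂ k₃ hij hik hjk h1 h2 h3
    obtain ⟨b, g1, g2, g3⟩ := htri V i j k hij hik hjk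
    exact exists_ok_of_tupleLabel hc.toIsColouring ((hc.atom_spec b.2).2 _ (hrep b)).1
      (g1.trans h1) (g2.trans h2) (g3.trans h3)
  refine false_of_labelling he ?_ ?_ (U := U) ?_ ?_ ?_
  · intro V i j t t' hij hi hj ht hi0 hi1 hj0 hj1
    have h0i : (0 : Fin 7) ≠ i := fun h => by subst h; exact absurd hi (by decide)
    have h0j : (0 : Fin 7) ≠ j := fun h => by subst h; exact absurd hj (by decide)
    have h1i : (1 : Fin 7) ≠ i := fun h => by subst h; exact absurd hi (by decide)
    have h1j : (1 : Fin 7) ≠ j := fun h => by subst h; exact absurd hj (by decide)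
    rcases hk : e V i j with _ | k
    · obtain ⟨b, g1, g2, g3⟩ := htri V 0 i j h0i h0j hij
      have h1 := eq_of_tupleLabel_eq_none (g1.trans hi0) (g2.trans hj0) (g3.trans hk)
      exact (ht (by simpa using h1)).elim
    · obtain ⟨a, b, d, ka, kb, kd, hok, hd⟩ := tri V 0 i j _ _ _ h0i h0j hij hi0 hj0 hk
      obtain ⟨a', b', d', ka', kb', kd', hok', -⟩ := tri V 1 i j _ _ _ h1i h1j hij hi1 hj1 hk
      obtain rfl := eq_green_of_kind_eq ka
      obtain rfl := eq_green_of_kind_eq kb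
      obtain rfl := eq_green_of_kind_eq ka'
      obtain rfl := eq_green_of_kind_eq kb'
      -- A green edge would complete a green triangle, `white l` is excluded by the base node `l`,
      -- and `none` does not occur in atoms; a genuine red remains.
      rcases d with ⟨l, s⟩ | l | (_ | ⟨m, b⟩)
      · exact (hok.ggg 0 0 l rfl rfl rfl).elim
      · obtain rfl := eq_white_of_kind_eq (kd'.trans kd.symm)
        fin_cases l
        · exact (hok.ggw 0 rfl rfl rfl).elim
        · exact (hok'.ggw 1 rfl rfl rfl).elim
      · exact (hd rfl).elim
      · exact ⟨b, by rw [← kd]; rfl⟩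
  · intro V i j k b hij hik hjk h1 h2 h3
    obtain ⟨a₁, a₂, a₃, k1, k2, k3, hok, -⟩ := tri V i j k _ _ _ hij hik hjk h1 h2 h3
    obtain ⟨m₁, rfl⟩ := eq_red_of_kind_eq k1
    obtain ⟨m₂, rfl⟩ := eq_red_of_kind_eq k2
    obtain ⟨m₃, rfl⟩ := eq_red_of_kind_eq k3
    rcases hok.rrr _ _ _ rfl rfl rfl with h | h | h <;> exact h.2 rfl
  · exact (hU 0 (by decide)).trans ((htup 0 0 (by decide)).trans (by simp [conePattern, kind]))
  · exact (hU 1 (by decide)).trans ((htup 0 1 (by decide)).trans (by simp [conePattern, kind]))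
  · intro t
    obtain ⟨V, hV, hVt⟩ := hext 3 (by decide) t
    exact ⟨V, hV, (hVt 0 (by decide)).trans ((htup t 0 (by decide)).trans
        (by simp [conePattern, kind])),
      (hVt 1 (by decide)).trans ((htup t 1 (by decide)).trans (by simp [conePattern, kind]))⟩

end Cyl

theorem theorem3 (n : ℕ) (hn : 3 ≤ n) :
    -- the rainbow algebra is not in `S Nr_n CA_{n+4}`
    ¬ Cyl.SNr.{u, 0} n 4 (Cyl.rainbowCA n (n + 2) (n + 1)) ∧
    -- some representable atomic algebra has a completion outside `S Nr_n CA_{n+4}`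
    (∃ B C : Cyl.Alg.{0} n, Cyl.Representable B ∧ IsAtomic B.carrier ∧
      Cyl.IsCompletion B C ∧ ¬ Cyl.SNr.{u, 0} n 4 C) ∧
    -- `S Nr_n CA_{n+4}` is not atom-canonical
    ¬ Cyl.AtomCanonical (Cyl.SNr.{u, 0} n 4) := by
  obtain ⟨p, rfl⟩ := Nat.exists_eq_add_of_le' hn
  obtain ⟨c, hc⟩ := Cyl.exists_isUniversal p
  have hB : Cyl.IsCA (Cyl.simSetAlg hc) := Cyl.isEmbedding_subtype.isCA (Cyl.isCA_setAlg _ _)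
  have hat : IsAtomic (Cyl.simSetAlg hc).carrier := hc.isAtomic
  exact ⟨Cyl.not_SNr_rainbowCA _ hn,
    ⟨Cyl.simSetAlg hc, Cyl.Cm (Cyl.At (Cyl.simSetAlg hc)), Cyl.representable_subSetAlg, hat,
      hB.isCompletion_Cm_At, Cyl.not_SNr_Cm_At_simSetAlg hc⟩,
    fun h => Cyl.not_SNr_Cm_At_simSetAlg hc (h _ (Cyl.sNr_subSetAlg 4) hat)⟩
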